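/- **Setting.** Let $X_0$ be a real Hilbert space of dimension $n\ge 1$ and $A_0:X_0\to X_0$ an invertible linear operator with $\sigma(A_0)=\{\lambda_1^0<\dots<\lambda_n^0\}$, $\lambda_1^0>0$. Let $\varepsilon_0>0$ and, for $\varepsilon\in(0,\varepsilon_0]$, let $A_\varepsilon:D(A_\varepsilon)\subset X_\varepsilon\to X_\varepsilon$ be an invertible positive self-adjoint operator with compact resolvent on a real Hilbert space $X_\varepsilon$. Fix $\alpha\in(0,1)$ and let $X_\varepsilon^\alpha=D(A_\varepsilon^\alpha)$ with norm $\|u\|_{X_\varepsilon^\alpha}=\|A_\varepsilon^\alpha u\|_{X_\varepsilon}$. Let $f_0:X_0\to X_0$ and $f_\varepsilon:X_\varepsilon^\alpha\to X_\varepsilon$ be $C^1$, with $f_\varepsilon$ bounded and globally Lipschitz, with constants independent of $\varepsilon$. Let $T_0(t)$ be the solution semigroup of $\dot u+A_0u=f_0(u)$ on $X_0$ and $T_\varepsilon(t)$ the continuous nonlinear semigroup on $X_\varepsilon^\alpha$ given by the variation of constants formula for $u_t+A_\varepsilon u=f_\varepsilon(u)$; assume that they have global attractors $\mathcal A_0$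 and $\mathcal A_\varepsilon$, and that the $\mathcal A_\varepsilon$ are bounded in $X^\alpha_\varepsilon$ uniformly in $\varepsilon$. Let $E_\varepsilon:X_0\to X_\varepsilon^\alpha$ and $M_\varepsilon:X_\varepsilon\to X_0$ be bounded linear operators such that $M_\varepsilon E_\varepsilon=I_{X_0}$, $\|E_\varepsilon u\|_{X_\varepsilon}\to\|u\|_{X_0}$ as $\varepsilon\to0$ for each $u\in X_0$, and the norms of $E_\varepsilon$ in $\mathcal L(X_0,X_\varepsilon)$ and $\mathcal L(X_0,X_\varepsilon^\alpha)$ and of $M_\varepsilon$ in $\mathcal L(X_\varepsilon,X_0)$ and $\mathcal L(X_\varepsilon^\alpha,X_0)$ are bounded independently of $\varepsilon$. Say that $u^\varepsilon$ E-converges to $u^0\in X_0$ if $\|u^\varepsilon-E_\varepsilon u^0\|_{X_\varepsilon^\alpha}\to0$ as $\varepsilon\to 0$. Assume that $A_\varepsilon^{-1}$ converges compactly to $A_0^{-1}$: (i) if $u^\varepsilon$ E-converges to $u^0$, then $A_\varepsilon^{-1}u^\varepsilon$ E-converges to $A_0^{-1}u^0$; (ii) if $\|u^\varepsilon\|_{X_\varepsilon^\alpha}=1$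 for all $\varepsilon$, then every sequence $A_{\varepsilon_k}^{-1}u^{\varepsilon_k}$ with $\varepsilon_k\to0$ has an E-convergent subsequence. Let $\tau,\rho:[0,\varepsilon_0]\to[0,\infty)$ be increasing functions with $\tau(0)=\rho(0)=0$ such that, with a constant $K$ independent of $\varepsilon$, $$\|A_\varepsilon^{-1}-E_\varepsilon A_0^{-1}M_\varepsilon\|_{\mathcal L(X_\varepsilon,X_\varepsilon^\alpha)}\le\tau(\varepsilon),\qquad \|f_\varepsilon(u)-E_\varepsilon f_0(u^0)\|_{X_\varepsilon}\le K\|u-E_\varepsilon u^0\|_{X_\varepsilon^\alpha}+\rho(\varepsilon)$$ for all $u\in X_\varepsilon^\alpha$, $u^0\in X_0$. Fix $\delta>0$. Let $Q_\varepsilon$ be the spectral projection of $A_\varepsilon$ associated with the eigenvalues in $(\lambda_1^0-\delta,\lambda_n^0+\delta)$, $Y_\varepsilon=Q_\varepsilon X_\varepsilon^\alpha$ and $Z_\varepsilon=(I-Q_\varepsilon)X_\varepsilon^\alpha$. An invariant-manifold map is a bounded Lipschitz map $s:Y_\varepsilon\to Z_\varepsilon$ such that through each point of the graph $\{v+s(v):v\in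 Y_\varepsilon\}$ there is a global solution of $T_\varepsilon(\cdot)$ that stays in the graph for all $t\in\mathbb R$. For such an $s$, the reduced semigroup $\tilde T_\varepsilon(t)$ on $Y_\varepsilon$ is the solution semigroup of $\dot v+A_\varepsilon v=Q_\varepsilon f_\varepsilon(v+s(v))$. Write $\tilde T_\varepsilon=\tilde T_\varepsilon(1)$ and $T_0=T_0(1)$, and let $d_\varepsilon$ be the Hausdorff distance of subsets of $X_\varepsilon^\alpha$. **Theorem.** There are constants $C>0$ and $\varepsilon_1\in(0,\varepsilon_0]$, independent of $\varepsilon$, such that for every $\varepsilon\in(0,\varepsilon_1]$ the following hold. 1. An invariant-manifold map $s$ exists, and for every such $s$ the reduced semigroup exists and $$\|\tilde T_\varepsilon w-E_\varepsilon T_0M_\varepsilon w\|_{X_\varepsilon^\alpha}\le C(\tau(\varepsilon)+\rho(\varepsilon))(1+\|w\|_{X_\varepsilon^\alpha})\qquad\text{for all } w\in Y_\varepsilon.$$ 2. For all $w^\varepsilon\in\mathcal A_\varepsilon$ and $w^0\in\mathcal A_0$, $$\|E_\varepsilon T_0M_\varepsilon Q_\varepsilon w^\varepsilon-E_\varepsilon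 T_0w^0\|_{X_\varepsilon^\alpha}\le C\|Q_\varepsilon w^\varepsilon-E_\varepsilon w^0\|_{X_\varepsilon^\alpha}.$$ 3. $d_\varepsilon(\mathcal A_\varepsilon,E_\varepsilon\mathcal A_0)\le C(\tau(\varepsilon)+\rho(\varepsilon))+d_\varepsilon(Q_\varepsilon\mathcal A_\varepsilon,E_\varepsilon\mathcal A_0)$. -/

import Mathlib

open Set Filter Topology

noncomputable section

namespace AttractorRate

universe u

/-- A positive self-adjoint (in general unbounded) operator `A : D(A) ⊂ X → X` on a real Hilbert
space which is boundedly invertible with compact inverse, i.e. an invertible positive self-adjoint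
operator with compact resolvent. -/
structure PosSelfAdjoint (X : Type u) [NormedAddCommGroup X] [InnerProductSpace ℝ X]
    [CompleteSpace X] where
  toLinearPMap : X →ₗ.[ℝ] X
  isSelfAdjoint : IsSelfAdjoint toLinearPMap
  pos : ∀ x : toLinearPMap.domain, x ≠ 0 → 0 < inner ℝ (toLinearPMap x) (x : X)
  exists_compact_inverse : ∃ R : X →L[ℝ] X, IsCompactOperator R ∧
    (∀ x : X, (R x, x) ∈ toLinearPMap.graph) ∧
    ∀ x : toLinearPMap.domain, R (toLinearPMap x) = x

namespace PosSelfAdjoint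

variable {X : Type u} [NormedAddCommGroup X] [InnerProductSpace ℝ X] [CompleteSpace X]
variable (A : PosSelfAdjoint X)

/-- The bounded inverse `A⁻¹ : X → X`. -/
def inv : X →L[ℝ] X := A.exists_compact_inverse.choose

theorem isCompactOperator_inv : IsCompactOperator A.inv :=
  A.exists_compact_inverse.choose_spec.1

theorem inv_graph (x : X) : (A.inv x, x) ∈ A.toLinearPMap.graph :=
  A.exists_compact_inverse.choose_spec.2.1 x

theorem inv_apply (x : A.toLinearPMap.domain) : A.inv (A.toLinearPMap x) = x :=
  A.exists_compact_inverse.choose_spec.2.2 x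

/-- The eigenspace `{x ∈ D(A) : A x = μ x}` (it is `0` unless `μ` is an eigenvalue). -/
def eigenspace (μ : ℝ) : Submodule ℝ X where
  carrier := {x | (x, μ • x) ∈ A.toLinearPMap.graph}
  add_mem' := fun {x y} hx hy => by
    have h := A.toLinearPMap.graph.add_mem hx hy
    simpa [smul_add] using h
  zero_mem' := by
    change ((0 : X), μ • (0 : X)) ∈ A.toLinearPMap.graph
    rw [smul_zero]
    exact A.toLinearPMap.graph.zero_mem
  smul_mem' := fun c x hx => by
    have h := A.toLinearPMap.graph.smul_mem c hx
    simpa [smul_comm μ c x] using h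

theorem mem_eigenspace {μ : ℝ} {x : X} :
    x ∈ A.eigenspace μ ↔ (x, μ • x) ∈ A.toLinearPMap.graph := Iff.rfl

/-- The spectral subspace of `A` for a set `I` of real numbers: the closed linear span of all
eigenvectors of `A` with eigenvalue in `I`. -/
def specSubspace (I : Set ℝ) : Submodule ℝ X :=
  (⨆ μ ∈ I, A.eigenspace μ).topologicalClosure

instance (I : Set ℝ) : CompleteSpace (A.specSubspace I) :=
  inferInstanceAs (CompleteSpace ((⨆ μ ∈ I, A.eigenspace μ).topologicalClosure))

/-- The spectral projection of `A` for a set `I` of real numbers: the orthogonal projection of `X`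
onto the spectral subspace. For `I = {μ}` it is the orthogonal projection onto the eigenspace; for
an interval with endpoints outside the spectrum it is the Riesz projection of a contour that cuts
the real axis in the endpoints of that interval. -/
def specProj (I : Set ℝ) : X →L[ℝ] X := (A.specSubspace I).starProjection

/-- The domain `D(A^α) = {x : ∑_μ μ^{2α} ‖P_μ x‖² < ∞}` of the fractional power, where `P_μ` is the
orthogonal projection onto the eigenspace of `μ`. -/
def MemFrac (α : ℝ) (x : X) : Prop :=
  Summable fun μ : ℝ => μ ^ (2 * α) * ‖A.specProj {μ} x‖ ^ 2

theorem inner_graph {x y x' y' : X} (h : (x, x') ∈ A.toLinearPMap.graph)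
    (h' : (y, y') ∈ A.toLinearPMap.graph) : inner ℝ x' y = inner ℝ x y' := by
  rw [LinearPMap.mem_graph_iff] at h h'
  obtain ⟨a, rfl, rfl⟩ := h
  obtain ⟨b, rfl, rfl⟩ := h'
  have hd : Dense (A.toLinearPMap.domain : Set X) := A.isSelfAdjoint.dense_domain
  have hf := LinearPMap.adjoint_isFormalAdjoint (T := A.toLinearPMap) hd
  have hs : A.toLinearPMap.adjoint = A.toLinearPMap :=
    LinearPMap.isSelfAdjoint_def.1 A.isSelfAdjoint
  rw [hs] at hf
  exact hf a b

theorem pos_graph {x y : X} (h : (x, y) ∈ A.toLinearPMap.graph) (hx : x ≠ 0) :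
    0 < inner ℝ y x := by
  rw [LinearPMap.mem_graph_iff] at h
  obtain ⟨a, rfl, rfl⟩ := h
  exact A.pos a (fun h0 => hx (by simp [h0]))

theorem eigenvalue_pos {μ : ℝ} {x : X} (h : x ∈ A.eigenspace μ) (hx : x ≠ 0) : 0 < μ := by
  have h1 := A.pos_graph h hx
  rw [real_inner_smul_left] at h1
  have h2 : 0 < inner ℝ x x := real_inner_self_pos.2 hx
  exact pos_of_mul_pos_left h1 h2.le

theorem eigenspace_isClosed (μ : ℝ) : IsClosed (A.eigenspace μ : Set X) := by
  have hc : IsClosed (A.toLinearPMap.graph : Set (X × X)) := A.isSelfAdjoint.isClosed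
  exact hc.preimage (f := fun x : X => (x, μ • x)) (by fun_prop)

theorem specSubspace_singleton (μ : ℝ) : A.specSubspace {μ} = A.eigenspace μ := by
  unfold specSubspace
  rw [iSup_singleton]
  exact (A.eigenspace_isClosed μ).submodule_topologicalClosure_eq

theorem specProj_mem (I : Set ℝ) (x : X) : A.specProj I x ∈ A.specSubspace I :=
  Submodule.starProjection_apply_mem _ _

theorem specProj_singleton_mem (μ : ℝ) (x : X) : A.specProj {μ} x ∈ A.eigenspace μ := by
  rw [← A.specSubspace_singleton]
  exact A.specProj_mem _ _

theorem isOrtho_eigenspace {μ ν : ℝ} (h : μ ≠ ν) : A.eigenspace μ ⟂ A.eigenspace ν := by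
  rw [Submodule.isOrtho_iff_inner_eq]
  intro x hx y hy
  have h1 := A.inner_graph hx hy
  rw [real_inner_smul_left, real_inner_smul_right] at h1
  have h2 : (μ - ν) * inner ℝ x y = 0 := by linarith
  exact (mul_eq_zero.1 h2).resolve_left (sub_ne_zero.2 h)

theorem orthogonalFamily : OrthogonalFamily ℝ (fun μ : ℝ => A.eigenspace μ)
    fun μ => (A.eigenspace μ).subtypeₗᵢ :=
  OrthogonalFamily.of_pairwise fun _ _ h => A.isOrtho_eigenspace h

theorem specProj_of_nonpos {μ : ℝ} (h : μ ≤ 0) (x : X) : A.specProj {μ} x = 0 := by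
  by_contra hne
  exact absurd (A.eigenvalue_pos (A.specProj_singleton_mem μ x) hne) (not_lt.2 h)

theorem summable_norm_sq_specProj (x : X) : Summable fun μ : ℝ => ‖A.specProj {μ} x‖ ^ 2 := by
  refine summable_of_sum_le (c := ‖x‖ ^ 2) (fun μ => by positivity) fun s => ?_
  have h1 : ‖∑ μ ∈ s, A.specProj {μ} x‖ ^ 2 = ∑ μ ∈ s, ‖A.specProj {μ} x‖ ^ 2 :=
    A.orthogonalFamily.norm_sum (fun μ => ⟨A.specProj {μ} x, A.specProj_singleton_mem μ x⟩) s
  have h2 : inner ℝ (∑ μ ∈ s, A.specProj {μ} x) x = ∑ μ ∈ s, ‖A.specProj {μ} x‖ ^ 2 := by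
    rw [sum_inner]
    refine Finset.sum_congr rfl fun μ _ => ?_
    have h3 := Submodule.re_inner_starProjection_eq_normSq (𝕜 := ℝ) (A.specSubspace {μ}) x
    exact h3
  have h4 := real_inner_le_norm (∑ μ ∈ s, A.specProj {μ} x) x
  rw [h2, ← h1] at h4
  rw [← h1]
  nlinarith [norm_nonneg (∑ μ ∈ s, A.specProj {μ} x), norm_nonneg x]

theorem specProj_graph {x y : X} (h : (x, y) ∈ A.toLinearPMap.graph) (μ : ℝ) :
    A.specProj {μ} y = μ • A.specProj {μ} x := by
  refine Submodule.eq_starProjection_of_mem_of_inner_eq_zero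
    (Submodule.smul_mem _ _ (A.specProj_mem _ _)) fun w hw => ?_
  have hw' : w ∈ A.eigenspace μ := by rwa [← A.specSubspace_singleton]
  have h1 := A.inner_graph h hw'
  have h2 : inner ℝ (x - A.specProj {μ} x) w = 0 :=
    Submodule.starProjection_inner_eq_zero x w hw
  rw [inner_sub_left] at h2 ⊢
  rw [real_inner_smul_left, h1, real_inner_smul_right]
  linear_combination μ * h2

theorem memFrac_of_graph {α : ℝ} (hα : α ∈ Ioo (0 : ℝ) 1) {x y : X}
    (h : (x, y) ∈ A.toLinearPMap.graph) : A.MemFrac α x := by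
  refine Summable.of_nonneg_of_le (fun μ => ?_) (fun μ => ?_)
    ((A.summable_norm_sq_specProj x).add (A.summable_norm_sq_specProj y))
  · by_cases hμ : 0 < μ
    · positivity
    · simp [A.specProj_of_nonpos (not_lt.1 hμ)]
  · by_cases hμ : 0 < μ
    · rw [A.specProj_graph h, norm_smul, mul_pow, ← one_add_mul]
      refine mul_le_mul_of_nonneg_right ?_ (by positivity)
      rw [Real.norm_eq_abs, sq_abs]
      obtain ⟨h0, h1⟩ := hα
      rcases le_total μ 1 with h2 | h2
      · have := Real.rpow_le_one hμ.le h2 (by linarith : 0 ≤ 2 * α)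
        nlinarith [sq_nonneg μ]
      · have := Real.rpow_le_rpow_of_exponent_le h2 (by push_cast; linarith : 2 * α ≤ (2 : ℕ))
        rw [Real.rpow_natCast] at this
        linarith
    · simp [A.specProj_of_nonpos (not_lt.1 hμ)]

theorem memFrac_iff {α : ℝ} {x : X} :
    A.MemFrac α x ↔ Summable fun μ : ℝ => μ ^ α • A.specProj {μ} x := by
  have h := A.orthogonalFamily.summable_iff_norm_sq_summable
    (fun μ => ⟨μ ^ α • A.specProj {μ} x,
      Submodule.smul_mem _ _ (A.specProj_singleton_mem μ x)⟩)
  refine Iff.trans ?_ h.symm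
  unfold MemFrac
  refine summable_congr fun μ => ?_
  by_cases hμ : 0 < μ
  · change μ ^ (2 * α) * ‖A.specProj {μ} x‖ ^ 2 = ‖μ ^ α • A.specProj {μ} x‖ ^ 2
    rw [norm_smul, mul_pow, Real.norm_eq_abs, sq_abs, ← Real.rpow_natCast (μ ^ α),
      ← Real.rpow_mul hμ.le]
    congr 2
    push_cast
    ring
  · have h0 := A.specProj_of_nonpos (not_lt.1 hμ) x
    change μ ^ (2 * α) * ‖A.specProj {μ} x‖ ^ 2 = ‖μ ^ α • A.specProj {μ} x‖ ^ 2
    simp [h0]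

theorem memFrac_specProj {α : ℝ} {x : X} (I : Set ℝ) (h : A.MemFrac α x) :
    A.MemFrac α (A.specProj I x) := by
  refine Summable.of_norm_bounded h fun μ => ?_
  have hle : ‖A.specProj {μ} (A.specProj I x)‖ ≤ ‖A.specProj {μ} x‖ := by
    by_cases hμ : μ ∈ I
    · have hsub : A.specSubspace {μ} ≤ A.specSubspace I := by
        rw [A.specSubspace_singleton]
        exact (le_iSup₂_of_le (f := fun ν (_ : ν ∈ I) => A.eigenspace ν) μ hμ le_rfl).trans
          (Submodule.le_topologicalClosure (⨆ ν ∈ I, A.eigenspace ν))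
      have := Submodule.starProjection_comp_starProjection_of_le hsub
      have h2 := congrArg (fun T : X →L[ℝ] X => T x) this
      exact le_of_eq (congrArg norm h2)
    · have hort : A.specSubspace {μ} ⟂ A.specSubspace I := by
        rw [A.specSubspace_singleton]
        unfold specSubspace
        rw [Submodule.IsOrtho, Submodule.orthogonal_closure]
        change A.eigenspace μ ⟂ _
        simp only [Submodule.isOrtho_iSup_right]
        exact fun ν hν => A.isOrtho_eigenspace (fun h => hμ (h ▸ hν))
      have := hort.starProjection_comp_starProjection
      have h2 := congrArg (fun T : X →L[ℝ] X => T x) this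
      have h3 : A.specProj {μ} (A.specProj I x) = 0 := h2
      simp [h3]
  by_cases hμ : 0 < μ
  · rw [Real.norm_of_nonneg (by positivity)]
    gcongr
  · simp [A.specProj_of_nonpos (not_lt.1 hμ)]

theorem eq_zero_of_specProj {x : X} (h : ∀ μ : ℝ, A.specProj {μ} x = 0) : x = 0 := by
  have hsym : (A.inv : X →ₗ[ℝ] X).IsSymmetric := fun y z =>
    (A.inner_graph (A.inv_graph y) (A.inv_graph z)).symm
  have hbot := ContinuousLinearMap.orthogonalComplement_iSup_eigenspaces_eq_bot
    A.isCompactOperator_inv hsym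
  have hx : x ∈ (⨆ ν, Module.End.eigenspace (A.inv : X →ₗ[ℝ] X) ν)ᗮ := by
    rw [← Submodule.iInf_orthogonal, Submodule.mem_iInf]
    intro ν
    rw [Submodule.mem_orthogonal]
    intro y hy
    have hy' : A.inv y = ν • y := Module.End.mem_eigenspace_iff.1 hy
    by_cases hν : ν = 0
    · have h0 := A.inv_graph y
      rw [hy', hν, zero_smul] at h0
      have : y = 0 := LinearPMap.graph_fst_eq_zero_snd _ h0 rfl
      simp [this]
    · have h1 : y ∈ A.eigenspace ν⁻¹ := by
        have h0 := A.toLinearPMap.graph.smul_mem ν⁻¹ (A.inv_graph y)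
        rw [hy'] at h0
        simpa [mem_eigenspace, smul_smul, hν] using h0
      have h2 : y ∈ A.specSubspace {ν⁻¹} := by rwa [A.specSubspace_singleton]
      have h3 : x ∈ (A.specSubspace {ν⁻¹})ᗮ :=
        (Submodule.starProjection_apply_eq_zero_iff _).1 (h ν⁻¹)
      exact (Submodule.mem_orthogonal _ _).1 h3 y h2
  rw [hbot] at hx
  simpa using hx

/-- `D(A^α)` as a linear subspace of `X`. -/
def fracDomain (α : ℝ) : Submodule ℝ X where
  carrier := {x | A.MemFrac α x}
  add_mem' := fun {x y} hx hy => by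
    have h := (A.memFrac_iff.1 hx).add (A.memFrac_iff.1 hy)
    refine A.memFrac_iff.2 ?_
    simpa only [map_add, smul_add] using h
  zero_mem' := by simp [MemFrac, summable_zero]
  smul_mem' := fun c x hx => by
    have h := (A.memFrac_iff.1 hx).const_smul c
    refine A.memFrac_iff.2 ?_
    simpa only [map_smul, smul_comm c] using h

/-- The fractional power `A^α x = ∑_μ μ^α P_μ x`, `x ∈ D(A^α)`. -/
def fracPow (α : ℝ) : A.fracDomain α →ₗ[ℝ] X where
  toFun x := ∑' μ : ℝ, μ ^ α • A.specProj {μ} (x : X)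
  map_add' x y := by
    rw [← (A.memFrac_iff.1 x.2).tsum_add (A.memFrac_iff.1 y.2)]
    simp only [Submodule.coe_add, map_add, smul_add]
  map_smul' c x := by
    rw [RingHom.id_apply, ← (A.memFrac_iff.1 x.2).tsum_const_smul c]
    simp only [Submodule.coe_smul, map_smul, smul_comm c]

theorem fracPow_injective (α : ℝ) : Function.Injective (A.fracPow α) := by
  rw [← LinearMap.ker_eq_bot, LinearMap.ker_eq_bot']
  intro x hx
  have hsum := A.memFrac_iff.1 x.2
  refine Subtype.ext (A.eq_zero_of_specProj fun ν => ?_)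
  have h1 : A.specProj {ν} (A.fracPow α x) = ν ^ α • A.specProj {ν} (x : X) := by
    change A.specProj {ν} (∑' μ : ℝ, μ ^ α • A.specProj {μ} (x : X)) = _
    rw [(A.specProj {ν}).map_tsum hsum, tsum_eq_single ν]
    · rw [map_smul]
      congr 1
      exact Submodule.starProjection_eq_self_iff.2 (A.specProj_mem _ _)
    · intro μ hμ
      rw [map_smul]
      have : A.specProj {ν} (A.specProj {μ} (x : X)) = 0 := by
        refine (Submodule.starProjection_apply_eq_zero_iff _).2 ?_
        rw [A.specSubspace_singleton]
        exact (A.isOrtho_eigenspace hμ) (A.specProj_singleton_mem μ _)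
      rw [this, smul_zero]
  rw [hx, map_zero] at h1
  by_cases hν : 0 < ν
  · exact (smul_eq_zero.1 h1.symm).resolve_left (Real.rpow_pos_of_pos hν α).ne'
  · exact A.specProj_of_nonpos (not_lt.1 hν) _

/-- The fractional power space `X^α`: the space `D(A^α)` with the norm `‖x‖_α = ‖A^α x‖`. -/
def FracSpace (α : ℝ) : Type u := A.fracDomain α

namespace FracSpace

instance (α : ℝ) : AddCommGroup (A.FracSpace α) := inferInstanceAs (AddCommGroup (A.fracDomain α))

instance (α : ℝ) : Module ℝ (A.FracSpace α) := inferInstanceAs (Module ℝ (A.fracDomain α))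

instance (α : ℝ) : CoeOut (A.FracSpace α) X := ⟨fun x => Subtype.val x⟩

instance (α : ℝ) : NormedAddCommGroup (A.FracSpace α) :=
  NormedAddCommGroup.induced (A.FracSpace α) X (A.fracPow α) (A.fracPow_injective α)

instance (α : ℝ) : NormedSpace ℝ (A.FracSpace α) :=
  NormedSpace.induced ℝ (A.FracSpace α) X (A.fracPow α)

end FracSpace

/-- The inverse `A⁻¹` as a map `X → X^α`, `0 < α < 1`. -/
def invFrac {α : ℝ} (hα : α ∈ Ioo (0 : ℝ) 1) : X →ₗ[ℝ] A.FracSpace α :=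
  LinearMap.codRestrict (A.fracDomain α) (A.inv : X →ₗ[ℝ] X)
    fun x => A.memFrac_of_graph hα (A.inv_graph x)

/-- The spectral projection as a map `X^α → X^α`. -/
def fracProj (α : ℝ) (I : Set ℝ) : A.FracSpace α →ₗ[ℝ] A.FracSpace α :=
  LinearMap.restrict (A.specProj I : X →ₗ[ℝ] X) (p := A.fracDomain α) (q := A.fracDomain α)
    fun _ hx => A.memFrac_specProj I hx

/-- `Y = Q X^α`, where `Q` is the spectral projection for `I`. -/
def fracY (α : ℝ) (I : Set ℝ) : Submodule ℝ (A.FracSpace α) := LinearMap.range (A.fracProj α I)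

/-- `Z = (I - Q) X^α`, where `Q` is the spectral projection for `I`. -/
def fracZ (α : ℝ) (I : Set ℝ) : Submodule ℝ (A.FracSpace α) :=
  LinearMap.range (LinearMap.id - A.fracProj α I)

/-- The linear semigroup `e^{-A t} x = ∑_μ e^{-μ t} P_μ x`, `t ≥ 0`. -/
def expNeg (t : ℝ) (x : X) : X := ∑' μ : ℝ, Real.exp (-(μ * t)) • A.specProj {μ} x

/-- `T` is the nonlinear semigroup on `X^α` of the problem `u' + A u = f(u)`: a continuous semigroup
that satisfies the variation of constants formula (an identity in `X`). Only times `t ≥ 0` matter. -/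
structure IsSolutionSemigroup {α : ℝ} (f : A.FracSpace α → X)
    (T : ℝ → A.FracSpace α → A.FracSpace α) : Prop where
  zero : ∀ w, T 0 w = w
  add : ∀ t s, 0 ≤ t → 0 ≤ s → ∀ w, T (t + s) w = T t (T s w)
  continuousOn : ContinuousOn (fun p : ℝ × A.FracSpace α => T p.1 p.2) (Ici 0 ×ˢ univ)
  variation_of_constants : ∀ t, 0 < t → ∀ w,
    (T t w : X) = A.expNeg t (w : X) + ∫ r in (0 : ℝ)..t, A.expNeg (t - r) (f (T r w))

/-- The graph `{v + s(v) : v ∈ Y}` of a map `s : Y → Z`. -/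
def graphOf {α : ℝ} {I : Set ℝ} (s : A.fracY α I → A.fracZ α I) : Set (A.FracSpace α) :=
  range fun v : A.fracY α I => (v : A.FracSpace α) + (s v : A.FracSpace α)

/-- `S : ℝ → Y → Y` is the solution semigroup of the ordinary differential equation
`v' + A v = Q f(v + s(v))` in `Y`. Only times `t ≥ 0` matter. -/
def IsReducedSemigroup {α : ℝ} (f : A.FracSpace α → X) {I : Set ℝ}
    (s : A.fracY α I → A.fracZ α I) (S : ℝ → A.fracY α I → A.fracY α I) : Prop :=
  ∀ w : A.fracY α I, S 0 w = w ∧ ∀ t : ℝ, 0 ≤ t →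
    ∃ h : ((S t w : A.FracSpace α) : X) ∈ A.toLinearPMap.domain,
      HasDerivWithinAt (fun r : ℝ => ((S r w : A.FracSpace α) : X))
        (-A.toLinearPMap ⟨((S t w : A.FracSpace α) : X), h⟩ +
          A.specProj I (f ((S t w : A.FracSpace α) + (s (S t w) : A.FracSpace α)))) (Ici 0) t

end PosSelfAdjoint

section Dynamics

variable {V : Type u}

/-- `M` is an invariant manifold for `T` in the sense that through each point of `M` there is a
global solution of `T` that stays in `M`. -/
def IsInvariantManifold [TopologicalSpace V] (T : ℝ → V → V) (M : Set V) : Prop :=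
  ∀ w ∈ M, ∃ ξ : ℝ → V, Continuous ξ ∧ (∀ τ t : ℝ, 0 ≤ t → T t (ξ τ) = ξ (t + τ)) ∧
    ξ 0 = w ∧ ∀ t, ξ t ∈ M

/-- The Hausdorff semidistance `sup_{a ∈ S} inf_{b ∈ S'} ‖a - b‖`, with values in `[0, ∞]`. -/
def semidist [NormedAddCommGroup V] (S S' : Set V) : ENNReal :=
  ⨆ a ∈ S, Metric.infEDist a S'

/-- Global attractor: compact, invariant and attracting all bounded sets. -/
structure IsGlobalAttractor [NormedAddCommGroup V] (T : ℝ → V → V) (𝒜 : Set V) : Prop where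
  isCompact : IsCompact 𝒜
  invariant : ∀ t : ℝ, 0 ≤ t → T t '' 𝒜 = 𝒜
  attracts : ∀ B : Set V, Bornology.IsBounded B →
    Tendsto (fun t : ℝ => semidist (T t '' B) 𝒜) atTop (𝓝 0)

/-- `T` is the solution semigroup of the ordinary differential equation `u' + A₀ u = f₀(u)`.
Only times `t ≥ 0` matter. -/
def IsODESemigroup [NormedAddCommGroup V] [NormedSpace ℝ V] (A₀ : V ≃L[ℝ] V) (f₀ : V → V)
    (T : ℝ → V → V) : Prop :=
  ∀ w : V, T 0 w = w ∧ ∀ t : ℝ, 0 ≤ t →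
    HasDerivWithinAt (fun r : ℝ => T r w) (-A₀ (T t w) + f₀ (T t w)) (Ici 0) t

end Dynamics

universe v

/-- Compact convergence `A_ε⁻¹ → A₀⁻¹` as `ε → 0`: (i) if `u_ε` E-converges to `u₀`, i.e.
`‖u_ε - E_ε u₀‖_α → 0`, then `A_ε⁻¹ u_ε` E-converges to `A₀⁻¹ u₀`; (ii) if `‖u_ε‖_α = 1`, then every
sequence from the family `A_ε⁻¹ u_ε` with parameters tending to `0` has an E-convergent
subsequence. -/
def CompactlyConverges {X₀ : Type v} [NormedAddCommGroup X₀] [InnerProductSpace ℝ X₀]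
    {X : ℝ → Type u} [∀ ε, NormedAddCommGroup (X ε)] [∀ ε, InnerProductSpace ℝ (X ε)]
    [∀ ε, CompleteSpace (X ε)] (ε₀ : ℝ) (A : ∀ ε, PosSelfAdjoint (X ε)) (A₀ : X₀ ≃L[ℝ] X₀)
    {α : ℝ} (hα : α ∈ Ioo (0 : ℝ) 1) (E : ∀ ε, X₀ →L[ℝ] (A ε).FracSpace α) : Prop :=
  (∀ (u : ∀ ε, (A ε).FracSpace α) (u₀ : X₀),
    Tendsto (fun ε => ‖u ε - E ε u₀‖) (𝓝[>] 0) (𝓝 0) →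
    Tendsto (fun ε => ‖(A ε).invFrac hα (u ε : X ε) - E ε (A₀.symm u₀)‖) (𝓝[>] 0) (𝓝 0)) ∧
  ∀ u : ∀ ε, (A ε).FracSpace α, (∀ ε ∈ Ioc 0 ε₀, ‖u ε‖ = 1) →
    ∀ e : ℕ → ℝ, (∀ k, e k ∈ Ioc 0 ε₀) → Tendsto e atTop (𝓝 0) →
    ∃ φ : ℕ → ℕ, StrictMono φ ∧ ∃ u₀ : X₀,
      Tendsto (fun k => ‖(A (e (φ k))).invFrac hα (u (e (φ k)) : X (e (φ k))) - E (e (φ k)) u₀‖)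
        atTop (𝓝 0)

end AttractorRate

end

open AttractorRate

namespace AttractorRate

universe u

namespace PosSelfAdjoint

variable {X : Type u} [NormedAddCommGroup X] [InnerProductSpace ℝ X] [CompleteSpace X]
variable (A : PosSelfAdjoint X)

/-! ### Functional calculus -/

/-! Since `A⁻¹` is compact and symmetric, a vector is determined by its components in the
eigenspaces of `A`, and its norm is given by Parseval. Semigroup, fractional powers and resolvent
act there by scalars, so identities and bounds reduce to statements about one eigenvalue `μ`. The
only smoothing estimate is `μ^α e^{-μr} ≤ r^{-α} e^{-Lr/2}` for `μ ≥ L`, whose integral over `r > 0`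
is `Γ(1-α) (L/2)^{α-1}`.

Existence of the manifold. By compact convergence, eigenvalues of `A_ε` that stay bounded as `ε → 0`
can accumulate only at eigenvalues of `A₀`, which lie in the open interval `I`. Hence the
eigenvalues outside `I` exceed any prescribed bound for small `ε`
(`CompactlyConverges.exists_eigGE`). With so large a gap the Lyapunov-Perron operator contracts in
an exponentially weighted norm. Its fixed points are the backward mild solutions with bounded
component in `Z`; this class is invariant under translation along a global solution, which makes the
graph invariant (`GapData.exists_invariantManifold`).

Rates. For an eigenvalue `μ ≥ 2‖A₀‖` the resolvent estimate forces `μ^{α-1} ≤ (1+2K²) τ`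
(`Connection.rpow_le_of_large`). The same power `α-1` occurs in the smoothing integral. Therefore a
point with arbitrarily long backward orbits of bounded `Z` component has `Z` component of order `τ`
itself, with no loss in the exponent (`Connection.norm_sub_fracProj_le`). This applies to every
invariant graph and to the attractor; for the latter, the triangle inequality through `Q 𝒜` gives
the third claim.

For the first claim let `v` be a reduced trajectory, `u₀` the limit trajectory from `M w`, and `d =
M v - u₀`. The derivative of `d` is a linear term in `d` plus the defects `A₀Mv - MAv`, `M(1-Q)f`
and the size of `s`, all `O(τ)`, and the error `ρ` of the nonlinearity. Gronwall bounds `d`, and `v`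
is close to `E M v` because `A v` is bounded on `Y`. The second claim is the Lipschitz continuity on
bounded sets of the time-one map of an ordinary differential equation with bounded `C^1`
nonlinearity. -/

/-- `μ` is an eigenvalue of `A`. -/
def IsEig (μ : ℝ) : Prop := ∃ x ∈ A.eigenspace μ, x ≠ 0

variable {A} in
theorem IsEig.pos {μ : ℝ} (h : A.IsEig μ) : 0 < μ := by
  obtain ⟨x, hx, h0⟩ := h
  exact A.eigenvalue_pos hx h0

theorem isEig_of_specProj_ne_zero {μ : ℝ} {x : X} (h : A.specProj {μ} x ≠ 0) : A.IsEig μ :=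
  ⟨_, A.specProj_singleton_mem μ x, h⟩

theorem specProj_eq_zero {μ : ℝ} (h : ¬ A.IsEig μ) (x : X) : A.specProj {μ} x = 0 := by
  by_contra h0
  exact h (A.isEig_of_specProj_ne_zero h0)

theorem specProj_apply_of_mem_eigenspace {μ : ℝ} {x : X} (h : x ∈ A.eigenspace μ) :
    A.specProj {μ} x = x :=
  Submodule.starProjection_eq_self_iff.2 (by rwa [A.specSubspace_singleton])

theorem specProj_apply_of_mem_eigenspace_ne {μ ν : ℝ} (hne : μ ≠ ν) {x : X}
    (h : x ∈ A.eigenspace μ) : A.specProj {ν} x = 0 := by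
  refine (Submodule.starProjection_apply_eq_zero_iff _).2 ?_
  rw [A.specSubspace_singleton]
  exact (A.isOrtho_eigenspace hne) h

/-- Each eigenspace lies inside the spectral subspace of `I` or is orthogonal to it. -/
theorem specProj_singleton_specProj (I : Set ℝ) (μ : ℝ) (x : X) :
    A.specProj {μ} (A.specProj I x) = I.indicator (fun _ => (1 : ℝ)) μ • A.specProj {μ} x := by
  by_cases hμ : μ ∈ I
  · have hsub : A.specSubspace {μ} ≤ A.specSubspace I := by
      rw [A.specSubspace_singleton]
      exact (le_iSup₂_of_le (f := fun ν (_ : ν ∈ I) => A.eigenspace ν) μ hμ le_rfl).trans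
        (Submodule.le_topologicalClosure (⨆ ν ∈ I, A.eigenspace ν))
    have := Submodule.starProjection_comp_starProjection_of_le hsub
    have h2 := congrArg (fun T : X →L[ℝ] X => T x) this
    rw [indicator_of_mem hμ, one_smul]
    exact h2
  · have hort : A.specSubspace {μ} ⟂ A.specSubspace I := by
      rw [A.specSubspace_singleton]
      unfold specSubspace
      rw [Submodule.IsOrtho, Submodule.orthogonal_closure]
      change A.eigenspace μ ⟂ _
      simp only [Submodule.isOrtho_iSup_right]
      exact fun ν hν => A.isOrtho_eigenspace (fun h => hμ (h ▸ hν))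
    have := hort.starProjection_comp_starProjection
    have h2 := congrArg (fun T : X →L[ℝ] X => T x) this
    rw [indicator_of_notMem hμ, zero_smul]
    exact h2

/-- The basic device: identities between operators, series and integrals are checked one eigenvalue
at a time, where they become scalar. -/
theorem ext_specProj {x y : X} (h : ∀ μ : ℝ, A.specProj {μ} x = A.specProj {μ} y) : x = y := by
  rw [← sub_eq_zero]
  refine A.eq_zero_of_specProj fun μ => ?_
  rw [map_sub, h, sub_self]

theorem ext_specProj_of_isEig {x y : X}
    (h : ∀ μ : ℝ, A.IsEig μ → A.specProj {μ} x = A.specProj {μ} y) : x = y := by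
  refine A.ext_specProj fun μ => ?_
  by_cases hμ : A.IsEig μ
  · exact h μ hμ
  · rw [A.specProj_eq_zero hμ, A.specProj_eq_zero hμ]

theorem summable_smul_specProj {φ : ℝ → ℝ} {C : ℝ} (h : ∀ μ, A.IsEig μ → |φ μ| ≤ C) (x : X) :
    Summable fun μ : ℝ => φ μ • A.specProj {μ} x := by
  refine (A.orthogonalFamily.summable_iff_norm_sq_summable
    (fun μ => ⟨φ μ • A.specProj {μ} x,
      Submodule.smul_mem _ _ (A.specProj_singleton_mem μ x)⟩)).2 ?_
  refine Summable.of_nonneg_of_le (fun μ => by positivity) (fun μ => ?_)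
    ((A.summable_norm_sq_specProj x).mul_left (C ^ 2))
  change ‖φ μ • A.specProj {μ} x‖ ^ 2 ≤ _
  rw [norm_smul, mul_pow, Real.norm_eq_abs]
  by_cases hμ : A.IsEig μ
  · have := h μ hμ
    gcongr
  · simp [A.specProj_eq_zero hμ]

theorem specProj_tsum {φ : ℝ → ℝ} {x : X} (hs : Summable fun μ : ℝ => φ μ • A.specProj {μ} x)
    (ν : ℝ) : A.specProj {ν} (∑' μ : ℝ, φ μ • A.specProj {μ} x) = φ ν • A.specProj {ν} x := by
  rw [(A.specProj {ν}).map_tsum hs, tsum_eq_single ν]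
  · rw [map_smul, A.specProj_apply_of_mem_eigenspace (A.specProj_singleton_mem ν x)]
  · intro μ hμ
    rw [map_smul, A.specProj_apply_of_mem_eigenspace_ne hμ (A.specProj_singleton_mem μ x),
      smul_zero]

theorem hasSum_specProj (x : X) : HasSum (fun μ : ℝ => A.specProj {μ} x) x := by
  have h1 := A.summable_smul_specProj (φ := fun _ => 1) (C := 1) (by simp) x
  have h2 : ∑' μ : ℝ, (1 : ℝ) • A.specProj {μ} x = x :=
    A.ext_specProj fun ν => by rw [A.specProj_tsum h1, one_smul]
  have h3 := h1.hasSum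
  rw [h2] at h3
  simpa using h3

theorem hasSum_norm_sq_specProj (x : X) :
    HasSum (fun μ : ℝ => ‖A.specProj {μ} x‖ ^ 2) (‖x‖ ^ 2) := by
  have h := (A.hasSum_specProj x).mapL (innerSL ℝ x)
  rw [innerSL_apply_apply, real_inner_self_eq_norm_sq] at h
  refine h.congr_fun fun μ => ?_
  rw [innerSL_apply_apply, real_inner_comm]
  exact (Submodule.re_inner_starProjection_eq_normSq (𝕜 := ℝ) (A.specSubspace {μ}) x).symm

/-- Parseval, compared term by term. The companion of `ext_specProj` for estimates. -/
theorem norm_le_of_specProj {x y : X} {C : ℝ} (hC : 0 ≤ C)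
    (h : ∀ μ, A.IsEig μ → ‖A.specProj {μ} x‖ ≤ C * ‖A.specProj {μ} y‖) : ‖x‖ ≤ C * ‖y‖ := by
  refine le_of_sq_le_sq ?_ (by positivity)
  rw [mul_pow]
  refine hasSum_le (fun μ => ?_) (A.hasSum_norm_sq_specProj x)
    ((A.hasSum_norm_sq_specProj y).mul_left (C ^ 2))
  rw [← mul_pow]
  by_cases hμ : A.IsEig μ
  · exact pow_le_pow_left₀ (norm_nonneg _) (h μ hμ) 2
  · simp [A.specProj_eq_zero hμ]

open Classical in
/-- The operator `φ(A) = ∑_μ φ(μ) P_μ`, for a function `φ` that is bounded on the eigenvalues. -/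
noncomputable def diag (φ : ℝ → ℝ) : X →L[ℝ] X :=
  if h : ∃ C, ∀ μ, A.IsEig μ → |φ μ| ≤ C then
    LinearMap.mkContinuous
      { toFun := fun x => ∑' μ : ℝ, φ μ • A.specProj {μ} x
        map_add' := fun x y => A.ext_specProj fun ν => by
          obtain ⟨C, hC⟩ := h
          have hs := fun z => A.specProj_tsum (A.summable_smul_specProj hC z) ν
          rw [map_add, hs, hs, hs, map_add, smul_add]
        map_smul' := fun c x => A.ext_specProj fun ν => by
          obtain ⟨C, hC⟩ := h
          have hs := fun z => A.specProj_tsum (A.summable_smul_specProj hC z) ν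
          rw [RingHom.id_apply, map_smul, hs, hs, map_smul, smul_comm] }
      |h.choose| fun x => A.norm_le_of_specProj (abs_nonneg _) fun μ hμ => by
        have h1 := h.choose_spec
        simp only [LinearMap.coe_mk, AddHom.coe_mk, A.specProj_tsum (A.summable_smul_specProj h1 _)]
        rw [norm_smul]
        have := (h1 μ hμ).trans (le_abs_self _)
        rw [Real.norm_eq_abs]
        gcongr
  -- The default value does occur: `A^α e^{-Ar}` with `r ≤ 0` is unbounded on an infinite set of
  -- eigenvalues. Its lemmas therefore assume `r > 0` or a bounded spectral set.
  else 0

theorem diag_apply {φ : ℝ → ℝ} {C : ℝ} (h : ∀ μ, A.IsEig μ → |φ μ| ≤ C) (x : X) :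
    A.diag φ x = ∑' μ : ℝ, φ μ • A.specProj {μ} x := by
  have h' : ∃ C, ∀ μ, A.IsEig μ → |φ μ| ≤ C := ⟨C, h⟩
  rw [diag, dif_pos h']
  rfl

theorem specProj_diag {φ : ℝ → ℝ} {C : ℝ} (h : ∀ μ, A.IsEig μ → |φ μ| ≤ C) (ν : ℝ) (x : X) :
    A.specProj {ν} (A.diag φ x) = φ ν • A.specProj {ν} x := by
  rw [A.diag_apply h, A.specProj_tsum (A.summable_smul_specProj h x)]

theorem norm_diag_le {φ : ℝ → ℝ} {C : ℝ} (hC : 0 ≤ C) (h : ∀ μ, A.IsEig μ → |φ μ| ≤ C) (x : X) :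
    ‖A.diag φ x‖ ≤ C * ‖x‖ := by
  refine A.norm_le_of_specProj hC fun μ hμ => ?_
  rw [A.specProj_diag h, norm_smul, Real.norm_eq_abs]
  have := h μ hμ
  gcongr

/-- Dominated convergence in the Parseval sum handles a fixed vector, and the uniform bound `C` lets
the vector vary. No uniformity in `μ` is needed, so this yields strong continuity of semigroup and
kernel. -/
theorem tendsto_diag {ι : Type*} {l : Filter ι} {φ : ι → ℝ → ℝ} {φ₀ : ℝ → ℝ} {C : ℝ} {x : ι → X}
    {x₀ : X} (hC : 0 ≤ C) (h : ∀ᶠ i in l, ∀ μ, A.IsEig μ → |φ i μ| ≤ C)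
    (h₀ : ∀ μ, A.IsEig μ → |φ₀ μ| ≤ C)
    (hφ : ∀ μ, A.IsEig μ → Tendsto (fun i => φ i μ) l (𝓝 (φ₀ μ))) (hx : Tendsto x l (𝓝 x₀)) :
    Tendsto (fun i => A.diag (φ i) (x i)) l (𝓝 (A.diag φ₀ x₀)) := by
  have h1 : Tendsto (fun i => ‖A.diag (φ i) x₀ - A.diag φ₀ x₀‖ ^ 2) l (𝓝 0) := by
    have key : Tendsto (fun i => ∑' μ : ℝ, (φ i μ - φ₀ μ) ^ 2 * ‖A.specProj {μ} x₀‖ ^ 2) l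
        (𝓝 (∑' _ : ℝ, 0)) := by
      refine tendsto_tsum_of_dominated_convergence
        ((A.summable_norm_sq_specProj x₀).mul_left ((2 * C) ^ 2)) (fun μ => ?_) ?_
      · by_cases hμ : A.IsEig μ
        · have := (((hφ μ hμ).sub_const (φ₀ μ)).pow 2).mul_const (‖A.specProj {μ} x₀‖ ^ 2)
          simpa using this
        · simpa [A.specProj_eq_zero hμ] using tendsto_const_nhds
      · filter_upwards [h] with i hi μ
        by_cases hμ : A.IsEig μ
        · rw [Real.norm_of_nonneg (by positivity)]
          have h2 : |φ i μ - φ₀ μ| ≤ 2 * C := by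
            have := abs_sub (φ i μ) (φ₀ μ)
            linarith [hi μ hμ, h₀ μ hμ]
          have h3 : (φ i μ - φ₀ μ) ^ 2 ≤ (2 * C) ^ 2 := by
            rw [← sq_abs]
            gcongr
          gcongr
        · simp [A.specProj_eq_zero hμ]
    rw [tsum_zero] at key
    refine key.congr' ?_
    filter_upwards [h] with i hi
    refine (HasSum.tsum_eq ?_)
    refine (A.hasSum_norm_sq_specProj _).congr_fun fun μ => ?_
    rw [map_sub, A.specProj_diag hi, A.specProj_diag h₀, ← sub_smul, norm_smul, mul_pow,
      Real.norm_eq_abs, sq_abs]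
  have h2 : Tendsto (fun i => ‖A.diag (φ i) x₀ - A.diag φ₀ x₀‖) l (𝓝 0) := by
    have := h1.sqrt
    simpa [Real.sqrt_sq] using this
  have h3 : Tendsto (fun i => C * ‖x i - x₀‖) l (𝓝 0) := by
    have := (tendsto_iff_norm_sub_tendsto_zero.1 hx).const_mul C
    simpa using this
  rw [tendsto_iff_norm_sub_tendsto_zero]
  refine squeeze_zero' (Eventually.of_forall fun i => norm_nonneg _) ?_ (by simpa using h3.add h2)
  filter_upwards [h] with i hi
  have h4 := A.norm_diag_le hC hi (x i - x₀)
  rw [map_sub] at h4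
  have h5 := norm_sub_le_norm_sub_add_norm_sub (A.diag (φ i) (x i)) (A.diag (φ i) x₀)
    (A.diag φ₀ x₀)
  linarith

theorem specProj_inv (μ : ℝ) (x : X) : A.specProj {μ} (A.inv x) = μ⁻¹ • A.specProj {μ} x := by
  have h := A.specProj_graph (A.inv_graph x) μ
  by_cases hμ : A.IsEig μ
  · rw [h, smul_smul, inv_mul_cancel₀ hμ.pos.ne', one_smul]
  · rw [A.specProj_eq_zero hμ, A.specProj_eq_zero hμ, smul_zero]

theorem inv_of_mem_eigenspace {μ : ℝ} {x : X} (hx : x ∈ A.eigenspace μ) :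
    A.inv x = μ⁻¹ • x := by
  refine A.ext_specProj fun ν => ?_
  rw [A.specProj_inv, map_smul]
  by_cases hν : μ = ν
  · rw [hν]
  · rw [A.specProj_apply_of_mem_eigenspace_ne hν hx, smul_zero, smul_zero]

/-- `μ⁻¹` is an eigenvalue of the bounded operator `A⁻¹`. The summand `1` keeps the bound positive
on the zero space. -/
theorem exists_le_isEig : ∃ m > 0, ∀ μ, A.IsEig μ → m ≤ μ := by
  refine ⟨(‖A.inv‖ + 1)⁻¹, by positivity, fun μ hμ => ?_⟩
  have hpos := hμ.pos
  obtain ⟨x, hx, h0⟩ := hμ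
  have h2 := A.inv_of_mem_eigenspace hx
  have h3 := A.inv.le_opNorm x
  rw [h2, norm_smul, norm_inv, Real.norm_of_nonneg hpos.le] at h3
  have h4 : μ⁻¹ ≤ ‖A.inv‖ := le_of_mul_le_mul_right h3 (norm_pos_iff.2 h0)
  exact inv_le_of_inv_le₀ hpos (by linarith)

/-- `A` is the maximal diagonal operator: if the components of `y` are `μ` times those of `x`, then
`A⁻¹ y` and `x` have the same components. -/
theorem specProj_mem_graph_iff {x y : X} :
    (x, y) ∈ A.toLinearPMap.graph ↔ ∀ μ : ℝ, A.specProj {μ} y = μ • A.specProj {μ} x := by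
  refine ⟨fun h μ => A.specProj_graph h μ, fun h => ?_⟩
  have : x = A.inv y := by
    refine A.ext_specProj_of_isEig fun μ hμ => ?_
    rw [A.specProj_inv, h, smul_smul, inv_mul_cancel₀ hμ.pos.ne', one_smul]
  rw [this]
  exact A.inv_graph y

end PosSelfAdjoint
end AttractorRate
namespace AttractorRate

universe u

namespace PosSelfAdjoint

variable {X : Type u} [NormedAddCommGroup X] [InnerProductSpace ℝ X] [CompleteSpace X]
variable (A : PosSelfAdjoint X)

/-! ### The fractional power spaces -/

theorem specProj_fracPow {α : ℝ} (x : A.FracSpace α) (μ : ℝ) :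
    A.specProj {μ} (A.fracPow α x) = μ ^ α • A.specProj {μ} (x : X) :=
  A.specProj_tsum (A.memFrac_iff.1 x.2) μ

theorem abs_rpow_le_of_nonpos {m s : ℝ} (hm : 0 < m) (hs : s ≤ 0) {μ : ℝ} (hμ : m ≤ μ) :
    |μ ^ s| ≤ m ^ s := by
  rw [abs_of_nonneg (Real.rpow_nonneg (hm.le.trans hμ) s)]
  exact Real.rpow_le_rpow_of_nonpos hm hμ hs

theorem exists_abs_rpow_le {s : ℝ} (hs : s ≤ 0) : ∃ C, 0 ≤ C ∧ ∀ μ, A.IsEig μ → |μ ^ s| ≤ C := by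
  obtain ⟨m, hm, h⟩ := A.exists_le_isEig
  exact ⟨m ^ s, by positivity, fun μ hμ => abs_rpow_le_of_nonpos hm hs (h μ hμ)⟩

/-- `A^{-α}` is bounded because the eigenvalues stay away from `0`, and `A^{-α} y` is the preimage.
Thus `X^α` is isometric to `X`, and estimates in `X^α` can be carried out in `X`. -/
theorem fracPow_surjective {α : ℝ} (hα : α ∈ Ioo (0 : ℝ) 1) :
    Function.Surjective (A.fracPow α) := by
  intro y
  obtain ⟨C, -, hC⟩ := A.exists_abs_rpow_le (s := -α) (by linarith [hα.1])
  have hcancel : ∀ μ : ℝ, μ ^ α • A.specProj {μ} (A.diag (fun μ => μ ^ (-α)) y) =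
      A.specProj {μ} y := fun μ => by
    by_cases hμ : A.IsEig μ
    · rw [A.specProj_diag hC, smul_smul, ← Real.rpow_add hμ.pos, add_neg_cancel, Real.rpow_zero,
        one_smul]
    · rw [A.specProj_eq_zero hμ, A.specProj_eq_zero hμ, smul_zero]
  have hmem : A.MemFrac α (A.diag (fun μ => μ ^ (-α)) y) := by
    refine A.memFrac_iff.2 ?_
    simp only [hcancel]
    exact (A.hasSum_specProj y).summable
  refine ⟨⟨_, hmem⟩, A.ext_specProj fun μ => ?_⟩
  exact (A.specProj_fracPow (α := α) ⟨_, hmem⟩ μ).trans (hcancel μ)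

/-- `A^α` as an isometry of `X^α` onto `X`. -/
noncomputable def fracEquiv {α : ℝ} (hα : α ∈ Ioo (0 : ℝ) 1) : A.FracSpace α ≃ₗᵢ[ℝ] X :=
  LinearIsometryEquiv.ofSurjective
    (⟨A.fracPow α, fun _ => rfl⟩ : A.FracSpace α →ₗᵢ[ℝ] X) (A.fracPow_surjective hα)

variable {α : ℝ} (hα : α ∈ Ioo (0 : ℝ) 1)

theorem specProj_fracEquiv (x : A.FracSpace α) (μ : ℝ) :
    A.specProj {μ} (A.fracEquiv hα x) = μ ^ α • A.specProj {μ} (x : X) :=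
  A.specProj_fracPow x μ

theorem specProj_coe (x : A.FracSpace α) (μ : ℝ) :
    A.specProj {μ} (x : X) = μ ^ (-α) • A.specProj {μ} (A.fracEquiv hα x) := by
  by_cases hμ : A.IsEig μ
  · rw [A.specProj_fracEquiv, smul_smul, ← Real.rpow_add hμ.pos, neg_add_cancel, Real.rpow_zero,
      one_smul]
  · rw [A.specProj_eq_zero hμ, A.specProj_eq_zero hμ, smul_zero]

include hα in
theorem norm_coe_le {m : ℝ} (hm : 0 < m) (h : ∀ μ, A.IsEig μ → m ≤ μ) (x : A.FracSpace α) :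
    ‖(x : X)‖ ≤ m ^ (-α) * ‖x‖ := by
  rw [← (A.fracEquiv hα).norm_map x]
  refine A.norm_le_of_specProj (by positivity) fun μ hμ => ?_
  rw [A.specProj_coe hα, norm_smul]
  exact mul_le_mul_of_nonneg_right
    (abs_rpow_le_of_nonpos hm (by linarith [hα.1]) (h μ hμ)) (norm_nonneg _)

/-- The embedding of `X^α` into `X`. -/
noncomputable def toX : A.FracSpace α →L[ℝ] X :=
  LinearMap.mkContinuous
    ((A.fracDomain α).subtype : A.FracSpace α →ₗ[ℝ] X)
    (A.exists_le_isEig.choose ^ (-α)) fun x =>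
      A.norm_coe_le hα A.exists_le_isEig.choose_spec.1 A.exists_le_isEig.choose_spec.2 x

theorem coe_injective : Function.Injective (fun x : A.FracSpace α => (x : X)) :=
  Subtype.val_injective

theorem specProj_fracEquiv_invFrac (x : X) (μ : ℝ) :
    A.specProj {μ} (A.fracEquiv hα (A.invFrac hα x)) = μ ^ (α - 1) • A.specProj {μ} x := by
  rw [A.specProj_fracEquiv]
  change μ ^ α • A.specProj {μ} (A.inv x) = _
  rw [A.specProj_inv]
  by_cases hμ : A.IsEig μ
  · rw [smul_smul, Real.rpow_sub_one hμ.pos.ne', div_eq_mul_inv]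
  · simp only [A.specProj_eq_zero hμ, smul_zero]

theorem norm_invFrac_le {C : ℝ} (hC : 0 ≤ C) {x : X}
    (h : ∀ μ, A.specProj {μ} x ≠ 0 → μ ^ (α - 1) ≤ C) : ‖A.invFrac hα x‖ ≤ C * ‖x‖ := by
  rw [← (A.fracEquiv hα).norm_map]
  refine A.norm_le_of_specProj hC fun μ hμ => ?_
  rw [A.specProj_fracEquiv_invFrac, norm_smul]
  by_cases h0 : A.specProj {μ} x = 0
  · simp [h0]
  · rw [Real.norm_of_nonneg (Real.rpow_nonneg hμ.pos.le _)]
    exact mul_le_mul_of_nonneg_right (h μ h0) (norm_nonneg _)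

/-- An exact norm, so that a bound for `A⁻¹ : X → X^α` on an eigenvector becomes a bound for its
eigenvalue. -/
theorem norm_invFrac_of_mem_eigenspace {μ : ℝ} {x : X} (hx : x ∈ A.eigenspace μ) :
    ‖A.invFrac hα x‖ = μ ^ (α - 1) * ‖x‖ := by
  by_cases h0 : x = 0
  · simp [h0]
  have hμ : 0 < μ := A.eigenvalue_pos hx h0
  have : A.fracEquiv hα (A.invFrac hα x) = μ ^ (α - 1) • x := by
    refine A.ext_specProj fun ν => ?_
    rw [A.specProj_fracEquiv_invFrac, map_smul]
    by_cases hν : μ = ν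
    · rw [hν]
    · rw [A.specProj_apply_of_mem_eigenspace_ne hν hx, smul_zero, smul_zero]
  rw [← (A.fracEquiv hα).norm_map, this, norm_smul, Real.norm_of_nonneg (by positivity)]

theorem coe_fracProj (I : Set ℝ) (x : A.FracSpace α) :
    ((A.fracProj α I x : A.FracSpace α) : X) = A.specProj I (x : X) := rfl

theorem fracEquiv_fracProj (I : Set ℝ) (x : A.FracSpace α) :
    A.fracEquiv hα (A.fracProj α I x) = A.specProj I (A.fracEquiv hα x) := by
  refine A.ext_specProj fun μ => ?_
  rw [A.specProj_fracEquiv, A.coe_fracProj, A.specProj_singleton_specProj,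
    A.specProj_singleton_specProj, A.specProj_fracEquiv, smul_comm]

theorem specProj_specProj_self (I : Set ℝ) (x : X) : A.specProj I (A.specProj I x) =
    A.specProj I x :=
  Submodule.starProjection_eq_self_iff.2 (A.specProj_mem I x)

theorem mem_fracY_iff {I : Set ℝ} {x : A.FracSpace α} :
    x ∈ A.fracY α I ↔ A.fracProj α I x = x := by
  refine ⟨?_, fun h => ⟨x, h⟩⟩
  rintro ⟨y, rfl⟩
  exact A.coe_injective (A.specProj_specProj_self I _)

theorem mem_fracZ_iff {I : Set ℝ} {x : A.FracSpace α} :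
    x ∈ A.fracZ α I ↔ A.fracProj α I x = 0 := by
  constructor
  · rintro ⟨y, rfl⟩
    have h : A.fracProj α I (A.fracProj α I y) = A.fracProj α I y :=
      A.mem_fracY_iff.1 ⟨y, rfl⟩
    rw [LinearMap.sub_apply, LinearMap.id_apply, map_sub, h, sub_self]
  · intro h
    exact ⟨x, by rw [LinearMap.sub_apply, LinearMap.id_apply, h, sub_zero]⟩

theorem norm_specProj_le (I : Set ℝ) (x : X) : ‖A.specProj I x‖ ≤ ‖x‖ := by
  have := A.norm_le_of_specProj (x := A.specProj I x) (y := x) zero_le_one fun μ _ => by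
    rw [A.specProj_singleton_specProj, norm_smul, one_mul]
    by_cases h : μ ∈ I <;> simp [h]
  simpa using this

include hα in
theorem norm_fracProj_le (I : Set ℝ) (x : A.FracSpace α) : ‖A.fracProj α I x‖ ≤ ‖x‖ := by
  rw [← (A.fracEquiv hα).norm_map, ← (A.fracEquiv hα).norm_map x, fracEquiv_fracProj]
  exact A.norm_specProj_le I _

theorem specProj_eq_zero_of_mem_fracY {I : Set ℝ} {x : A.FracSpace α} (hx : x ∈ A.fracY α I)
    {μ : ℝ} (hμ : μ ∉ I) : A.specProj {μ} (x : X) = 0 := by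
  rw [← A.mem_fracY_iff.1 hx, coe_fracProj, specProj_singleton_specProj, indicator_of_notMem hμ,
    zero_smul]

end PosSelfAdjoint
end AttractorRate
namespace AttractorRate

universe u

/-! ### The smoothing kernel -/

/-- The integral `∫_0^∞ r^{-α} e^{-cr} dr`. -/
noncomputable def smoothConst (α c : ℝ) : ℝ := Real.Gamma (1 - α) * c ^ (α - 1)

theorem smoothConst_nonneg {α c : ℝ} (hα : α < 1) (hc : 0 ≤ c) : 0 ≤ smoothConst α c :=
  mul_nonneg (Real.Gamma_pos_of_pos (by linarith)).le (Real.rpow_nonneg hc _)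

/-- The source of every smallness in the contraction arguments: a large gap or a large exponential
weight beats any Lipschitz constant. -/
theorem tendsto_smoothConst {α : ℝ} (hα : α < 1) : Tendsto (smoothConst α) atTop (𝓝 0) := by
  have h := (tendsto_rpow_neg_atTop (y := 1 - α) (by linarith)).const_mul (Real.Gamma (1 - α))
  rw [mul_zero] at h
  refine h.congr fun x => ?_
  rw [smoothConst, neg_sub]

theorem integral_smooth {α c : ℝ} (hα : α < 1) (hc : 0 < c) :
    ∫ r in Ioi (0 : ℝ), r ^ (-α) * Real.exp (-(c * r)) = smoothConst α c := by
  have h := Real.integral_rpow_mul_exp_neg_mul_Ioi (a := 1 - α) (r := c) (by linarith) hc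
  rw [show 1 - α - 1 = -α by ring] at h
  rw [h, smoothConst, one_div, Real.inv_rpow hc.le, ← Real.rpow_neg hc.le, neg_sub, mul_comm]

theorem integrableOn_smooth {α c : ℝ} (hα : α < 1) (hc : 0 < c) :
    MeasureTheory.IntegrableOn (fun r => r ^ (-α) * Real.exp (-(c * r))) (Ioi (0 : ℝ)) := by
  have h := integrableOn_rpow_mul_exp_neg_mul_rpow (p := 1) (s := -α) (b := c) (by linarith)
    one_pos hc
  refine h.congr_fun (fun r _ => ?_) measurableSet_Ioi
  simp only [Real.rpow_one, neg_mul]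

/-- Half of the exponent pays for the power, `(μr)^α ≤ e^{μr/2}`; the other half decays. This is why
`L/2` and not `L` is the rate throughout. -/
theorem rpow_mul_exp_neg_le {α L μ r : ℝ} (hα : α ∈ Ioo (0 : ℝ) 1) (hμ : 0 < μ) (hL : L ≤ μ)
    (hr : 0 < r) :
    μ ^ α * Real.exp (-(μ * r)) ≤ r ^ (-α) * Real.exp (-(L / 2 * r)) := by
  have hc : 0 < μ * r := mul_pos hμ hr
  have h1 : (μ * r) ^ α ≤ Real.exp (μ * r / 2) := by
    rcases le_total (μ * r) 1 with h | h
    · exact (Real.rpow_le_one hc.le h hα.1.le).trans (Real.one_le_exp (by positivity))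
    · refine (Real.rpow_le_rpow_of_exponent_le h hα.2.le).trans ?_
      rw [Real.rpow_one]
      have h2 := Real.add_one_le_exp (μ * r / 2 - 1)
      -- `x ≤ e^{x/2}` follows from `e^{x/2-1} ≥ x/2` and `e ≥ 2`.
      have h3 : Real.exp (μ * r / 2) = Real.exp (μ * r / 2 - 1) * Real.exp 1 := by
        rw [← Real.exp_add, sub_add_cancel]
      have h4 := Real.add_one_le_exp (1 : ℝ)
      rw [h3]
      nlinarith
  have h2 : μ ^ α = (μ * r) ^ α * r ^ (-α) := by
    rw [Real.mul_rpow hμ.le hr.le, mul_assoc, ← Real.rpow_add hr, add_neg_cancel, Real.rpow_zero,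
      mul_one]
  have h3 : Real.exp (μ * r / 2) * Real.exp (-(μ * r)) ≤ Real.exp (-(L / 2 * r)) := by
    rw [← Real.exp_add]
    refine Real.exp_le_exp.2 ?_
    nlinarith
  calc μ ^ α * Real.exp (-(μ * r)) = r ^ (-α) * ((μ * r) ^ α * Real.exp (-(μ * r))) := by
        rw [h2]; ring
    _ ≤ r ^ (-α) * (Real.exp (μ * r / 2) * Real.exp (-(μ * r))) := by gcongr
    _ ≤ _ := by gcongr

namespace PosSelfAdjoint

variable {X : Type u} [NormedAddCommGroup X] [InnerProductSpace ℝ X] [CompleteSpace X]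
variable (A : PosSelfAdjoint X) {α : ℝ} (hα : α ∈ Ioo (0 : ℝ) 1)

/-- The operator `A^α e^{-Ar}` restricted to the spectral subspace of `B`. -/
noncomputable def kern (α : ℝ) (B : Set ℝ) (r : ℝ) : X →L[ℝ] X :=
  A.diag (B.indicator fun μ => μ ^ α * Real.exp (-(μ * r)))

/-- All eigenvalues of `A` in `B` are at least `L`. -/
def EigGE (B : Set ℝ) (L : ℝ) : Prop := ∀ μ ∈ B, A.IsEig μ → L ≤ μ

variable {A} in
include hα in
theorem EigGE.kern_bound {B : Set ℝ} {L : ℝ} (hL : A.EigGE B L) {r : ℝ} (hr : 0 < r) :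
    ∀ μ, A.IsEig μ → |B.indicator (fun μ => μ ^ α * Real.exp (-(μ * r))) μ| ≤
      r ^ (-α) * Real.exp (-(L / 2 * r)) := by
  intro μ hμ
  have := hμ.pos
  by_cases h : μ ∈ B
  · rw [indicator_of_mem h, abs_of_nonneg (by positivity)]
    exact rpow_mul_exp_neg_le hα hμ.pos (hL μ h hμ) hr
  · rw [indicator_of_notMem h, abs_zero]
    positivity

variable {A} in
include hα in
theorem EigGE.norm_kern_le {B : Set ℝ} {L : ℝ} (hL : A.EigGE B L) {r : ℝ} (hr : 0 < r) (x : X) :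
    ‖A.kern α B r x‖ ≤ r ^ (-α) * Real.exp (-(L / 2 * r)) * ‖x‖ :=
  A.norm_diag_le (by positivity) (hL.kern_bound hα hr) x

theorem eigGE_zero (B : Set ℝ) : A.EigGE B 0 := fun _ _ h => h.pos.le

include hα in
theorem specProj_kern (B : Set ℝ) {r : ℝ} (hr : 0 < r) (ν : ℝ) (x : X) :
    A.specProj {ν} (A.kern α B r x) =
      B.indicator (fun μ => μ ^ α * Real.exp (-(μ * r))) ν • A.specProj {ν} x :=
  A.specProj_diag ((A.eigGE_zero B).kern_bound hα hr) ν x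

include hα in
theorem continuousOn_kern (B : Set ℝ) {S : Set ℝ} (hS : S ⊆ Ioi 0) {G : ℝ → X}
    (hG : ContinuousOn G S) : ContinuousOn (fun r => A.kern α B r (G r)) S := by
  intro r₀ hr₀
  have h0 : 0 < r₀ := hS hr₀
  have hbd : ∀ r, r₀ / 2 < r → ∀ μ, A.IsEig μ →
      |B.indicator (fun μ => μ ^ α * Real.exp (-(μ * r))) μ| ≤ (r₀ / 2) ^ (-α) := by
    intro r hr μ hμ
    refine ((A.eigGE_zero B).kern_bound hα (by linarith) μ hμ).trans ?_
    simp only [zero_div, zero_mul, neg_zero, Real.exp_zero, mul_one]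
    exact Real.rpow_le_rpow_of_nonpos (by linarith) hr.le (by linarith [hα.1])
  refine A.tendsto_diag (C := (r₀ / 2) ^ (-α)) (by positivity) ?_ (hbd r₀ (by linarith)) ?_
    (hG r₀ hr₀)
  · filter_upwards [mem_nhdsWithin_of_mem_nhds (lt_mem_nhds (by linarith : r₀ / 2 < r₀))] with r hr
    exact hbd r hr
  · intro μ _
    refine tendsto_nhdsWithin_of_tendsto_nhds (Continuous.tendsto ?_ r₀)
    by_cases h : μ ∈ B
    · simp only [indicator_of_mem h]
      fun_prop
    · simp only [indicator_of_notMem h]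
      fun_prop

/-! ### Integrals of the smoothing kernel against exponentially weighted functions. -/

section Convolution

variable {A} {B : Set ℝ} {L β N : ℝ} (hL : A.EigGE B L) (hβ : 0 < L / 2 + β)
  {S : Set ℝ} (hSm : MeasurableSet S) (hS : S ⊆ Ioi 0) {G : ℝ → X} (hG : ContinuousOn G S)
  (hN : ∀ r ∈ S, ‖G r‖ ≤ N * Real.exp (-(β * r)))

-- The weight `β` of `G` adds to the rate `L/2` of the kernel. It may be negative, as for
-- trajectories growing backward in time; integrability later asks only that the sum be positive.
include hα hL hSm hS hN in
theorem EigGE.norm_kern_le_smooth : ∀ᵐ r ∂MeasureTheory.volume.restrict S,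
    ‖A.kern α B r (G r)‖ ≤ N * (r ^ (-α) * Real.exp (-((L / 2 + β) * r))) := by
  refine (MeasureTheory.ae_restrict_iff' hSm).2 (Eventually.of_forall fun r hr => ?_)
  refine (hL.norm_kern_le hα (hS hr) (G r)).trans ?_
  have hr0 : 0 < r := hS hr
  have h := mul_le_mul_of_nonneg_left (hN r hr)
    (by positivity : 0 ≤ r ^ (-α) * Real.exp (-(L / 2 * r)))
  refine h.trans (le_of_eq ?_)
  rw [add_mul, neg_add, Real.exp_add]
  ring

include hα hL hβ hSm hS hG hN in
theorem EigGE.integrableOn_kern :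
    MeasureTheory.IntegrableOn (fun r => A.kern α B r (G r)) S := by
  refine MeasureTheory.Integrable.mono' (((integrableOn_smooth hα.2 hβ).mono_set hS).const_mul N)
    ((A.continuousOn_kern hα B hS hG).aestronglyMeasurable hSm)
    (hL.norm_kern_le_smooth hα hSm hS hN)

include hα hL hβ hSm hS hN in
theorem EigGE.norm_integral_kern_le (hN0 : 0 ≤ N) :
    ‖∫ r in S, A.kern α B r (G r)‖ ≤ N * smoothConst α (L / 2 + β) := by
  have h1 := MeasureTheory.norm_integral_le_of_norm_le
    (((integrableOn_smooth hα.2 hβ).mono_set hS).const_mul N)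
    (hL.norm_kern_le_smooth hα hSm hS hN)
  refine h1.trans ?_
  rw [MeasureTheory.integral_const_mul, ← integral_smooth hα.2 hβ]
  refine mul_le_mul_of_nonneg_left ?_ hN0
  refine MeasureTheory.setIntegral_mono_set (integrableOn_smooth hα.2 hβ) ?_
    (Eventually.of_forall hS)
  refine (MeasureTheory.ae_restrict_iff' measurableSet_Ioi).2 (Eventually.of_forall fun r hr => ?_)
  have hr0 : 0 < r := hr
  change 0 ≤ r ^ (-α) * Real.exp (-((L / 2 + β) * r))
  positivity

-- The vector integral carries the norm bound, and its components are Duhamel integrals in single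
-- eigenspaces. The link turns componentwise variation of constants into estimates in `X^α`.
include hα hL hβ hSm hS hG hN in
theorem EigGE.specProj_integral_kern (ν : ℝ) :
    A.specProj {ν} (∫ r in S, A.kern α B r (G r)) =
      B.indicator (fun μ => μ ^ α) ν • ∫ r in S, Real.exp (-(ν * r)) • A.specProj {ν} (G r) := by
  rw [← ContinuousLinearMap.integral_comp_comm _ (hL.integrableOn_kern hα hβ hSm hS hG hN),
    ← MeasureTheory.integral_smul]
  refine MeasureTheory.setIntegral_congr_fun hSm fun r hr => ?_
  change A.specProj {ν} (A.kern α B r (G r)) = _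
  rw [A.specProj_kern hα B (hS hr), smul_smul]
  by_cases h : ν ∈ B
  · simp only [indicator_of_mem h]
  · simp only [indicator_of_notMem h, zero_mul]

end Convolution

/-! ### Mild solutions -/

/-- `ξ` is a mild solution of `u' + Au = f(u)` on `S`: the variation of constants formula holds in
every eigenspace. -/
structure IsMild (f : A.FracSpace α → X) (ξ : ℝ → A.FracSpace α) (S : Set ℝ) : Prop where
  continuousOn : ContinuousOn ξ S
  eq : ∀ a ∈ S, ∀ b ∈ S, a ≤ b → ∀ μ, A.specProj {μ} (ξ b : X) =
    Real.exp (-(μ * (b - a))) • A.specProj {μ} (ξ a : X) +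
      ∫ r in a..b, Real.exp (-(μ * (b - r))) • A.specProj {μ} (f (ξ r))

variable {A}

theorem IsMild.mono {f : A.FracSpace α → X} {ξ : ℝ → A.FracSpace α} {S S' : Set ℝ}
    (h : A.IsMild f ξ S) (hS : S' ⊆ S) : A.IsMild f ξ S' :=
  ⟨h.continuousOn.mono hS, fun a ha b hb => h.eq a (hS ha) b (hS hb)⟩

theorem exp_bound {t : ℝ} (ht : 0 ≤ t) : ∀ μ, A.IsEig μ → |Real.exp (-(μ * t))| ≤ 1 := by
  intro μ hμ
  rw [abs_of_pos (Real.exp_pos _)]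
  have := hμ.pos
  exact Real.exp_le_one_iff.2 (neg_nonpos.2 (by positivity))

theorem expNeg_eq {t : ℝ} (ht : 0 ≤ t) (x : X) :
    A.expNeg t x = A.diag (fun μ => Real.exp (-(μ * t))) x :=
  (A.diag_apply (exp_bound ht) x).symm

theorem specProj_expNeg {t : ℝ} (ht : 0 ≤ t) (μ : ℝ) (x : X) :
    A.specProj {μ} (A.expNeg t x) = Real.exp (-(μ * t)) • A.specProj {μ} x := by
  rw [expNeg_eq ht, A.specProj_diag (exp_bound ht)]

theorem continuousOn_expNeg {t : ℝ} {g : ℝ → X} (hg : ContinuousOn g (Icc 0 t)) :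
    ContinuousOn (fun r => A.expNeg (t - r) (g r)) (Icc 0 t) := by
  have h : ContinuousOn (fun r => A.diag (fun μ => Real.exp (-(μ * (t - r)))) (g r))
      (Icc 0 t) := by
    intro r₀ hr₀
    refine A.tendsto_diag zero_le_one ?_ (exp_bound (sub_nonneg.2 hr₀.2)) (fun μ _ => ?_)
      (hg r₀ hr₀)
    · filter_upwards [self_mem_nhdsWithin] with r hr
      exact exp_bound (sub_nonneg.2 hr.2)
    · refine tendsto_nhdsWithin_of_tendsto_nhds (Continuous.tendsto ?_ r₀)
      fun_prop
  exact h.congr fun r hr => expNeg_eq (sub_nonneg.2 hr.2) _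

theorem IsSolutionSemigroup.specProj_eq {f : A.FracSpace α → X} (hf : Continuous f)
    {T : ℝ → A.FracSpace α → A.FracSpace α} (hT : A.IsSolutionSemigroup f T) {t : ℝ} (ht : 0 ≤ t)
    (w : A.FracSpace α) (μ : ℝ) :
    A.specProj {μ} (T t w : X) = Real.exp (-(μ * t)) • A.specProj {μ} (w : X) +
      ∫ r in (0 : ℝ)..t, Real.exp (-(μ * (t - r))) • A.specProj {μ} (f (T r w)) := by
  rcases ht.eq_or_lt with rfl | ht
  · simp [hT.zero]
  have hc : ContinuousOn (fun r => T r w) (Icc 0 t) :=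
    hT.continuousOn.comp (f := fun r : ℝ => (r, w)) (by fun_prop)
      fun r hr => ⟨hr.1, mem_univ _⟩
  have hi : IntervalIntegrable (fun r => A.expNeg (t - r) (f (T r w)))
      MeasureTheory.volume 0 t := by
    refine ContinuousOn.intervalIntegrable ?_
    rw [uIcc_of_le ht.le]
    exact continuousOn_expNeg (hf.comp_continuousOn hc)
  rw [hT.variation_of_constants t ht w, map_add, specProj_expNeg ht.le,
    ← ContinuousLinearMap.intervalIntegral_comp_comm _ hi]
  congr 1
  refine intervalIntegral.integral_congr fun r hr => ?_
  rw [uIcc_of_le ht.le] at hr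
  exact specProj_expNeg (sub_nonneg.2 hr.2) μ _

theorem IsSolutionSemigroup.isMild {f : A.FracSpace α → X} (hf : Continuous f)
    {T : ℝ → A.FracSpace α → A.FracSpace α} (hT : A.IsSolutionSemigroup f T) {S : Set ℝ}
    (hS : S.OrdConnected) {ξ : ℝ → A.FracSpace α} (hξ : ContinuousOn ξ S)
    (h : ∀ a ∈ S, ∀ b ∈ S, a ≤ b → T (b - a) (ξ a) = ξ b) : A.IsMild f ξ S := by
  refine ⟨hξ, fun a ha b hb hab μ => ?_⟩
  have h1 := hT.specProj_eq hf (sub_nonneg.2 hab) (ξ a) μ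
  rw [h a ha b hb hab] at h1
  rw [h1]
  congr 1
  have h2 := intervalIntegral.integral_comp_sub_right
    (fun r => Real.exp (-(μ * (b - a - r))) • A.specProj {μ} (f (T r (ξ a)))) a (a := a) (b := b)
  rw [sub_self] at h2
  rw [← h2]
  refine intervalIntegral.integral_congr fun r hr => ?_
  rw [uIcc_of_le hab] at hr
  rw [h a ha r (hS.out ha hb hr) hr.1, sub_sub_sub_cancel_right]

theorem IsSolutionSemigroup.isMild_apply {f : A.FracSpace α → X} (hf : Continuous f)
    {T : ℝ → A.FracSpace α → A.FracSpace α} (hT : A.IsSolutionSemigroup f T) (w : A.FracSpace α) :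
    A.IsMild f (fun t => T t w) (Ici 0) := by
  refine hT.isMild hf ordConnected_Ici ?_ fun a ha b _ hab => ?_
  · exact hT.continuousOn.comp (f := fun r : ℝ => (r, w)) (by fun_prop)
      fun r hr => ⟨hr, mem_univ _⟩
  · rw [← hT.add _ _ (sub_nonneg.2 hab) ha, sub_add_cancel]

theorem integral_exp_smul_comp_sub {E : Type*} [NormedAddCommGroup E] [NormedSpace ℝ E]
    (g : ℝ → E) {a b : ℝ} (hab : a ≤ b) (μ : ℝ) :
    ∫ r in a..b, Real.exp (-(μ * (b - r))) • g r =
      ∫ r in Ioc 0 (b - a), Real.exp (-(μ * r)) • g (b - r) := by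
  have h := intervalIntegral.integral_comp_sub_left
    (fun r => Real.exp (-(μ * (b - r))) • g r) b (a := 0) (b := b - a)
  rw [sub_sub_cancel, sub_zero] at h
  rw [← h, intervalIntegral.integral_of_le (sub_nonneg.2 hab)]
  simp only [sub_sub_cancel]

/-- Variation of constants in `X^α`, projected to the spectral subspace of `B`. -/
theorem IsMild.specProj_fracEquiv {f : A.FracSpace α → X}
    {ξ : ℝ → A.FracSpace α} {a b : ℝ} (hab : a ≤ b) (hξ : A.IsMild f ξ (Icc a b)) (μ : ℝ) :
    A.specProj {μ} (A.fracEquiv hα (ξ b)) =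
      Real.exp (-(μ * (b - a))) • A.specProj {μ} (A.fracEquiv hα (ξ a)) +
      μ ^ α • ∫ r in Ioc 0 (b - a), Real.exp (-(μ * r)) • A.specProj {μ} (f (ξ (b - r))) := by
  rw [A.specProj_fracEquiv, A.specProj_fracEquiv,
    hξ.eq a (left_mem_Icc.2 hab) b (right_mem_Icc.2 hab) hab μ, smul_add, smul_comm,
    integral_exp_smul_comp_sub _ hab]

theorem IsMild.continuousOn_comp_sub {f : A.FracSpace α → X} (hf : Continuous f)
    {ξ : ℝ → A.FracSpace α} {a b : ℝ} (hξ : A.IsMild f ξ (Icc a b)) :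
    ContinuousOn (fun r => f (ξ (b - r))) (Ioc 0 (b - a)) :=
  (hf.comp_continuousOn hξ.continuousOn).comp (f := fun r => b - r) (by fun_prop) fun r hr =>
    ⟨by linarith [hr.2], by linarith [hr.1]⟩

-- Outside `I`, subtracting the Duhamel integral from `ξ b` leaves `e^{-μ(b-a)}` times the component
-- of `ξ a`, with `μ ≥ Λ`. The initial value is forgotten exponentially and only the smoothing
-- constant remains.
include hα in
theorem IsMild.norm_sub_fracProj_le {f : A.FracSpace α → X} (hf : Continuous f)
    {I : Set ℝ} {Λ K : ℝ} (hΛ : 0 < Λ) (hI : A.EigGE Iᶜ Λ) (hK : ∀ u, ‖f u‖ ≤ K)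
    {ξ : ℝ → A.FracSpace α} {a b : ℝ} (hab : a ≤ b) (hξ : A.IsMild f ξ (Icc a b)) :
    ‖ξ b - A.fracProj α I (ξ b)‖ ≤
      Real.exp (-(Λ * (b - a))) * ‖ξ a - A.fracProj α I (ξ a)‖ + K * smoothConst α (Λ / 2) := by
  have hK0 : 0 ≤ K := (norm_nonneg _).trans (hK 0)
  set J := ∫ r in Ioc 0 (b - a), A.kern α Iᶜ r (f (ξ (b - r))) with hJ
  have hβ : 0 < Λ / 2 + 0 := by linarith
  have hN : ∀ r ∈ Ioc 0 (b - a), ‖f (ξ (b - r))‖ ≤ K * Real.exp (-(0 * r)) := by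
    intro r _
    simpa using hK _
  have hS : Ioc 0 (b - a) ⊆ Ioi 0 := fun r hr => hr.1
  have h1 : ‖J‖ ≤ K * smoothConst α (Λ / 2) := by
    have := hI.norm_integral_kern_le hα hβ measurableSet_Ioc hS hN hK0
    rwa [add_zero] at this
  have h2 : ‖A.fracEquiv hα (ξ b - A.fracProj α I (ξ b)) - J‖ ≤
      Real.exp (-(Λ * (b - a))) * ‖A.fracEquiv hα (ξ a - A.fracProj α I (ξ a))‖ := by
    refine A.norm_le_of_specProj (by positivity) fun μ hμ => ?_
    rw [map_sub, hI.specProj_integral_kern hα hβ measurableSet_Ioc hS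
      (hξ.continuousOn_comp_sub hf) hN, map_sub, map_sub, map_sub, map_sub,
      fracEquiv_fracProj, fracEquiv_fracProj,
      specProj_singleton_specProj, specProj_singleton_specProj, hξ.specProj_fracEquiv hα hab]
    by_cases h : μ ∈ I
    · simp [h]
    · simp only [indicator_of_notMem h, zero_smul, sub_zero,
        indicator_of_mem (mem_compl h), add_sub_cancel_right]
      rw [norm_smul, Real.norm_of_nonneg (Real.exp_pos _).le]
      have := hI μ h hμ
      have h0 : 0 ≤ b - a := sub_nonneg.2 hab
      gcongr
  rw [LinearIsometryEquiv.norm_map] at h2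
  have h3 := norm_le_norm_sub_add (A.fracEquiv hα (ξ b - A.fracProj α I (ξ b))) J
  rw [LinearIsometryEquiv.norm_map] at h3
  linarith

/-- A point with backward orbits of arbitrary length and bounded component in `Z` has a small
component in `Z`. -/
theorem IsSolutionSemigroup.norm_sub_fracProj_le {f : A.FracSpace α → X} (hα : α ∈ Ioo (0 : ℝ) 1)
    (hf : Continuous f)
    {T : ℝ → A.FracSpace α → A.FracSpace α} (hT : A.IsSolutionSemigroup f T)
    {I : Set ℝ} {Λ K D : ℝ} (hΛ : 0 < Λ) (hI : A.EigGE Iᶜ Λ) (hK : ∀ u, ‖f u‖ ≤ K)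
    {w : A.FracSpace α} (hw : ∀ t, 0 ≤ t → ∃ v, T t v = w ∧ ‖v - A.fracProj α I v‖ ≤ D) :
    ‖w - A.fracProj α I w‖ ≤ K * smoothConst α (Λ / 2) := by
  have hlim : Tendsto (fun t : ℝ => Real.exp (-(Λ * t)) * D + K * smoothConst α (Λ / 2)) atTop
      (𝓝 (K * smoothConst α (Λ / 2))) := by
    have h1 : Tendsto (fun t : ℝ => Real.exp (-(Λ * t))) atTop (𝓝 0) :=
      Real.tendsto_exp_neg_atTop_nhds_zero.comp (tendsto_id.const_mul_atTop hΛ)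
    simpa using (h1.mul_const D).add_const (K * smoothConst α (Λ / 2))
  refine ge_of_tendsto hlim ?_
  filter_upwards [eventually_ge_atTop 0] with t ht
  obtain ⟨v, hv, hD⟩ := hw t ht
  have hm := (hT.isMild_apply hf v).mono (S' := Icc 0 t) fun r hr => hr.1
  have h := hm.norm_sub_fracProj_le hα hf hΛ hI hK ht
  rw [hv, hT.zero, sub_zero] at h
  refine h.trans ?_
  gcongr

/-- In the norm weighted by `e^{-βt}` with `β` large, the Duhamel operator halves differences. At
the time where the weighted difference is maximal, `N ≤ N/2`, so `N = 0`. -/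
theorem IsMild.eqOn_of_eq_left (hα : α ∈ Ioo (0 : ℝ) 1) {f : A.FracSpace α → X}
    {K : ℝ} (hf : ∀ u v, ‖f u - f v‖ ≤ K * ‖u - v‖) (hfc : Continuous f)
    {ξ ζ : ℝ → A.FracSpace α} {a b : ℝ}
    (hξ : A.IsMild f ξ (Icc a b)) (hζ : A.IsMild f ζ (Icc a b)) (h : ξ a = ζ a) :
    EqOn ξ ζ (Icc a b) := by
  rcases lt_or_ge b a with hab | hab
  · rw [Icc_eq_empty (not_le.2 hab)]
    exact eqOn_empty _ _
  obtain ⟨β, hβ0, hβ⟩ : ∃ β > 0, |K| * smoothConst α β ≤ 1 / 2 := by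
    have h1 := (tendsto_smoothConst hα.2).const_mul |K|
    rw [mul_zero] at h1
    obtain ⟨β, h2, h3⟩ := ((h1.eventually (gt_mem_nhds (by norm_num : (0 : ℝ) < 1 / 2))).and
      (eventually_gt_atTop 0)).exists
    exact ⟨β, h3, h2.le⟩
  have hcont : ContinuousOn (fun t => Real.exp (-(β * t)) * ‖ξ t - ζ t‖) (Icc a b) :=
    (by fun_prop : Continuous fun t : ℝ => Real.exp (-(β * t))).continuousOn.mul
      (hξ.continuousOn.sub hζ.continuousOn).norm
  obtain ⟨t₀, ht₀, hmax⟩ := isCompact_Icc.exists_isMaxOn ⟨a, left_mem_Icc.2 hab⟩ hcont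
  set N := Real.exp (-(β * t₀)) * ‖ξ t₀ - ζ t₀‖ with hNdef
  have hN0 : 0 ≤ N := by positivity
  have hN : ∀ t ∈ Icc a b, ‖ξ t - ζ t‖ ≤ N * Real.exp (β * t) := by
    intro t ht
    have h1 : Real.exp (-(β * t)) * ‖ξ t - ζ t‖ ≤ N := hmax ht
    rw [Real.exp_neg, inv_mul_le_iff₀ (Real.exp_pos _)] at h1
    linarith
  have hkey : ‖ξ t₀ - ζ t₀‖ ≤ 1 / 2 * (N * Real.exp (β * t₀)) := by
    have hsub : Icc a t₀ ⊆ Icc a b := Icc_subset_Icc_right ht₀.2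
    have hξ' := hξ.mono hsub
    have hζ' := hζ.mono hsub
    have hS : Ioc 0 (t₀ - a) ⊆ Ioi 0 := fun r hr => hr.1
    have hG : ContinuousOn (fun r => f (ξ (t₀ - r)) - f (ζ (t₀ - r))) (Ioc 0 (t₀ - a)) :=
      (hξ'.continuousOn_comp_sub hfc).sub (hζ'.continuousOn_comp_sub hfc)
    have hGN : ∀ r ∈ Ioc 0 (t₀ - a), ‖f (ξ (t₀ - r)) - f (ζ (t₀ - r))‖ ≤
        (|K| * (N * Real.exp (β * t₀))) * Real.exp (-(β * r)) := by
      intro r hr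
      have h1 := hN (t₀ - r) ⟨by linarith [hr.2], by linarith [hr.1, ht₀.2]⟩
      calc _ ≤ K * ‖ξ (t₀ - r) - ζ (t₀ - r)‖ := hf _ _
        _ ≤ |K| * (N * Real.exp (β * (t₀ - r))) :=
          mul_le_mul (le_abs_self K) h1 (norm_nonneg _) (abs_nonneg K)
        _ = _ := by
          rw [mul_sub, sub_eq_add_neg, Real.exp_add]
          ring
    -- With all of the spectrum and `L = 0`, the decay comes from the weight alone; no spectral gap
    -- enters.
    have hβ' : 0 < (0 : ℝ) / 2 + β := by linarith
    have hbd := (A.eigGE_zero univ).norm_integral_kern_le hα hβ' measurableSet_Ioc hS hGN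
      (by positivity)
    have heq : A.fracEquiv hα (ξ t₀ - ζ t₀) =
        ∫ r in Ioc 0 (t₀ - a), A.kern α univ r (f (ξ (t₀ - r)) - f (ζ (t₀ - r))) := by
      refine A.ext_specProj fun μ => ?_
      rw [(A.eigGE_zero univ).specProj_integral_kern hα hβ' measurableSet_Ioc hS hG hGN,
        map_sub, map_sub, hξ'.specProj_fracEquiv hα ht₀.1,
        hζ'.specProj_fracEquiv hα ht₀.1, h, add_sub_add_left_eq_sub, ← smul_sub,
        indicator_of_mem (mem_univ μ)]
      congr 1
      have hint : ∀ ζ : ℝ → A.FracSpace α, A.IsMild f ζ (Icc a t₀) →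
          MeasureTheory.IntegrableOn
            (fun r => Real.exp (-(μ * r)) • A.specProj {μ} (f (ζ (t₀ - r)))) (Ioc 0 (t₀ - a)) := by
        intro ζ hζ
        refine (ContinuousOn.integrableOn_Icc ?_).mono_set Ioc_subset_Icc_self
        refine (by fun_prop : Continuous fun r : ℝ => Real.exp (-(μ * r))).continuousOn.smul ?_
        refine (A.specProj {μ}).continuous.comp_continuousOn ?_
        exact (hfc.comp_continuousOn hζ.continuousOn).comp (f := fun r => t₀ - r) (by fun_prop)
          fun r hr => ⟨by linarith [hr.2], by linarith [hr.1]⟩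
      rw [← MeasureTheory.integral_sub (hint ξ hξ') (hint ζ hζ')]
      simp only [map_sub, smul_sub]
    rw [← heq, LinearIsometryEquiv.norm_map, zero_div, zero_add] at hbd
    have h5 : 0 ≤ N * Real.exp (β * t₀) := by positivity
    nlinarith
  have hN' : N ≤ 1 / 2 * N := by
    have h1 : N * Real.exp (β * t₀) = ‖ξ t₀ - ζ t₀‖ := by
      rw [hNdef, mul_right_comm, ← Real.exp_add, neg_add_cancel, Real.exp_zero, one_mul]
    have h2 : N * Real.exp (β * t₀) ≤ 1 / 2 * N * Real.exp (β * t₀) := by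
      rw [h1, mul_assoc, h1] at *
      linarith
    exact le_of_mul_le_mul_right h2 (Real.exp_pos _)
  have hN1 : N = 0 := by linarith
  intro t ht
  have h1 := hN t ht
  rw [hN1, zero_mul] at h1
  exact sub_eq_zero.1 (norm_le_zero_iff.1 h1)

end PosSelfAdjoint
end AttractorRate
namespace AttractorRate

universe u

namespace PosSelfAdjoint

variable {X : Type u} [NormedAddCommGroup X] [InnerProductSpace ℝ X] [CompleteSpace X]

/-! ### The Lyapunov-Perron operator -/

/-- The quantitative gap condition under which an invariant manifold exists. -/
structure GapData (A : PosSelfAdjoint X) {α : ℝ} (I : Set ℝ) (f : A.FracSpace α → X)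
    (K b σ Λ : ℝ) : Prop where
  mem : α ∈ Ioo (0 : ℝ) 1
  pos : 0 < b
  le : ∀ μ ∈ I, μ ≤ b
  ge : A.EigGE Iᶜ Λ
  lt : b < σ
  lt' : σ < Λ / 2
  bdd : ∀ u, ‖f u‖ ≤ K
  lip : ∀ u v, ‖f u - f v‖ ≤ K * ‖u - v‖
  small : K * (b ^ α / (σ - b) + smoothConst α (Λ / 2 - σ)) ≤ 1 / 2

variable {A : PosSelfAdjoint X} {α : ℝ} {I : Set ℝ} {f : A.FracSpace α → X} {K b σ Λ : ℝ}

variable (A) in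
/-- The operator `e^{-At}` on the spectral subspace of `I`, `t ∈ ℝ`. -/
noncomputable def expY (I : Set ℝ) (t : ℝ) : X →L[ℝ] X :=
  A.diag (I.indicator fun μ => Real.exp (-(μ * t)))

namespace GapData

variable (h : A.GapData I f K b σ Λ)
include h

theorem K_nonneg : 0 ≤ K := (norm_nonneg _).trans (h.bdd 0)

theorem Λ_pos : 0 < Λ := by linarith [h.pos, h.lt, h.lt']

theorem continuous_f : Continuous f := by
  refine (LipschitzWith.of_dist_le_mul (K := ⟨K, h.K_nonneg⟩) fun u v => ?_).continuous
  rw [dist_eq_norm, dist_eq_norm]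
  exact h.lip u v

theorem expY_bound (t : ℝ) : ∀ μ, A.IsEig μ →
    |I.indicator (fun μ => Real.exp (-(μ * t))) μ| ≤ Real.exp (b * |t|) := by
  intro μ hμ
  by_cases hI : μ ∈ I
  · rw [indicator_of_mem hI, abs_of_pos (Real.exp_pos _)]
    refine Real.exp_le_exp.2 ?_
    have := h.le μ hI
    have h1 := hμ.pos
    calc -(μ * t) ≤ |μ * t| := neg_le_abs _
      _ = μ * |t| := by rw [abs_mul, abs_of_pos h1]
      _ ≤ _ := by gcongr
  · rw [indicator_of_notMem hI, abs_zero]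
    positivity

/-- Boundedness of `I` gives a bounded kernel at all real times, unlike on `Iᶜ`, so the `Y` part can
be solved backward. -/
theorem kernY_bound (t : ℝ) : ∀ μ, A.IsEig μ →
    |I.indicator (fun μ => μ ^ α * Real.exp (-(μ * t))) μ| ≤ b ^ α * Real.exp (b * |t|) := by
  intro μ hμ
  have h1 := h.expY_bound t μ hμ
  have hb := h.pos
  by_cases hI : μ ∈ I
  · rw [indicator_of_mem hI] at h1 ⊢
    have h2 : 0 ≤ μ ^ α := Real.rpow_nonneg hμ.pos.le _
    rw [abs_mul, abs_of_nonneg h2]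
    have h3 : μ ^ α ≤ b ^ α := Real.rpow_le_rpow hμ.pos.le (h.le μ hI) h.mem.1.le
    gcongr
  · rw [indicator_of_notMem hI, abs_zero]
    positivity

theorem specProj_expY (t ν : ℝ) (x : X) : A.specProj {ν} (A.expY I t x) =
    I.indicator (fun μ => Real.exp (-(μ * t))) ν • A.specProj {ν} x :=
  A.specProj_diag (h.expY_bound t) ν x

theorem specProj_kernY (t ν : ℝ) (x : X) : A.specProj {ν} (A.kern α I t x) =
    I.indicator (fun μ => μ ^ α * Real.exp (-(μ * t))) ν • A.specProj {ν} x :=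
  A.specProj_diag (h.kernY_bound t) ν x

theorem norm_expY_le (t : ℝ) (x : X) : ‖A.expY I t x‖ ≤ Real.exp (b * |t|) * ‖x‖ :=
  A.norm_diag_le (by positivity) (h.expY_bound t) x

theorem continuous_expY {g : ℝ → X} (hg : Continuous g) :
    Continuous fun t => A.expY I t (g t) := by
  rw [continuous_iff_continuousAt]
  intro t₀
  refine A.tendsto_diag (C := Real.exp (b * (|t₀| + 1))) (by positivity) ?_ ?_ ?_ (hg.tendsto t₀)
  · have : ∀ᶠ t in 𝓝 t₀, |t| < |t₀| + 1 :=
      continuous_abs.continuousAt.eventually (gt_mem_nhds (by linarith))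
    filter_upwards [this] with t ht μ hμ
    refine (h.expY_bound t μ hμ).trans (Real.exp_le_exp.2 ?_)
    exact mul_le_mul_of_nonneg_left ht.le h.pos.le
  · intro μ hμ
    refine (h.expY_bound t₀ μ hμ).trans (Real.exp_le_exp.2 ?_)
    exact mul_le_mul_of_nonneg_left (by linarith) h.pos.le
  · intro μ _
    refine Continuous.tendsto ?_ t₀
    by_cases hI : μ ∈ I
    · simp only [indicator_of_mem hI]
      fun_prop
    · simp only [indicator_of_notMem hI]
      fun_prop

theorem continuous_kernY {g : ℝ → X} (hg : Continuous g) :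
    Continuous fun t => A.kern α I (-t) (g t) := by
  rw [continuous_iff_continuousAt]
  intro t₀
  have hb := h.pos
  refine A.tendsto_diag (C := b ^ α * Real.exp (b * (|t₀| + 1))) (by positivity) ?_ ?_ ?_
    (hg.tendsto t₀)
  · have : ∀ᶠ t in 𝓝 t₀, |t| < |t₀| + 1 :=
      continuous_abs.continuousAt.eventually (gt_mem_nhds (by linarith))
    filter_upwards [this] with t ht μ hμ
    refine (h.kernY_bound (-t) μ hμ).trans ?_
    rw [abs_neg]
    gcongr
  · intro μ hμ
    refine (h.kernY_bound (-t₀) μ hμ).trans ?_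
    rw [abs_neg]
    gcongr
    linarith
  · intro μ _
    refine Continuous.tendsto ?_ t₀
    by_cases hI : μ ∈ I
    · simp only [indicator_of_mem hI]
      fun_prop
    · simp only [indicator_of_notMem hI]
      fun_prop

end GapData

variable (A α I) in
/-- The component in `Y` of the Lyapunov-Perron integral. -/
noncomputable def lpY (g : ℝ → X) (t : ℝ) : X :=
  A.expY I t (∫ r in t..0, A.kern α I (-r) (g r))

variable (A α I) in
/-- The component in `Z` of the Lyapunov-Perron integral. -/
noncomputable def lpZ (g : ℝ → X) (t : ℝ) : X :=
  ∫ r in Ioi 0, A.kern α Iᶜ r (g (t - r))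

variable (A α I) in
/-- The Lyapunov-Perron integral. -/
noncomputable def lp (g : ℝ → X) (t : ℝ) : X := A.lpZ α I g t - A.lpY α I g t

namespace GapData

variable (h : A.GapData I f K b σ Λ)
include h

/-! ### Components, continuity and weighted bounds of the Lyapunov-Perron integral. -/

section Linear

variable {g : ℝ → X} {D : ℝ} (hg : Continuous g) (hD : ∀ r, ‖g r‖ ≤ D)

omit [InnerProductSpace ℝ X] [CompleteSpace X] h in
include hD in
theorem bound_comp_sub (t : ℝ) : ∀ r ∈ Ioi (0 : ℝ), ‖g (t - r)‖ ≤ D * Real.exp (-(0 * r)) := by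
  intro r _
  simpa using hD (t - r)

include hg hD in
theorem integrableOn_lpZ (t : ℝ) :
    MeasureTheory.IntegrableOn (fun r => A.kern α Iᶜ r (g (t - r))) (Ioi 0) :=
  h.ge.integrableOn_kern h.mem (β := 0) (by linarith [h.Λ_pos]) measurableSet_Ioi Subset.rfl
    (by fun_prop) (bound_comp_sub hD t)

include hg hD in
theorem specProj_lpZ (t ν : ℝ) : A.specProj {ν} (A.lpZ α I g t) =
    Iᶜ.indicator (fun μ => μ ^ α) ν •
      ∫ r in Ioi 0, Real.exp (-(ν * r)) • A.specProj {ν} (g (t - r)) :=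
  h.ge.specProj_integral_kern h.mem (β := 0) (by linarith [h.Λ_pos]) measurableSet_Ioi Subset.rfl
    (by fun_prop) (bound_comp_sub hD t) ν

include hD in
theorem norm_lpZ_le (t : ℝ) : ‖A.lpZ α I g t‖ ≤ D * smoothConst α (Λ / 2) := by
  have := h.ge.norm_integral_kern_le h.mem (β := 0) (by linarith [h.Λ_pos]) measurableSet_Ioi
    Subset.rfl (bound_comp_sub hD t) ((norm_nonneg _).trans (hD 0))
  rwa [add_zero] at this

include hg in
theorem specProj_lpY (t ν : ℝ) : A.specProj {ν} (A.lpY α I g t) =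
    I.indicator (fun μ => μ ^ α) ν •
      ∫ r in t..0, Real.exp (-(ν * (t - r))) • A.specProj {ν} (g r) := by
  have hi := (h.continuous_kernY hg).intervalIntegrable (μ := MeasureTheory.volume) t 0
  rw [lpY, h.specProj_expY, ← ContinuousLinearMap.intervalIntegral_comp_comm _ hi,
    ← intervalIntegral.integral_smul, ← intervalIntegral.integral_smul]
  refine intervalIntegral.integral_congr fun r _ => ?_
  simp only [h.specProj_kernY]
  by_cases hI : ν ∈ I
  · simp only [indicator_of_mem hI, smul_smul]
    rw [mul_left_comm, ← Real.exp_add]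
    congr 3
    ring
  · simp only [indicator_of_notMem hI, zero_smul]

include hg in
theorem continuous_lpY : Continuous (A.lpY α I g) := by
  refine h.continuous_expY ?_
  have hc := h.continuous_kernY hg
  have h1 := intervalIntegral.continuous_primitive (μ := MeasureTheory.volume)
    (fun a b => hc.intervalIntegrable a b) 0
  have h2 : (fun t => ∫ r in t..0, A.kern α I (-r) (g r)) =
      fun t => -∫ r in (0 : ℝ)..t, A.kern α I (-r) (g r) := by
    funext t
    rw [intervalIntegral.integral_symm]
  rw [h2]
  exact h1.neg

include hg hD in
theorem continuous_lpZ : Continuous (A.lpZ α I g) := by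
  have hβ : 0 < Λ / 2 + 0 := by linarith [h.Λ_pos]
  refine MeasureTheory.continuous_of_dominated
    (bound := fun r => D * (r ^ (-α) * Real.exp (-((Λ / 2 + 0) * r)))) (fun t => ?_) (fun t => ?_)
    ((integrableOn_smooth h.mem.2 hβ).const_mul D) ?_
  · exact (A.continuousOn_kern h.mem Iᶜ Subset.rfl (by fun_prop)).aestronglyMeasurable
      measurableSet_Ioi
  · exact h.ge.norm_kern_le_smooth h.mem measurableSet_Ioi Subset.rfl (bound_comp_sub hD t)
  · exact Eventually.of_forall fun r => by fun_prop

include hg hD in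
theorem continuous_lp : Continuous (A.lp α I g) :=
  (h.continuous_lpZ hg hD).sub (h.continuous_lpY hg)

/-- The product is estimated as one operator: its exponent is `μ(r - t)`, whereas separate bounds on
the factors would lose the cancellation of `t` against `r`. -/
theorem norm_expY_kernY_le {t r : ℝ} (htr : t ≤ r) (x : X) :
    ‖A.expY I t (A.kern α I (-r) x)‖ ≤ b ^ α * Real.exp (b * (r - t)) * ‖x‖ := by
  have hb := h.pos
  refine A.norm_le_of_specProj (by positivity) fun μ hμ => ?_
  rw [h.specProj_expY, h.specProj_kernY, smul_smul, norm_smul]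
  refine mul_le_mul_of_nonneg_right ?_ (norm_nonneg _)
  by_cases hI : μ ∈ I
  · have h0 := hμ.pos
    rw [indicator_of_mem hI, indicator_of_mem hI, Real.norm_of_nonneg (by positivity),
      mul_left_comm, ← Real.exp_add]
    have h1 := h.le μ hI
    refine mul_le_mul (Real.rpow_le_rpow h0.le h1 h.mem.1.le) (Real.exp_le_exp.2 ?_)
      (by positivity) (by positivity)
    nlinarith
  · rw [indicator_of_notMem hI, zero_mul, norm_zero]
    positivity

include hg in
theorem norm_lpY_le {N : ℝ} (hN : ∀ r ≤ 0, ‖g r‖ ≤ N * Real.exp (-(σ * r))) {t : ℝ} (ht : t ≤ 0) :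
    ‖A.lpY α I g t‖ ≤ N * (b ^ α / (σ - b)) * Real.exp (-(σ * t)) := by
  have hb := h.pos
  have hσ : 0 < σ - b := sub_pos.2 h.lt
  have hN0 : 0 ≤ N := by simpa using (norm_nonneg _).trans (hN 0 le_rfl)
  have hi := (h.continuous_kernY hg).intervalIntegrable (μ := MeasureTheory.volume) t 0
  rw [lpY, ← ContinuousLinearMap.intervalIntegral_comp_comm _ hi]
  have h1 : ‖∫ r in t..0, A.expY I t (A.kern α I (-r) (g r))‖ ≤
      ∫ r in t..0, N * b ^ α * Real.exp (-(b * t)) * Real.exp ((b - σ) * r) := by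
    refine intervalIntegral.norm_integral_le_of_norm_le ht ?_ (by
      refine Continuous.intervalIntegrable ?_ _ _
      fun_prop)
    refine Eventually.of_forall fun r hr => (h.norm_expY_kernY_le hr.1.le _).trans ?_
    calc b ^ α * Real.exp (b * (r - t)) * ‖g r‖
        ≤ b ^ α * Real.exp (b * (r - t)) * (N * Real.exp (-(σ * r))) := by
          gcongr
          exact hN r hr.2
      _ = N * b ^ α * Real.exp (-(b * t)) * Real.exp ((b - σ) * r) := by
          rw [mul_sub, sub_eq_add_neg (b * r), Real.exp_add, sub_mul, sub_eq_add_neg (b * r),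
            Real.exp_add]
          ring
  refine h1.trans ?_
  have hne : b - σ ≠ 0 := by linarith
  rw [intervalIntegral.integral_const_mul, intervalIntegral.integral_comp_mul_left _ hne,
    integral_exp, mul_zero, Real.exp_zero, smul_eq_mul]
  have h2 : (b - σ)⁻¹ * (1 - Real.exp ((b - σ) * t)) ≤
      (σ - b)⁻¹ * Real.exp ((b - σ) * t) := by
    rw [← neg_sub σ b, inv_neg, neg_mul, ← mul_neg, neg_sub]
    refine mul_le_mul_of_nonneg_left (by linarith) (by positivity)
  have h3 : Real.exp (-(b * t)) * Real.exp ((b - σ) * t) = Real.exp (-(σ * t)) := by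
    rw [← Real.exp_add]
    congr 1
    ring
  calc _ ≤ N * b ^ α * Real.exp (-(b * t)) * ((σ - b)⁻¹ * Real.exp ((b - σ) * t)) := by gcongr
    _ = _ := by
      rw [← h3]
      ring

-- In the weight `e^{-σt}`, `t ≤ 0`, the `Y` part converges because `σ` exceeds its rate `b`, and
-- the `Z` part because `σ` is below `Λ/2`. The two summands are those in `GapData.small`.
include hg in
theorem norm_lp_le {N : ℝ} (hN : ∀ r ≤ 0, ‖g r‖ ≤ N * Real.exp (-(σ * r))) {t : ℝ} (ht : t ≤ 0) :
    ‖A.lp α I g t‖ ≤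
      N * (b ^ α / (σ - b) + smoothConst α (Λ / 2 - σ)) * Real.exp (-(σ * t)) := by
  have hN0 : 0 ≤ N := by simpa using (norm_nonneg _).trans (hN 0 le_rfl)
  have h1 := h.norm_lpY_le hg hN ht
  have h2 := h.ge.norm_integral_kern_le h.mem (β := -σ) (by linarith [h.lt'])
    (N := N * Real.exp (-(σ * t))) (G := fun r => g (t - r)) measurableSet_Ioi
    Subset.rfl (fun r hr => by
      have : (0 : ℝ) < r := hr
      refine (hN (t - r) (by linarith)).trans (le_of_eq ?_)
      rw [mul_assoc, ← Real.exp_add]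
      congr 2
      ring) (by positivity)
  rw [← sub_eq_add_neg] at h2
  change ‖A.lpZ α I g t‖ ≤ _ at h2
  refine (norm_sub_le _ _).trans ?_
  nlinarith

end Linear

theorem lp_sub {g g' : ℝ → X} {D D' : ℝ} (hg : Continuous g) (hD : ∀ r, ‖g r‖ ≤ D)
    (hg' : Continuous g') (hD' : ∀ r, ‖g' r‖ ≤ D') (t : ℝ) :
    A.lp α I g t - A.lp α I g' t = A.lp α I (fun r => g r - g' r) t := by
  have h1 : A.lpZ α I g t - A.lpZ α I g' t = A.lpZ α I (fun r => g r - g' r) t := by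
    unfold lpZ
    rw [← MeasureTheory.integral_sub (h.integrableOn_lpZ hg hD t) (h.integrableOn_lpZ hg' hD' t)]
    simp only [map_sub]
  have h2 : A.lpY α I g t - A.lpY α I g' t = A.lpY α I (fun r => g r - g' r) t := by
    unfold lpY
    rw [← map_sub, ← intervalIntegral.integral_sub
      ((h.continuous_kernY hg).intervalIntegrable _ _)
      ((h.continuous_kernY hg').intervalIntegrable _ _)]
    simp only [map_sub]
  rw [lp, lp, lp, ← h1, ← h2]
  abel

/-! ### The Lyapunov-Perron equation and mild solutions -/

section Equivalence

variable {ξ : ℝ → A.FracSpace α} (hξ : Continuous ξ)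

include hξ in
theorem continuous_comp : Continuous fun r => f (ξ r) := h.continuous_f.comp hξ

theorem bdd_comp : ∀ r, ‖f (ξ r)‖ ≤ K := fun r => h.bdd (ξ r)

include hξ in
theorem integrableOn_exp_smul {ν : ℝ} (hν : 0 < ν) (t : ℝ) :
    MeasureTheory.IntegrableOn (fun r => Real.exp (-(ν * r)) • A.specProj {ν} (f (ξ (t - r))))
      (Ioi 0) := by
  have hi := (integrableOn_exp_mul_Ioi (a := -ν) (by linarith) 0).const_mul K
  refine MeasureTheory.Integrable.mono' hi ?_ (Eventually.of_forall fun r => ?_)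
  · refine Continuous.aestronglyMeasurable ?_
    have := h.continuous_f
    fun_prop
  · rw [norm_smul, Real.norm_of_nonneg (Real.exp_pos _).le, neg_mul, mul_comm]
    have := (A.norm_specProj_le {ν} (f (ξ (t - r)))).trans (h.bdd _)
    gcongr

-- Components in `I` are obtained by solving variation of constants backward from time `0`. For the
-- others the initial time `t - s` goes to `-∞`, and the bound `D` kills the initial term.
include hξ in
theorem eq_lp_of_isMild (hm : A.IsMild f ξ (Iic 0)) {D : ℝ}
    (hD : ∀ t ≤ 0, ‖ξ t - A.fracProj α I (ξ t)‖ ≤ D) {t : ℝ} (ht : t ≤ 0) :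
    A.fracEquiv h.mem (ξ t) =
      A.expY I t (A.fracEquiv h.mem (ξ 0)) + A.lp α I (fun r => f (ξ r)) t := by
  refine A.ext_specProj_of_isEig fun μ hμ => ?_
  rw [lp, map_add, map_sub, h.specProj_lpZ (h.continuous_comp hξ) h.bdd_comp,
    h.specProj_lpY (h.continuous_comp hξ), h.specProj_expY]
  by_cases hI : μ ∈ I
  · rw [indicator_of_mem hI, indicator_of_mem hI, indicator_of_notMem (notMem_compl_iff.2 hI),
      zero_smul, zero_sub]
    have h1 := hm.eq t ht 0 self_mem_Iic ht μ
    rw [A.specProj_fracEquiv, A.specProj_fracEquiv, h1, smul_add, smul_add, smul_comm (μ ^ α),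
      smul_smul (Real.exp _), ← Real.exp_add]
    have h2 : -(μ * t) + -(μ * (0 - t)) = 0 := by ring
    rw [h2, Real.exp_zero, one_smul, smul_comm (Real.exp _),
      ← intervalIntegral.integral_smul (Real.exp _)]
    have h3 : (∫ r in t..0, Real.exp (-(μ * t)) • Real.exp (-(μ * (0 - r))) •
        A.specProj {μ} (f (ξ r))) = ∫ r in t..0, Real.exp (-(μ * (t - r))) •
        A.specProj {μ} (f (ξ r)) := by
      refine intervalIntegral.integral_congr fun r _ => ?_
      rw [smul_smul, ← Real.exp_add]
      congr 2
      ring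
    rw [h3]
    abel
  · rw [indicator_of_notMem hI, indicator_of_notMem hI, indicator_of_mem (mem_compl hI),
      zero_smul, zero_smul, sub_zero, zero_add]
    have hlim1 : Tendsto (fun s : ℝ => ∫ r in (0 : ℝ)..s,
        Real.exp (-(μ * r)) • A.specProj {μ} (f (ξ (t - r)))) atTop
        (𝓝 (∫ r in Ioi 0, Real.exp (-(μ * r)) • A.specProj {μ} (f (ξ (t - r))))) :=
      MeasureTheory.intervalIntegral_tendsto_integral_Ioi 0
        (h.integrableOn_exp_smul hξ hμ.pos t) tendsto_id
    have hlim2 : Tendsto (fun s : ℝ => Real.exp (-(μ * s)) •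
        A.specProj {μ} (A.fracEquiv h.mem (ξ (t - s)))) atTop (𝓝 0) := by
      have h1 : Tendsto (fun s : ℝ => Real.exp (-(μ * s)) * D) atTop (𝓝 0) := by
        have := (Real.tendsto_exp_neg_atTop_nhds_zero.comp
          (tendsto_id.const_mul_atTop hμ.pos)).mul_const D
        simpa using this
      refine squeeze_zero_norm' ?_ h1
      filter_upwards [eventually_ge_atTop 0] with s hs
      rw [norm_smul, Real.norm_of_nonneg (Real.exp_pos _).le]
      refine mul_le_mul_of_nonneg_left ?_ (Real.exp_pos _).le
      have h2 := hD (t - s) (by linarith)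
      rw [← (A.fracEquiv h.mem).norm_map] at h2
      refine le_trans ?_ h2
      have h3 : A.specProj {μ} (A.fracEquiv h.mem (ξ (t - s))) =
          A.specProj {μ} (A.fracEquiv h.mem (ξ (t - s) - A.fracProj α I (ξ (t - s)))) := by
        rw [map_sub, map_sub, fracEquiv_fracProj, specProj_singleton_specProj,
          indicator_of_notMem hI, zero_smul, sub_zero]
      rw [h3]
      exact A.norm_specProj_le _ _
    have hlim := hlim2.add (hlim1.const_smul (μ ^ α))
    rw [zero_add] at hlim
    refine tendsto_nhds_unique (tendsto_const_nhds.congr' ?_) hlim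
    filter_upwards [eventually_ge_atTop 0] with s hs
    have h1 := (hm.mono (S' := Icc (t - s) t) fun r hr => hr.2.trans ht).specProj_fracEquiv h.mem
      (by linarith) μ
    rw [sub_sub_cancel] at h1
    rw [h1, intervalIntegral.integral_of_le hs]

include hξ in
theorem isMild_of_eq_lp {p : X} (hlp : ∀ t ≤ 0, A.fracEquiv h.mem (ξ t) =
      A.expY I t p + A.lp α I (fun r => f (ξ r)) t) : A.IsMild f ξ (Iic 0) := by
  refine ⟨hξ.continuousOn, fun a ha c hc hac μ => ?_⟩
  by_cases hμ : A.IsEig μ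
  swap
  · simp only [A.specProj_eq_zero hμ, smul_zero, intervalIntegral.integral_zero, add_zero]
  have hkey : ∀ t ≤ 0, μ ^ α • A.specProj {μ} (ξ t : X) =
      A.specProj {μ} (A.expY I t p + A.lp α I (fun r => f (ξ r)) t) := fun t ht => by
    rw [← hlp t ht, A.specProj_fracEquiv]
  have hcan : μ ^ α ≠ 0 := (Real.rpow_pos_of_pos hμ.pos α).ne'
  refine smul_right_injective X hcan ?_
  have hci : ∀ x y : ℝ, IntervalIntegrable
      (fun r => Real.exp (-(μ * (c - r))) • A.specProj {μ} (f (ξ r))) MeasureTheory.volume x y := by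
    intro x y
    refine Continuous.intervalIntegrable ?_ x y
    have := h.continuous_f
    fun_prop
  simp only
  rw [smul_add, smul_comm, hkey c hc, hkey a ha]
  simp only [lp, map_add, map_sub, h.specProj_lpZ (h.continuous_comp hξ) h.bdd_comp,
    h.specProj_lpY (h.continuous_comp hξ), h.specProj_expY]
  by_cases hI : μ ∈ I
  · rw [indicator_of_mem hI, indicator_of_mem hI, indicator_of_mem hI,
      indicator_of_notMem (notMem_compl_iff.2 hI), zero_smul, zero_sub, zero_smul, zero_sub]
    rw [smul_add, smul_neg, smul_smul (Real.exp _), ← Real.exp_add, smul_comm (Real.exp _),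
      ← intervalIntegral.integral_smul (Real.exp _)]
    have h3 : (∫ r in a..0, Real.exp (-(μ * (c - a))) • Real.exp (-(μ * (a - r))) •
        A.specProj {μ} (f (ξ r))) = ∫ r in a..0, Real.exp (-(μ * (c - r))) •
        A.specProj {μ} (f (ξ r)) := by
      refine intervalIntegral.integral_congr fun r _ => ?_
      rw [smul_smul, ← Real.exp_add]
      congr 2
      ring
    have h4 : -(μ * (c - a)) + -(μ * a) = -(μ * c) := by ring
    rw [h3, h4, ← intervalIntegral.integral_add_adjacent_intervals (hci a c) (hci c 0), smul_add]
    abel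
  · rw [indicator_of_notMem hI, indicator_of_notMem hI, indicator_of_notMem hI,
      indicator_of_mem (mem_compl hI)]
    simp only [zero_smul, sub_zero, zero_add]
    have hd : 0 ≤ c - a := sub_nonneg.2 hac
    -- The part over `(0, c - a]` is the Duhamel integral on `[a, c]`; the tail, translated by `c -
    -- a`, is `e^{-μ(c-a)}` times the `Z` integral at `a`.
    have hsplit := MeasureTheory.setIntegral_union (μ := MeasureTheory.volume)
      (f := fun r => Real.exp (-(μ * r)) • A.specProj {μ} (f (ξ (c - r))))
      (s := Ioc 0 (c - a)) (t := Ioi (c - a)) (Ioc_disjoint_Ioi le_rfl) measurableSet_Ioi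
      ((h.integrableOn_exp_smul hξ hμ.pos c).mono_set Ioc_subset_Ioi_self)
      ((h.integrableOn_exp_smul hξ hμ.pos c).mono_set (Ioi_subset_Ioi hd))
    rw [Ioc_union_Ioi_eq_Ioi hd] at hsplit
    have hshift := (MeasureTheory.measurePreserving_add_right MeasureTheory.volume
      (c - a)).setIntegral_preimage_emb (measurableEmbedding_addRight (c - a))
      (fun r => Real.exp (-(μ * r)) • A.specProj {μ} (f (ξ (c - r)))) (Ioi (c - a))
    have hpre : (fun x => x + (c - a)) ⁻¹' Ioi (c - a) = Ioi 0 := by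
      ext x
      simp
    rw [hpre] at hshift
    rw [integral_exp_smul_comp_sub _ hac, hsplit, ← hshift, smul_add, add_comm]
    congr 1
    rw [smul_comm, ← MeasureTheory.integral_smul (Real.exp _)]
    congr 1
    refine MeasureTheory.setIntegral_congr_fun measurableSet_Ioi fun r _ => ?_
    have e1 : c - (r + (c - a)) = a - r := by ring
    have e2 : -(μ * (r + (c - a))) = -(μ * (c - a)) + -(μ * r) := by ring
    simp only [e1, e2, Real.exp_add, smul_smul]

end Equivalence

end GapData

end PosSelfAdjoint
end AttractorRate
namespace AttractorRate

universe u

namespace PosSelfAdjoint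

variable {X : Type u} [NormedAddCommGroup X] [InnerProductSpace ℝ X] [CompleteSpace X]
variable {A : PosSelfAdjoint X} {α : ℝ} {I : Set ℝ} {f : A.FracSpace α → X} {K b σ Λ : ℝ}

/-! ### Existence of the invariant manifold -/

theorem norm_sub_specProj_le (A : PosSelfAdjoint X) (I : Set ℝ) (x : X) :
    ‖x - A.specProj I x‖ ≤ ‖x‖ := by
  have := A.norm_le_of_specProj (x := x - A.specProj I x) (y := x) zero_le_one fun μ _ => by
    rw [map_sub, A.specProj_singleton_specProj, one_mul]
    by_cases h : μ ∈ I <;> simp [h]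
  simpa using this

theorem norm_sub_fracProj_le_self (hα : α ∈ Ioo (0 : ℝ) 1) (I : Set ℝ) (x : A.FracSpace α) :
    ‖x - A.fracProj α I x‖ ≤ ‖x‖ := by
  rw [← (A.fracEquiv hα).norm_map, ← (A.fracEquiv hα).norm_map x, map_sub, fracEquiv_fracProj]
  exact A.norm_sub_specProj_le I _

namespace GapData

variable (h : A.GapData I f K b σ Λ)

theorem norm_expY_le_of_nonpos (h : A.GapData I f K b σ Λ) {t : ℝ} (ht : t ≤ 0) (x : X) :
    ‖A.expY I t x‖ ≤ ‖x‖ * Real.exp (-(σ * t)) := by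
  refine (h.norm_expY_le t x).trans ?_
  rw [abs_of_nonpos ht, mul_comm]
  refine mul_le_mul_of_nonneg_left (Real.exp_le_exp.2 ?_) (norm_nonneg _)
  nlinarith [h.lt]

/-- The Lyapunov-Perron equation for `ξ` on `(-∞, 0]`. -/
def IsLP (h : A.GapData I f K b σ Λ) (p : X) (ξ : ℝ → A.FracSpace α) : Prop :=
  ∀ t ≤ 0, A.fracEquiv h.mem (ξ t) = A.expY I t p + A.lp α I (fun r => f (ξ r)) t

/-- An a priori weighted bound: as `f` is bounded by `K ≤ K e^{-σr}` for `r ≤ 0`, `GapData.small`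
contributes the `1/2`. It makes the supremum in `IsLP.norm_sub_le` finite. -/
theorem IsLP.norm_le {h : A.GapData I f K b σ Λ} {p : X} {ξ : ℝ → A.FracSpace α}
    (hξ : Continuous ξ) (hp : h.IsLP p ξ) {t : ℝ} (ht : t ≤ 0) :
    ‖ξ t‖ ≤ (‖p‖ + 1 / 2) * Real.exp (-(σ * t)) := by
  have h1 := h.norm_lp_le (h.continuous_comp hξ) (N := K) (fun r hr => (h.bdd_comp r).trans (by
    have : 1 ≤ Real.exp (-(σ * r)) := Real.one_le_exp (by nlinarith [h.pos, h.lt])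
    nlinarith [h.K_nonneg])) ht
  have h2 := norm_add_le (A.expY I t p) (A.lp α I (fun r => f (ξ r)) t)
  rw [← hp t ht, LinearIsometryEquiv.norm_map] at h2
  have h3 := h.norm_expY_le_of_nonpos ht p
  have h4 := mul_le_mul_of_nonneg_right h.small (Real.exp_pos (-(σ * t))).le
  linarith

/-- The weighted supremum `N` of the difference satisfies `N ≤ ‖p - q‖ + N/2`. This yields both the
Lipschitz constant of the manifold and, for `p = q`, uniqueness at time `0`. -/
theorem IsLP.norm_sub_le {h : A.GapData I f K b σ Λ} {p q : X} {ξ ζ : ℝ → A.FracSpace α}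
    (hξ : Continuous ξ) (hζ : Continuous ζ) (hp : h.IsLP p ξ) (hq : h.IsLP q ζ) :
    ‖ξ 0 - ζ 0‖ ≤ 2 * ‖p - q‖ := by
  have hstep : ∀ N : ℝ, 0 ≤ N → (∀ t ≤ 0, ‖ξ t - ζ t‖ ≤ N * Real.exp (-(σ * t))) →
      ∀ t ≤ 0, ‖ξ t - ζ t‖ ≤ (‖p - q‖ + 1 / 2 * N) * Real.exp (-(σ * t)) := by
    intro N hN0 hN t ht
    have hgc : Continuous fun r => f (ξ r) - f (ζ r) :=
      (h.continuous_comp hξ).sub (h.continuous_comp hζ)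
    have h1 := h.norm_lp_le hgc (N := K * N) (fun r hr => by
      rw [mul_assoc]
      exact (h.lip _ _).trans (mul_le_mul_of_nonneg_left (hN r hr) h.K_nonneg)) ht
    have h2 : A.fracEquiv h.mem (ξ t - ζ t) =
        A.expY I t (p - q) + A.lp α I (fun r => f (ξ r) - f (ζ r)) t := by
      rw [map_sub, hp t ht, hq t ht, map_sub, ← h.lp_sub (h.continuous_comp hξ) h.bdd_comp
        (h.continuous_comp hζ) h.bdd_comp]
      abel
    have h3 := norm_add_le (A.expY I t (p - q)) (A.lp α I (fun r => f (ξ r) - f (ζ r)) t)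
    rw [← h2, LinearIsometryEquiv.norm_map] at h3
    have h4 := h.norm_expY_le_of_nonpos ht (p - q)
    have h5 := mul_le_mul_of_nonneg_right (mul_le_mul_of_nonneg_right h.small hN0)
      (Real.exp_pos (-(σ * t))).le
    nlinarith
  set S := (fun t => ‖ξ t - ζ t‖ * Real.exp (σ * t)) '' Iic 0 with hS
  have hcancel : ∀ t : ℝ, Real.exp (-(σ * t)) * Real.exp (σ * t) = 1 := fun t => by
    rw [← Real.exp_add, neg_add_cancel, Real.exp_zero]
  have hbdd : BddAbove S := by
    refine ⟨‖p‖ + ‖q‖ + 1, ?_⟩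
    rintro _ ⟨t, ht, rfl⟩
    have h1 := hp.norm_le hξ ht
    have h2 := hq.norm_le hζ ht
    have h3 := _root_.norm_sub_le (ξ t) (ζ t)
    have h4 := mul_le_mul_of_nonneg_right
      (h3.trans (add_le_add h1 h2)) (Real.exp_pos (σ * t)).le
    refine h4.trans (le_of_eq ?_)
    linear_combination (‖p‖ + ‖q‖ + 1) * hcancel t
  have h0S : ‖ξ 0 - ζ 0‖ ∈ S := ⟨0, self_mem_Iic, by simp⟩
  have hN0 : 0 ≤ sSup S := (norm_nonneg _).trans (le_csSup hbdd h0S)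
  have h1 : ∀ t ≤ 0, ‖ξ t - ζ t‖ ≤ sSup S * Real.exp (-(σ * t)) := by
    intro t ht
    have h2 : ‖ξ t - ζ t‖ * Real.exp (σ * t) ≤ sSup S := le_csSup hbdd ⟨t, ht, rfl⟩
    have h3 := mul_le_mul_of_nonneg_right h2 (Real.exp_pos (-(σ * t))).le
    rwa [mul_assoc, mul_comm (Real.exp (σ * t)), hcancel, mul_one] at h3
  have h2 : sSup S ≤ ‖p - q‖ + 1 / 2 * sSup S := by
    refine csSup_le ⟨_, h0S⟩ ?_
    rintro _ ⟨t, ht, rfl⟩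
    have h3 := mul_le_mul_of_nonneg_right (hstep _ hN0 h1 t ht) (Real.exp_pos (σ * t)).le
    rwa [mul_assoc, hcancel, mul_one] at h3
  have h3 := le_csSup hbdd h0S
  linarith

theorem IsLP.fracEquiv_sub {h : A.GapData I f K b σ Λ} {p : X} {ξ : ℝ → A.FracSpace α}
    (hξ : Continuous ξ) (hp : h.IsLP p ξ) {t : ℝ} (ht : t ≤ 0) :
    A.fracEquiv h.mem (ξ t - A.fracProj α I (ξ t)) = A.lpZ α I (fun r => f (ξ r)) t := by
  refine A.ext_specProj fun μ => ?_
  rw [map_sub, map_sub, fracEquiv_fracProj, specProj_singleton_specProj, hp t ht, lp, map_add,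
    map_sub, h.specProj_lpZ (h.continuous_comp hξ) h.bdd_comp,
    h.specProj_lpY (h.continuous_comp hξ), h.specProj_expY]
  by_cases hI : μ ∈ I <;> simp [hI]

theorem IsLP.norm_sub_fracProj_le {h : A.GapData I f K b σ Λ} {p : X} {ξ : ℝ → A.FracSpace α}
    (hξ : Continuous ξ) (hp : h.IsLP p ξ) {t : ℝ} (ht : t ≤ 0) :
    ‖ξ t - A.fracProj α I (ξ t)‖ ≤ K * smoothConst α (Λ / 2) := by
  rw [← (A.fracEquiv h.mem).norm_map, hp.fracEquiv_sub hξ ht]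
  exact h.norm_lpZ_le h.bdd_comp t

/-- At time `0` the `Y` integral is void and the `Z` integral has no component in `I`. So the
parameter of the equation is the `Y` coordinate of the point. -/
theorem IsLP.fracProj_zero {h : A.GapData I f K b σ Λ} {v : A.FracSpace α} (hv : v ∈ A.fracY α I)
    {ξ : ℝ → A.FracSpace α} (hξ : Continuous ξ) (hp : h.IsLP (A.fracEquiv h.mem v) ξ) :
    A.fracProj α I (ξ 0) = v := by
  refine (A.fracEquiv h.mem).injective (A.ext_specProj fun μ => ?_)
  rw [fracEquiv_fracProj, specProj_singleton_specProj, hp 0 le_rfl, lp, map_add,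
    map_sub, h.specProj_lpZ (h.continuous_comp hξ) h.bdd_comp,
    h.specProj_lpY (h.continuous_comp hξ), h.specProj_expY]
  by_cases hI : μ ∈ I
  · simp [hI]
  · rw [A.specProj_fracEquiv, A.specProj_eq_zero_of_mem_fracY hv hI, indicator_of_notMem hI,
      zero_smul, smul_zero]

theorem expY_specProj (h : A.GapData I f K b σ Λ) (t : ℝ) (x : X) :
    A.expY I t (A.specProj I x) = A.expY I t x := by
  refine A.ext_specProj fun μ => ?_
  rw [h.specProj_expY, h.specProj_expY, specProj_singleton_specProj]
  by_cases hI : μ ∈ I <;> simp [hI]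

/-! ### The fixed point in the exponentially weighted space. -/

open BoundedContinuousFunction

/-- The trajectory in `X^α` that belongs to a bounded function, in exponentially weighted norm. -/
noncomputable def unweight (h : A.GapData I f K b σ Λ) (η : ℝ →ᵇ X) (r : ℝ) : A.FracSpace α :=
  (A.fracEquiv h.mem).symm (Real.exp (-(σ * r)) • η r)

theorem continuous_unweight (h : A.GapData I f K b σ Λ) (η : ℝ →ᵇ X) :
    Continuous (h.unweight η) := by
  refine (A.fracEquiv h.mem).symm.continuous.comp ?_
  have := η.continuous
  fun_prop

/-- The Lyapunov-Perron operator in the exponentially weighted space. -/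
noncomputable def lpMap (h : A.GapData I f K b σ Λ) (p : X) (η : ℝ →ᵇ X) : ℝ →ᵇ X :=
  BoundedContinuousFunction.ofNormedAddCommGroup
    -- Freezing time at `min t 0` gives bounded continuous functions on the whole line; the integral
    -- at times `≤ 0` uses `η` only at times `≤ 0`.
    (fun t => Real.exp (σ * min t 0) • (A.expY I (min t 0) p +
      A.lp α I (fun r => f (h.unweight η r)) (min t 0)))
    (by
      have h1 := h.continuous_expY (g := fun _ => p) continuous_const
      have h2 := h.continuous_lp (h.continuous_comp (h.continuous_unweight η)) h.bdd_comp
      have h3 : Continuous fun t : ℝ => min t 0 := by fun_prop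
      exact (by fun_prop : Continuous fun t : ℝ => Real.exp (σ * min t 0)).smul
        ((h1.comp h3).add (h2.comp h3)))
    (‖p‖ + 1 / 2) (by
      intro t
      have ht : min t 0 ≤ 0 := min_le_right _ _
      rw [norm_smul, Real.norm_of_nonneg (Real.exp_pos _).le]
      have h1 := h.norm_lp_le (h.continuous_comp (h.continuous_unweight η)) (N := K)
        (fun r hr => (h.bdd_comp r).trans (by
          have : 1 ≤ Real.exp (-(σ * r)) := Real.one_le_exp (by nlinarith [h.pos, h.lt])
          nlinarith [h.K_nonneg])) ht
      have h2 := norm_add_le (A.expY I (min t 0) p)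
        (A.lp α I (fun r => f (h.unweight η r)) (min t 0))
      have h3 := h.norm_expY_le_of_nonpos ht p
      have h4 := mul_le_mul_of_nonneg_right h.small (Real.exp_pos (-(σ * min t 0))).le
      have h5 : ‖A.expY I (min t 0) p + A.lp α I (fun r => f (h.unweight η r)) (min t 0)‖ ≤
          (‖p‖ + 1 / 2) * Real.exp (-(σ * min t 0)) := by linarith
      refine (mul_le_mul_of_nonneg_left h5 (Real.exp_pos (σ * min t 0)).le).trans (le_of_eq ?_)
      rw [mul_left_comm, ← Real.exp_add, add_neg_cancel, Real.exp_zero, mul_one])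

theorem lpMap_apply (h : A.GapData I f K b σ Λ) (p : X) (η : ℝ →ᵇ X) (t : ℝ) : h.lpMap p η t =
    Real.exp (σ * min t 0) • (A.expY I (min t 0) p +
      A.lp α I (fun r => f (h.unweight η r)) (min t 0)) := rfl

/-- At times `r ≤ 0` the two nonlinear terms differ by at most `K * dist η η' * e^{-σr}`, which is
the input of `norm_lp_le`; the outer weight cancels the exponential of its output. -/
theorem contracting_lpMap (h : A.GapData I f K b σ Λ) (p : X) :
    ContractingWith (1 / 2) (h.lpMap p) := by
  refine ⟨by rw [one_div]; exact inv_lt_one_of_one_lt₀ one_lt_two,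
    LipschitzWith.of_dist_le_mul fun η η' => ?_⟩
  refine (BoundedContinuousFunction.dist_le (by positivity)).2 fun t => ?_
  have ht : min t 0 ≤ 0 := min_le_right _ _
  have hgc : Continuous fun r => f (h.unweight η r) - f (h.unweight η' r) :=
    (h.continuous_comp (h.continuous_unweight η)).sub (h.continuous_comp (h.continuous_unweight η'))
  have h1 := h.norm_lp_le hgc (N := K * dist η η') (fun r _ => by
    refine (h.lip _ _).trans ?_
    rw [mul_assoc]
    refine mul_le_mul_of_nonneg_left ?_ h.K_nonneg
    unfold unweight
    rw [← map_sub, LinearIsometryEquiv.norm_map, ← smul_sub, norm_smul,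
      Real.norm_of_nonneg (Real.exp_pos _).le, ← dist_eq_norm, mul_comm]
    exact mul_le_mul_of_nonneg_right (BoundedContinuousFunction.dist_coe_le_dist r)
      (Real.exp_pos _).le) ht
  rw [lpMap_apply, lpMap_apply, dist_eq_norm, ← smul_sub, add_sub_add_left_eq_sub,
    h.lp_sub (h.continuous_comp (h.continuous_unweight η)) h.bdd_comp
      (h.continuous_comp (h.continuous_unweight η')) h.bdd_comp, norm_smul,
    Real.norm_of_nonneg (Real.exp_pos _).le]
  refine (mul_le_mul_of_nonneg_left h1 (Real.exp_pos _).le).trans ?_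
  have h2 : Real.exp (σ * min t 0) * Real.exp (-(σ * min t 0)) = 1 := by
    rw [← Real.exp_add, add_neg_cancel, Real.exp_zero]
  have h3 := mul_le_mul_of_nonneg_right h.small (dist_nonneg (x := η) (y := η'))
  calc _ = (K * (b ^ α / (σ - b) + smoothConst α (Λ / 2 - σ)) * dist η η') *
        (Real.exp (σ * min t 0) * Real.exp (-(σ * min t 0))) := by ring
    _ ≤ 1 / 2 * dist η η' := by rwa [h2, mul_one]
    _ = _ := by simp

theorem exists_isLP (h : A.GapData I f K b σ Λ) (p : X) :
    ∃ ξ : ℝ → A.FracSpace α, Continuous ξ ∧ h.IsLP p ξ := by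
  obtain ⟨η, hη⟩ : ∃ η, h.lpMap p η = η :=
    ⟨_, (h.contracting_lpMap p).fixedPoint_isFixedPt⟩
  refine ⟨h.unweight η, h.continuous_unweight η, fun t ht => ?_⟩
  have h1 : h.lpMap p η t = η t := by rw [hη]
  rw [lpMap_apply, min_eq_left ht] at h1
  rw [unweight, LinearIsometryEquiv.apply_symm_apply, ← h1, smul_smul, ← Real.exp_add,
    neg_add_cancel, Real.exp_zero, one_smul]

/-- The backward solution is continued by the semigroup from `ξ 0`. At negative times the semigroup
follows `ξ` by uniqueness of mild solutions, and a step across time `0` is split there. -/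
theorem exists_global_solution (h : A.GapData I f K b σ Λ)
    {T : ℝ → A.FracSpace α → A.FracSpace α} (hT : A.IsSolutionSemigroup f T)
    {ξ : ℝ → A.FracSpace α} (hξ : Continuous ξ) (hm : A.IsMild f ξ (Iic 0)) :
    ∃ ζ : ℝ → A.FracSpace α, Continuous ζ ∧ (∀ τ t : ℝ, 0 ≤ t → T t (ζ τ) = ζ (t + τ)) ∧
      ∀ t ≤ 0, ζ t = ξ t := by
  have hTc : Continuous fun t : ℝ => T (max t 0) (ξ 0) :=
    hT.continuousOn.comp_continuous (f := fun t : ℝ => (max t 0, ξ 0)) (by fun_prop)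
      fun t => ⟨mem_Ici.2 (le_max_right t 0), mem_univ _⟩
  set ζ : ℝ → A.FracSpace α := fun t => if t ≤ 0 then ξ t else T (max t 0) (ξ 0) with hζdef
  have hneg : ∀ t ≤ 0, ζ t = ξ t := fun t ht => if_pos ht
  have hpos : ∀ t, 0 ≤ t → ζ t = T t (ξ 0) := by
    intro t ht
    rcases ht.eq_or_lt with rfl | ht'
    · rw [hneg 0 le_rfl, hT.zero]
    · simp only [hζdef, if_neg (not_le.2 ht'), max_eq_left ht]
  have hnn : ∀ τ t : ℝ, 0 ≤ t → t + τ ≤ 0 → T t (ξ τ) = ξ (t + τ) := by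
    intro τ t ht htτ
    have h1 : A.IsMild f (fun r => T (r - τ) (ξ τ)) (Icc τ (t + τ)) := by
      refine hT.isMild h.continuous_f ordConnected_Icc ?_ fun a ha c _ hac => ?_
      · exact hT.continuousOn.comp (f := fun r : ℝ => (r - τ, ξ τ)) (by fun_prop)
          fun r hr => ⟨sub_nonneg.2 hr.1, mem_univ _⟩
      · rw [← hT.add _ _ (sub_nonneg.2 hac) (sub_nonneg.2 ha.1), sub_add_sub_cancel]
    have h2 := IsMild.eqOn_of_eq_left h.mem h.lip h.continuous_f h1
      (hm.mono fun r hr => hr.2.trans htτ) (by simp [hT.zero])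
    have h3 := h2 (right_mem_Icc.2 (by linarith))
    simpa using h3
  refine ⟨ζ, ?_, fun τ t ht => ?_, hneg⟩
  · refine Continuous.if_le hξ hTc continuous_id continuous_const fun x hx => ?_
    have hx0 : x = 0 := hx
    rw [hx0, max_self, hT.zero]
  · rcases le_total 0 τ with hτ | hτ
    · rw [hpos τ hτ, hpos _ (by linarith), hT.add _ _ ht hτ]
    · rcases le_total (t + τ) 0 with hs | hs
      · rw [hneg τ hτ, hneg _ hs, hnn τ t ht hs]
      · have h1 := hnn τ (-τ) (by linarith) (by linarith)
        rw [neg_add_cancel] at h1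
        rw [hneg τ hτ, hpos _ hs, ← h1, ← hT.add _ _ hs (by linarith)]
        congr 1
        ring

/-- `s v` is the `Z` part at time `0` of the Lyapunov-Perron solution with parameter `v`. For
invariance, the translate of the global solution to time `τ` is a backward mild solution with
bounded `Z` part. Hence it solves the equation with parameter `Q ζ(τ)`, and uniqueness puts `ζ(τ)`
on the graph. -/
theorem exists_invariantManifold (h : A.GapData I f K b σ Λ)
    {T : ℝ → A.FracSpace α → A.FracSpace α} (hT : A.IsSolutionSemigroup f T) :
    ∃ s : A.fracY α I → A.fracZ α I, (∃ L, LipschitzWith L s) ∧ (∃ D, ∀ v, ‖s v‖ ≤ D) ∧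
      IsInvariantManifold T (A.graphOf s) := by
  choose ξ hξc hξ using h.exists_isLP
  set Ξ : A.fracY α I → A.FracSpace α := fun v => ξ (A.fracEquiv h.mem (v : A.FracSpace α)) 0
    with hΞ
  have hQ : ∀ v : A.fracY α I, A.fracProj α I (Ξ v) = v := fun v =>
    (hξ _).fracProj_zero v.2 (hξc _)
  set s : A.fracY α I → A.fracZ α I := fun v =>
    ⟨Ξ v - A.fracProj α I (Ξ v), ⟨Ξ v, rfl⟩⟩ with hs
  have hgraph : ∀ v : A.fracY α I, (v : A.FracSpace α) + (s v : A.FracSpace α) = Ξ v := by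
    intro v
    simp only [hs]
    rw [hQ, add_sub_cancel]
  refine ⟨s, ⟨2, LipschitzWith.of_dist_le_mul fun v w => ?_⟩,
    ⟨K * smoothConst α (Λ / 2), fun v => (hξ _).norm_sub_fracProj_le (hξc _) le_rfl⟩, ?_⟩
  · rw [dist_eq_norm, dist_eq_norm]
    change ‖(Ξ v - A.fracProj α I (Ξ v)) - (Ξ w - A.fracProj α I (Ξ w))‖ ≤
      2 * ‖(v : A.FracSpace α) - w‖
    rw [sub_sub_sub_comm, ← map_sub]
    refine (norm_sub_fracProj_le_self h.mem I _).trans ?_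
    refine (IsLP.norm_sub_le (hξc _) (hξc _) (hξ _) (hξ _)).trans (le_of_eq ?_)
    rw [← map_sub, LinearIsometryEquiv.norm_map]
  · rintro _ ⟨v, rfl⟩
    simp only [hgraph]
    set p := A.fracEquiv h.mem (v : A.FracSpace α) with hp
    obtain ⟨ζ, hζc, hζ, hζξ⟩ := h.exists_global_solution hT (hξc p)
      (h.isMild_of_eq_lp (hξc p) (hξ p))
    refine ⟨ζ, hζc, hζ, hζξ 0 le_rfl, fun τ => ?_⟩
    set C := K * smoothConst α (Λ / 2) with hC
    have hC0 : 0 ≤ C := mul_nonneg h.K_nonneg (smoothConst_nonneg h.mem.2 (by linarith [h.Λ_pos]))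
    have hm : A.IsMild f ζ univ := by
      refine hT.isMild h.continuous_f ordConnected_univ hζc.continuousOn fun a _ c _ hac => ?_
      rw [hζ a _ (sub_nonneg.2 hac), sub_add_cancel]
    -- One `C` bounds the `Z` part at times `≤ 0`; at later times the forcing adds a second.
    have hbd : ∀ t, ‖ζ t - A.fracProj α I (ζ t)‖ ≤ C + C := by
      intro t
      have hle : ∀ t ≤ 0, ‖ζ t - A.fracProj α I (ζ t)‖ ≤ C := fun t ht => by
        rw [hζξ t ht]
        exact (hξ p).norm_sub_fracProj_le (hξc p) ht
      rcases le_total t 0 with ht | ht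
      · linarith [hle t ht]
      · refine ((hm.mono (subset_univ _)).norm_sub_fracProj_le h.mem h.continuous_f h.Λ_pos h.ge
          h.bdd ht).trans (add_le_add_left ?_ C)
        have h1 : Real.exp (-(Λ * (t - 0))) ≤ 1 :=
          Real.exp_le_one_iff.2 (by nlinarith [h.Λ_pos])
        exact (mul_le_of_le_one_left (norm_nonneg _) h1).trans (hle 0 le_rfl)
    have hζ'c : Continuous fun t => ζ (τ + t) := by fun_prop
    have hm' : A.IsMild f (fun t => ζ (τ + t)) (Iic 0) := by
      refine hT.isMild h.continuous_f ordConnected_Iic hζ'c.continuousOn fun a _ c _ hac => ?_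
      rw [hζ _ _ (sub_nonneg.2 hac)]
      congr 1
      ring
    have hlp : h.IsLP (A.fracEquiv h.mem (A.fracProj α I (ζ τ))) fun t => ζ (τ + t) := by
      intro t ht
      have h1 := h.eq_lp_of_isMild hζ'c hm' (fun t _ => hbd _) ht
      rw [add_zero] at h1
      rw [fracEquiv_fracProj, h.expY_specProj]
      exact h1
    have huniq := IsLP.norm_sub_le hζ'c
      (hξc (A.fracEquiv h.mem (A.fracProj α I (ζ τ)))) hlp (hξ _)
    rw [sub_self, norm_zero, mul_zero, add_zero] at huniq
    have h1 := sub_eq_zero.1 (norm_le_zero_iff.1 huniq)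
    exact ⟨⟨A.fracProj α I (ζ τ), ⟨_, rfl⟩⟩, (hgraph _).trans h1.symm⟩

end GapData

end PosSelfAdjoint
end AttractorRate
namespace AttractorRate

universe u

namespace PosSelfAdjoint

variable {X : Type u} [NormedAddCommGroup X] [InnerProductSpace ℝ X] [CompleteSpace X]
variable {A : PosSelfAdjoint X} {α : ℝ} {I : Set ℝ} {f : A.FracSpace α → X}

/-! ### The reduced semigroup -/

/-- `c` is controlled only for `t ≥ 0`. The explicit formula `G` is differentiable on all of `ℝ` and
agrees with `c` there, so the fundamental theorem of calculus is applied to `G`. -/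
theorem eq_add_integral_of_variation_of_constants {E : Type*} [NormedAddCommGroup E]
    [NormedSpace ℝ E] [CompleteSpace E] {μ : ℝ} {c g : ℝ → E} (hg : Continuous g)
    (hc : ∀ t, 0 ≤ t → c t = Real.exp (-(μ * t)) • c 0 +
      ∫ r in (0 : ℝ)..t, Real.exp (-(μ * (t - r))) • g r) {t : ℝ} (ht : 0 ≤ t) :
    c t = c 0 + ∫ r in (0 : ℝ)..t, (-(μ • c r) + g r) := by
  set G : ℝ → E := fun t => Real.exp (-(μ * t)) • (c 0 + ∫ r in (0 : ℝ)..t, Real.exp (μ * r) • g r)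
    with hG
  have hcG : ∀ t, 0 ≤ t → c t = G t := by
    intro t ht
    rw [hc t ht]
    simp only [hG]
    rw [smul_add, ← intervalIntegral.integral_smul]
    congr 1
    refine intervalIntegral.integral_congr fun r _ => ?_
    change _ = Real.exp (-(μ * t)) • Real.exp (μ * r) • g r
    rw [smul_smul, ← Real.exp_add]
    congr 2
    ring
  have hderiv : ∀ t, HasDerivAt G (-(μ • G t) + g t) t := by
    intro t
    have hcont : Continuous fun r => Real.exp (μ * r) • g r := by fun_prop
    have h1 : HasDerivAt (fun t => ∫ r in (0 : ℝ)..t, Real.exp (μ * r) • g r)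
        (Real.exp (μ * t) • g t) t :=
      intervalIntegral.integral_hasDerivAt_right (hcont.intervalIntegrable _ _)
        (hcont.stronglyMeasurableAtFilter _ _) hcont.continuousAt
    have h2 : HasDerivAt (fun t : ℝ => Real.exp (-(μ * t))) (Real.exp (-(μ * t)) * -(μ * 1)) t :=
      (((hasDerivAt_id t).const_mul μ).neg).exp
    have h3 := h2.smul (h1.const_add (c 0))
    refine h3.congr_deriv ?_
    rw [smul_smul, ← Real.exp_add, neg_add_cancel, Real.exp_zero, one_smul, add_comm]
    congr 1
    simp only [hG]
    rw [smul_smul, ← neg_smul]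
    congr 1
    ring
  have hGc : Continuous G := continuous_iff_continuousAt.2 fun t => (hderiv t).continuousAt
  have h1 := intervalIntegral.integral_eq_sub_of_hasDerivAt (a := 0) (b := t)
    (fun r _ => hderiv r) ((by fun_prop : Continuous fun r => -(μ • G r) + g r).intervalIntegrable
      0 t)
  have h2 : ∫ r in (0 : ℝ)..t, (-(μ • c r) + g r) = ∫ r in (0 : ℝ)..t, (-(μ • G r) + g r) := by
    refine intervalIntegral.integral_congr fun r hr => ?_
    rw [uIcc_of_le ht] at hr
    rw [hcG r hr.1]
  rw [h2, h1, hcG t ht, hcG 0 le_rfl]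
  abel

theorem indicator_id_bound {b : ℝ} (hI : ∀ μ ∈ I, μ ≤ b) (hb : 0 ≤ b) :
    ∀ μ, A.IsEig μ → |I.indicator (fun μ => μ) μ| ≤ b := by
  intro μ hμ
  by_cases h : μ ∈ I
  · rw [indicator_of_mem h, abs_of_pos hμ.pos]
    exact hI μ h
  · rwa [indicator_of_notMem h, abs_zero]

theorem mem_graph_diag_of_mem_fracY {b : ℝ} (hI : ∀ μ ∈ I, μ ≤ b) (hb : 0 ≤ b)
    {v : A.FracSpace α} (hv : v ∈ A.fracY α I) :
    ((v : X), A.diag (I.indicator fun μ => μ) (v : X)) ∈ A.toLinearPMap.graph := by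
  refine A.specProj_mem_graph_iff.2 fun μ => ?_
  rw [A.specProj_diag (indicator_id_bound hI hb)]
  by_cases h : μ ∈ I
  · rw [indicator_of_mem h]
  · rw [A.specProj_eq_zero_of_mem_fracY hv h, smul_zero, smul_zero]

/-- The semigroup is `Q T(t)(w + s w)`. Invariance keeps `T(t)` on the graph over it, and since `A`
is bounded on `Y` the mild equation becomes an integral equation with continuous integrand, hence
differentiable. -/
theorem IsSolutionSemigroup.exists_isReducedSemigroup (hα : α ∈ Ioo (0 : ℝ) 1) {b : ℝ}
    (hI : ∀ μ ∈ I, μ ≤ b) (hb : 0 ≤ b) (hf : Continuous f)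
    {T : ℝ → A.FracSpace α → A.FracSpace α} (hT : A.IsSolutionSemigroup f T)
    {s : A.fracY α I → A.fracZ α I} (hs : IsInvariantManifold T (A.graphOf s)) :
    ∃ S, A.IsReducedSemigroup f s S := by
  have hQ : ∀ v : A.fracY α I, A.fracProj α I ((v : A.FracSpace α) + (s v : A.FracSpace α)) = v :=
    fun v => by
      rw [map_add, A.mem_fracY_iff.1 v.2, A.mem_fracZ_iff.1 (s v).2, add_zero]
  refine ⟨fun t w => ⟨A.fracProj α I (T t ((w : A.FracSpace α) + (s w : A.FracSpace α))),
    ⟨_, rfl⟩⟩, fun w => ⟨Subtype.ext ?_, fun t ht => ?_⟩⟩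
  · simp only [hT.zero, hQ]
  set w' : A.FracSpace α := (w : A.FracSpace α) + (s w : A.FracSpace α) with hw'
  set v : A.fracY α I := ⟨A.fracProj α I (T t w'), ⟨_, rfl⟩⟩ with hv
  -- The global solution in the graph through `w'` coincides with `T t w'` for `t ≥ 0`, and the
  -- projection to `Y` identifies the base point.
  have hinv : (v : A.FracSpace α) + (s v : A.FracSpace α) = T t w' := by
    obtain ⟨ξ, -, h1, h2, h3⟩ := hs w' ⟨w, rfl⟩
    have h4 := h1 0 t ht
    rw [h2, add_zero] at h4
    obtain ⟨v', hv'⟩ := h3 t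
    rw [← h4] at hv'
    have h5 : v' = v := Subtype.ext (by
      change _ = A.fracProj α I (T t w')
      rw [← hv']
      exact (hQ v').symm)
    rw [← h5]
    exact hv'
  set B := A.diag (X := X) (I.indicator fun μ => μ) with hB
  set u : ℝ → A.FracSpace α := fun t => T (max t 0) w' with hu
  have huc : Continuous u :=
    hT.continuousOn.comp_continuous (f := fun t : ℝ => (max t 0, w')) (by fun_prop)
      fun t => ⟨mem_Ici.2 (le_max_right t 0), mem_univ _⟩
  have huX : Continuous fun t => (u t : X) := (A.toX hα).continuous.comp huc
  have hfu : Continuous fun t => f (u t) := hf.comp huc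
  have hut : ∀ r, 0 ≤ r → u r = T r w' := fun r hr => by simp only [hu, max_eq_left hr]
  have hFc : Continuous fun r => -B (A.specProj I (u r : X)) + A.specProj I (f (u r)) := by
    fun_prop
  have hint : ∀ r, 0 ≤ r → A.specProj I (u r : X) = A.specProj I (u 0 : X) +
      ∫ q in (0 : ℝ)..r, (-B (A.specProj I (u q : X)) + A.specProj I (f (u q))) := by
    intro r hr
    refine A.ext_specProj fun μ => ?_
    rw [map_add, ← ContinuousLinearMap.intervalIntegral_comp_comm _
      (hFc.intervalIntegrable _ _)]
    simp only [map_add, map_neg, hB, A.specProj_diag (indicator_id_bound hI hb),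
      specProj_singleton_specProj]
    by_cases h : μ ∈ I
    · simp only [indicator_of_mem h, one_smul]
      refine eq_add_integral_of_variation_of_constants (c := fun r => A.specProj {μ} (u r : X))
        (g := fun r => A.specProj {μ} (f (u r))) (by fun_prop) (fun t ht => ?_) hr
      rw [hut t ht, hut 0 le_rfl, hT.specProj_eq hf ht w' μ, hT.zero]
      congr 1
      refine intervalIntegral.integral_congr fun r hr => ?_
      rw [uIcc_of_le ht] at hr
      simp only [hut r hr.1]
    · simp only [indicator_of_notMem h, zero_smul, smul_zero, neg_zero, add_zero,
        intervalIntegral.integral_zero]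
  have hgr := mem_graph_diag_of_mem_fracY hI hb v.2
  obtain ⟨y, hy1, hy2⟩ := (LinearPMap.mem_graph_iff _).1 hgr
  simp only at hy1 hy2
  have hdom : ((v : A.FracSpace α) : X) ∈ A.toLinearPMap.domain := hy1 ▸ y.2
  refine ⟨hdom, ?_⟩
  have hy : (⟨((v : A.FracSpace α) : X), hdom⟩ : A.toLinearPMap.domain) = y := Subtype.ext hy1.symm
  have hderiv : HasDerivAt (fun r => A.specProj I (u 0 : X) +
      ∫ q in (0 : ℝ)..r, (-B (A.specProj I (u q : X)) + A.specProj I (f (u q))))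
      (-B (A.specProj I (u t : X)) + A.specProj I (f (u t))) t :=
    (intervalIntegral.integral_hasDerivAt_right (hFc.intervalIntegrable _ _)
      (hFc.stronglyMeasurableAtFilter _ _) hFc.continuousAt).const_add _
  have hw : HasDerivWithinAt (fun r => A.specProj I (T r w' : X))
      (-B (A.specProj I (u t : X)) + A.specProj I (f (u t))) (Ici 0) t :=
    hderiv.hasDerivWithinAt.congr (fun r hr => by rw [← hint r hr, hut r hr])
      (by rw [← hint t ht, hut t ht])
  refine hw.congr_deriv ?_
  change _ = -A.toLinearPMap ⟨((v : A.FracSpace α) : X), hdom⟩ +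
    A.specProj I (f ((v : A.FracSpace α) + (s v : A.FracSpace α)))
  rw [hinv, hy, hy2, hut t ht]
  rfl

end PosSelfAdjoint
end AttractorRate
namespace AttractorRate

universe u v

namespace PosSelfAdjoint

variable {X : Type u} [NormedAddCommGroup X] [InnerProductSpace ℝ X] [CompleteSpace X]
variable {X₀ : Type v} [NormedAddCommGroup X₀] [InnerProductSpace ℝ X₀]

/-! ### Comparison with the limit operator -/

theorem rpow_inv_le_of_rpow_le {α c μ : ℝ} (hα : α < 1) (hμ : 0 < μ) (h : μ ^ (α - 1) ≤ c) :
    c ^ (α - 1)⁻¹ ≤ μ := by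
  have h1 := Real.rpow_le_rpow_of_nonpos (Real.rpow_pos_of_pos hμ (α - 1)) h
    (inv_nonpos.2 (by linarith : α - 1 ≤ 0))
  rwa [← Real.rpow_mul hμ.le, mul_inv_cancel₀ (by linarith), Real.rpow_one] at h1

/-- The operators `E` and `M` connect `X` with the limit space `X₀`, and `A⁻¹` is close to
`E A₀⁻¹ M`. -/
structure Connection (A : PosSelfAdjoint X) (A₀ : X₀ ≃L[ℝ] X₀) {α : ℝ}
    (hα : α ∈ Ioo (0 : ℝ) 1) (E : X₀ →L[ℝ] A.FracSpace α) (M : X →L[ℝ] X₀) (K t : ℝ) : Prop where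
  K_nonneg : 0 ≤ K
  t_nonneg : 0 ≤ t
  leftInv : ∀ u, M (E u : X) = u
  norm_E_le : ∀ u, ‖E u‖ ≤ K * ‖u‖
  norm_M_le : ∀ x, ‖M x‖ ≤ K * ‖x‖
  norm_M_frac_le : ∀ x : A.FracSpace α, ‖M (x : X)‖ ≤ K * ‖x‖
  rate : ∀ x : X, ‖A.invFrac hα x - E (A₀.symm (M x))‖ ≤ t * ‖x‖

variable {A : PosSelfAdjoint X} {A₀ : X₀ ≃L[ℝ] X₀} {α : ℝ} {hα : α ∈ Ioo (0 : ℝ) 1}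
  {E : X₀ →L[ℝ] A.FracSpace α} {M : X →L[ℝ] X₀} {K t : ℝ}

theorem norm_apply_le (A₀ : X₀ ≃L[ℝ] X₀) (x : X₀) : ‖A₀ x‖ ≤ ‖(A₀ : X₀ →L[ℝ] X₀)‖ * ‖x‖ :=
  (A₀ : X₀ →L[ℝ] X₀).le_opNorm x

theorem map_coe_sub (M : X →L[ℝ] X₀) (x y : A.FracSpace α) :
    M ((x - y : A.FracSpace α) : X) = M (x : X) - M (y : X) := by
  rw [← map_sub]
  rfl

namespace Connection

variable (h : Connection A A₀ hα E M K t)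
include h

/-- The resolvent rate tested on an eigenvector. As `α - 1 < 0`, this is a lower bound for the
spectrum, uniform once `t` is bounded. -/
theorem rpow_le {μ : ℝ} (hμ : A.IsEig μ) :
    μ ^ (α - 1) ≤ t + K ^ 2 * ‖(A₀.symm : X₀ →L[ℝ] X₀)‖ := by
  obtain ⟨x, hx, h0⟩ := hμ
  have hx0 : 0 < ‖x‖ := norm_pos_iff.2 h0
  refine le_of_mul_le_mul_right ?_ hx0
  rw [← A.norm_invFrac_of_mem_eigenspace hα hx]
  have h1 := norm_le_norm_sub_add (A.invFrac hα x) (E (A₀.symm (M x)))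
  have h2 := h.norm_E_le (A₀.symm (M x))
  have h3 := norm_apply_le A₀.symm (M x)
  have h4 := h.norm_M_le x
  have h5 : ‖E (A₀.symm (M x))‖ ≤ K * (‖(A₀.symm : X₀ →L[ℝ] X₀)‖ * (K * ‖x‖)) :=
    h2.trans (mul_le_mul_of_nonneg_left
      (h3.trans (mul_le_mul_of_nonneg_left h4 (norm_nonneg _))) h.K_nonneg)
  have h6 := h.rate x
  linarith

/-- `M` applied to the resolvent rate, with `M E = 1`: the operators `M A⁻¹` and `A₀⁻¹ M` almost
agree. -/
theorem norm_symm_sub_le (x : X) :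
    ‖M (A.invFrac hα x : X) - A₀.symm (M x)‖ ≤ K * t * ‖x‖ := by
  have h1 := h.norm_M_frac_le (A.invFrac hα x - E (A₀.symm (M x)))
  rw [map_coe_sub, h.leftInv] at h1
  have h2 := mul_le_mul_of_nonneg_left (h.rate x) h.K_nonneg
  linarith

/-- Large eigenvalues are controlled by the distance of the resolvents. -/
theorem rpow_le_of_large {μ : ℝ} (hμ : A.IsEig μ) (hl : 2 * ‖(A₀ : X₀ →L[ℝ] X₀)‖ ≤ μ) :
    μ ^ (α - 1) ≤ (1 + 2 * K ^ 2) * t := by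
  have hpos := hμ.pos
  obtain ⟨x, hx, h0⟩ := hμ
  have hx0 : 0 < ‖x‖ := norm_pos_iff.2 h0
  refine le_of_mul_le_mul_right ?_ hx0
  rw [← A.norm_invFrac_of_mem_eigenspace hα hx]
  -- `M A⁻¹ x = μ⁻¹ A₀ y` has norm at most `‖y‖/2` and lies within `K t ‖x‖` of `y`. Hence `‖y‖ ≤ 2
  -- K t ‖x‖`, and `A⁻¹ x`, being close to `E y`, is small.
  set y := A₀.symm (M x) with hy
  have hMx : M x = A₀ y := by rw [hy, ContinuousLinearEquiv.apply_symm_apply]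
  have hinv : (A.invFrac hα x : X) = μ⁻¹ • x := A.inv_of_mem_eigenspace hx
  have h1 := h.norm_symm_sub_le x
  rw [hinv, map_smul, hMx, ContinuousLinearEquiv.symm_apply_apply] at h1
  have h2 : ‖μ⁻¹ • A₀ y‖ ≤ 1 / 2 * ‖y‖ := by
    rw [norm_smul, norm_inv, Real.norm_of_nonneg hpos.le, inv_mul_le_iff₀ hpos]
    have := norm_apply_le A₀ y
    nlinarith [norm_nonneg y]
  have h3 := norm_sub_norm_le y (μ⁻¹ • A₀ y)
  rw [norm_sub_rev] at h3
  have h4 : ‖y‖ ≤ 2 * (K * t * ‖x‖) := by linarith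
  have h5 := norm_le_norm_sub_add (A.invFrac hα x) (E y)
  have h6 := h.norm_E_le y
  have h7 := h.rate x
  have h8 := mul_le_mul_of_nonneg_left h4 h.K_nonneg
  linarith

/-- `A⁻¹ z` is `O(t)` as only large eigenvalues occur in `z`. So `A₀⁻¹ M z`, close to `M A⁻¹ z`, is
`O(t)` too, and the bounded operator `A₀` removes the inverse. -/
theorem norm_M_le_of_specProj_eq_zero {I : Set ℝ}
    (hI : A.EigGE Iᶜ (2 * ‖(A₀ : X₀ →L[ℝ] X₀)‖)) {z : X}
    (hz : ∀ μ ∈ I, A.specProj {μ} z = 0) :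
    ‖M z‖ ≤ ‖(A₀ : X₀ →L[ℝ] X₀)‖ * (K * (2 + 2 * K ^ 2)) * t * ‖z‖ := by
  have h1 : ‖A.invFrac hα z‖ ≤ (1 + 2 * K ^ 2) * t * ‖z‖ := by
    refine A.norm_invFrac_le hα (mul_nonneg (by positivity) h.t_nonneg) fun μ hμ => ?_
    have hμe := A.isEig_of_specProj_ne_zero hμ
    exact h.rpow_le_of_large hμe (hI μ (fun hm => hμ (hz μ hm)) hμe)
  have h2 := h.norm_symm_sub_le z
  have h3 := h.norm_M_frac_le (A.invFrac hα z)
  have h4 := norm_sub_norm_le (A₀.symm (M z)) (M (A.invFrac hα z : X))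
  rw [norm_sub_rev] at h4
  have h5 := mul_le_mul_of_nonneg_left h1 h.K_nonneg
  have h6 := norm_apply_le A₀ (A₀.symm (M z))
  rw [ContinuousLinearEquiv.apply_symm_apply] at h6
  have h7 : ‖A₀.symm (M z)‖ ≤ K * (2 + 2 * K ^ 2) * t * ‖z‖ := by linarith
  have h8 := mul_le_mul_of_nonneg_left h7 (norm_nonneg (A₀ : X₀ →L[ℝ] X₀))
  linarith

/-- Both `v` and `E M v` are close to `E A₀⁻¹ M y`. On `Y`, where `y = A v` is controlled by `v`,
this makes `E M` almost the identity. -/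
theorem norm_sub_E_M_le {v : A.FracSpace α} {y : X} (hv : A.invFrac hα y = v) :
    ‖v - E (M (v : X))‖ ≤ (1 + K ^ 2) * t * ‖y‖ := by
  have h1 := h.rate y
  have h2 := h.norm_symm_sub_le y
  have h3 := h.norm_E_le (A₀.symm (M y) - M (v : X))
  rw [hv] at h1 h2
  rw [norm_sub_rev] at h2
  rw [map_sub] at h3
  have h4 := norm_sub_le_norm_sub_add_norm_sub v (E (A₀.symm (M y))) (E (M (v : X)))
  have h5 := mul_le_mul_of_nonneg_left h2 h.K_nonneg
  linarith

theorem norm_A₀_M_sub_le {v : A.FracSpace α} {y : X} (hv : A.invFrac hα y = v) :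
    ‖A₀ (M (v : X)) - M y‖ ≤ ‖(A₀ : X₀ →L[ℝ] X₀)‖ * (K * t * ‖y‖) := by
  have h2 := h.norm_symm_sub_le y
  rw [hv] at h2
  have h3 := norm_apply_le A₀ (M (v : X) - A₀.symm (M y))
  rw [map_sub, ContinuousLinearEquiv.apply_symm_apply] at h3
  exact h3.trans (mul_le_mul_of_nonneg_left h2 (norm_nonneg _))

theorem norm_sub_fracProj_le {I : Set ℝ} (hI : A.EigGE Iᶜ (2 * ‖(A₀ : X₀ →L[ℝ] X₀)‖))
    {f : A.FracSpace α → X} (hf : Continuous f) (hK : ∀ u, ‖f u‖ ≤ K)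
    {T : ℝ → A.FracSpace α → A.FracSpace α} (hT : A.IsSolutionSemigroup f T)
    {D : ℝ} {w : A.FracSpace α}
    (hw : ∀ t, 0 ≤ t → ∃ v, T t v = w ∧ ‖v - A.fracProj α I v‖ ≤ D) :
    ‖w - A.fracProj α I w‖ ≤
      K * Real.Gamma (1 - α) * 2⁻¹ ^ (α - 1) * (1 + 2 * K ^ 2) * t := by
  have hα1 : 0 < 1 - α := by linarith [hα.2]
  -- An eigenvalue outside `I` forces `t > 0`, so that the threshold `Λ` below is meaningful;
  -- without one the projection is the identity.
  by_cases hex : ∃ μ, A.IsEig μ ∧ μ ∉ I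
  · obtain ⟨μ, hμ, hμI⟩ := hex
    have hlarge : ∀ μ ∈ Iᶜ, A.IsEig μ → μ ^ (α - 1) ≤ (1 + 2 * K ^ 2) * t := fun μ hμ he =>
      h.rpow_le_of_large he (hI μ hμ he)
    have hc : 0 < (1 + 2 * K ^ 2) * t :=
      (Real.rpow_pos_of_pos hμ.pos _).trans_le (hlarge μ hμI hμ)
    -- Chosen so that `Λ^{α-1}` equals the bound for large eigenvalues; the smoothing constant
    -- becomes linear in `t`.
    set Λ := ((1 + 2 * K ^ 2) * t) ^ (α - 1)⁻¹ with hΛ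
    have hΛ0 : 0 < Λ := Real.rpow_pos_of_pos hc _
    have hge : A.EigGE Iᶜ Λ := fun μ hμ he => rpow_inv_le_of_rpow_le hα.2 he.pos (hlarge μ hμ he)
    have h1 := hT.norm_sub_fracProj_le hα hf hΛ0 hge hK hw
    have h2 : Λ ^ (α - 1) = (1 + 2 * K ^ 2) * t := by
      rw [hΛ, ← Real.rpow_mul hc.le, inv_mul_cancel₀ (by linarith), Real.rpow_one]
    refine h1.trans (le_of_eq ?_)
    rw [smoothConst, div_eq_mul_inv, Real.mul_rpow hΛ0.le (by norm_num), h2]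
    ring
  · push Not at hex
    have : w - A.fracProj α I w = 0 := by
      rw [sub_eq_zero]
      refine A.coe_injective (A.ext_specProj_of_isEig fun μ hμ => ?_)
      change _ = A.specProj {μ} (A.specProj I (w : X))
      rw [A.specProj_singleton_specProj, indicator_of_mem (hex μ hμ), one_smul]
    rw [this, norm_zero]
    have := h.K_nonneg
    have := h.t_nonneg
    have := (Real.Gamma_pos_of_pos hα1).le
    positivity

end Connection

/-! ### Comparison of the reduced semigroup with the limit semigroup -/

/-- The growth constant of the reduced semigroup on `[0, 1]`. -/
noncomputable def growthConst (K b c : ℝ) : ℝ := c * Real.exp b + K / b * (Real.exp b - 1)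

/-- The constant in the estimate for the time-one map of the reduced semigroup. -/
noncomputable def comparisonConst (K a b c cs cM : ℝ) : ℝ :=
  (1 + K ^ 2) * (b * growthConst K b c) +
    K * ((a * K * (b * growthConst K b c) + K ^ 2 * ((1 + K ^ 2) * (b * growthConst K b c)) +
      K ^ 2 * cs + cM * K + K) / (a + K ^ 3 + 1) * (Real.exp (a + K ^ 3 + 1) - 1))

theorem growthConst_nonneg {K b c : ℝ} (hK : 0 ≤ K) (hb : 0 < b) (hc : 0 ≤ c) :
    0 ≤ growthConst K b c := by
  have := Real.one_le_exp hb.le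
  exact add_nonneg (by positivity) (mul_nonneg (by positivity) (by linarith))

theorem comparisonConst_nonneg {K a b c cs cM : ℝ} (hK : 0 ≤ K) (ha : 0 ≤ a) (hb : 0 < b)
    (hc : 0 ≤ c) (hcs : 0 ≤ cs) (hcM : 0 ≤ cM) : 0 ≤ comparisonConst K a b c cs cM := by
  have h1 := growthConst_nonneg hK hb hc
  have h2 : 0 ≤ Real.exp (a + K ^ 3 + 1) - 1 := by
    have := Real.one_le_exp (by positivity : 0 ≤ a + K ^ 3 + 1)
    linarith
  unfold comparisonConst
  positivity

/-- Here `y = A v` along the trajectory, with `A` bounded by `b` on `Y`. The form `v = A⁻¹ y` is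
what the resolvent estimates of `Connection` need. -/
theorem IsReducedSemigroup.exists_eq {f : A.FracSpace α → X} {I : Set ℝ}
    {s : A.fracY α I → A.fracZ α I} {S : ℝ → A.fracY α I → A.fracY α I}
    (hS : A.IsReducedSemigroup f s S) (hα : α ∈ Ioo (0 : ℝ) 1) {b : ℝ}
    (hI : ∀ μ ∈ I, μ ≤ b) (hb : 0 ≤ b) (w : A.fracY α I) {r : ℝ} (hr : 0 ≤ r) :
    ∃ y : X, A.invFrac hα y = (S r w : A.FracSpace α) ∧
      ‖y‖ ≤ b * ‖((S r w : A.FracSpace α) : X)‖ ∧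
      HasDerivWithinAt (fun r : ℝ => ((S r w : A.FracSpace α) : X))
        (-y + A.specProj I (f ((S r w : A.FracSpace α) + (s (S r w) : A.FracSpace α))))
        (Ici 0) r := by
  obtain ⟨hd, hderiv⟩ := (hS w).2 r hr
  refine ⟨_, A.coe_injective (A.inv_apply ⟨_, hd⟩), ?_, hderiv⟩
  refine A.norm_le_of_specProj hb fun μ hμ => ?_
  rw [A.specProj_graph (LinearPMap.mem_graph A.toLinearPMap ⟨_, hd⟩), norm_smul,
    Real.norm_of_nonneg hμ.pos.le]
  by_cases h : μ ∈ I
  · exact mul_le_mul_of_nonneg_right (hI μ h) (norm_nonneg _)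
  · simp [A.specProj_eq_zero_of_mem_fracY (S r w).2 h]

/-- Gronwall for `‖v'‖ ≤ b‖v‖ + K`. The origin of the factor `1 + ‖w‖` in the final estimate. -/
theorem IsReducedSemigroup.norm_le {f : A.FracSpace α → X} {I : Set ℝ}
    {s : A.fracY α I → A.fracZ α I} {S : ℝ → A.fracY α I → A.fracY α I}
    (hS : A.IsReducedSemigroup f s S) (hα : α ∈ Ioo (0 : ℝ) 1) {b c : ℝ}
    (hI : ∀ μ ∈ I, μ ≤ b) (hb : 0 < b) (hK0 : 0 ≤ K) (hK : ∀ u, ‖f u‖ ≤ K) (hc0 : 0 ≤ c)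
    (hc : ∀ x : A.FracSpace α, ‖(x : X)‖ ≤ c * ‖x‖)
    (w : A.fracY α I) {r : ℝ} (hr : r ∈ Icc (0 : ℝ) 1) :
    ‖((S r w : A.FracSpace α) : X)‖ ≤ growthConst K b c * (1 + ‖w‖) := by
  choose! y hy1 hy2 hy3 using fun r (hr : 0 ≤ r) => hS.exists_eq hα hI hb.le w hr
  have h1 := norm_le_gronwallBound_of_norm_deriv_right_le (a := 0) (b := 1) (K := b) (ε := K)
    (δ := c * ‖w‖)
    (f := fun r : ℝ => ((S r w : A.FracSpace α) : X))
    (fun r hr => ((hy3 r hr.1).continuousWithinAt).mono fun q hq => hq.1)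
    (fun r hr => (hy3 r hr.1).mono (Ici_subset_Ici.2 hr.1))
    (by
      rw [(hS w).1]
      exact hc w) (fun r hr => by
      refine (norm_add_le _ _).trans ?_
      rw [norm_neg]
      exact add_le_add (hy2 r hr.1) ((A.norm_specProj_le _ _).trans (hK _))) r hr
  refine h1.trans ?_
  rw [gronwallBound_of_K_ne_0 hb.ne', sub_zero]
  have h2 : Real.exp (b * r) ≤ Real.exp b := Real.exp_le_exp.2 (by nlinarith [hr.2])
  have h3 := Real.one_le_exp hb.le
  have hw := norm_nonneg w
  have h4 : 0 ≤ K / b := by positivity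
  have h5 : c * ‖w‖ * Real.exp (b * r) ≤ c * ‖w‖ * Real.exp b := by gcongr
  have h6 : K / b * (Real.exp (b * r) - 1) ≤ K / b * (Real.exp b - 1) := by gcongr
  have h7 : 0 ≤ c * Real.exp b := by positivity
  have h8 : 0 ≤ K / b * (Real.exp b - 1) := mul_nonneg h4 (by linarith)
  unfold growthConst
  nlinarith

/-- Gronwall for `d = M v - u₀`, which starts at `0`, followed by `v = (v - E M v) + E M v`. A
Lipschitz constant of `f₀` is not needed, because `hf₀` compares `f` and `f₀` at unrelated points.
-/
theorem IsReducedSemigroup.norm_sub_le {f : A.FracSpace α → X} {I : Set ℝ}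
    {s : A.fracY α I → A.fracZ α I} {S : ℝ → A.fracY α I → A.fracY α I}
    (hS : A.IsReducedSemigroup f s S) (h : Connection A A₀ hα E M K t) {b c cs cM ρ : ℝ}
    (hI : ∀ μ ∈ I, μ ≤ b) (hb : 0 < b) (hK : ∀ u, ‖f u‖ ≤ K) (hc0 : 0 ≤ c)
    (hc : ∀ x : A.FracSpace α, ‖(x : X)‖ ≤ c * ‖x‖)
    (hcs0 : 0 ≤ cs) (hcs : ∀ v, ‖s v‖ ≤ cs * t) (hcM0 : 0 ≤ cM)
    (hcM : ∀ x, ‖M (x - A.specProj I x)‖ ≤ cM * t * ‖x‖) (hρ : 0 ≤ ρ)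
    {f₀ : X₀ → X₀} (hf₀ : ∀ (u : A.FracSpace α) (u₀ : X₀),
      ‖f u - (E (f₀ u₀) : X)‖ ≤ K * ‖u - E u₀‖ + ρ)
    {T₀ : ℝ → X₀ → X₀} (hT₀ : IsODESemigroup A₀ f₀ T₀) (w : A.fracY α I) :
    ‖(S 1 w : A.FracSpace α) - E (T₀ 1 (M ((w : A.FracSpace α) : X)))‖ ≤
      comparisonConst K ‖(A₀ : X₀ →L[ℝ] X₀)‖ b c cs cM * (t + ρ) * (1 + ‖w‖) := by
  set a := ‖(A₀ : X₀ →L[ℝ] X₀)‖ with ha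
  have ha0 : 0 ≤ a := norm_nonneg _
  have hK0 := h.K_nonneg
  have ht0 := h.t_nonneg
  set R := growthConst K b c * (1 + ‖w‖) with hR
  have hG0 := growthConst_nonneg hK0 hb hc0
  have hw0 := norm_nonneg w
  have hR0 : 0 ≤ R := by positivity
  choose! y hy1 hy2 hy3 using fun r (hr : 0 ≤ r) => hS.exists_eq hα hI hb.le w hr
  have hyR : ∀ r ∈ Icc (0 : ℝ) 1, ‖y r‖ ≤ b * R := fun r hr =>
    (hy2 r hr.1).trans (mul_le_mul_of_nonneg_left (hS.norm_le hα hI hb hK0 hK hc0 hc w hr) hb.le)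
  set u₀ : ℝ → X₀ := fun r => T₀ r (M ((w : A.FracSpace α) : X)) with hu₀
  have hu₀0 : u₀ 0 = M ((w : A.FracSpace α) : X) := (hT₀ _).1
  set v : ℝ → A.FracSpace α := fun r => (S r w : A.FracSpace α) with hv
  set F : ℝ → X := fun r => f (v r + (s (S r w) : A.FracSpace α)) with hF
  set d : ℝ → X₀ := fun r => M (v r : X) - u₀ r with hd
  have hderiv : ∀ r, 0 ≤ r → HasDerivWithinAt d
      (M (-y r + A.specProj I (F r)) - (-A₀ (u₀ r) + f₀ (u₀ r))) (Ici 0) r := fun r hr =>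
    (M.hasFDerivAt.comp_hasDerivWithinAt r (hy3 r hr)).sub ((hT₀ _).2 r hr)
  have hvE : ∀ r ∈ Icc (0 : ℝ) 1, ‖v r - E (M (v r : X))‖ ≤ (1 + K ^ 2) * t * (b * R) :=
    fun r hr => (h.norm_sub_E_M_le (hy1 r hr.1)).trans
      (mul_le_mul_of_nonneg_left (hyR r hr) (by positivity))
  set D := a * (K * t * (b * R)) + K * (K * ((1 + K ^ 2) * t * (b * R) + cs * t) + ρ) + cM * t * K
    with hD
  have hbound : ∀ r ∈ Ico (0 : ℝ) 1,
      ‖M (-y r + A.specProj I (F r)) - (-A₀ (u₀ r) + f₀ (u₀ r))‖ ≤ (a + K ^ 3 + 1) * ‖d r‖ + D := by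
    intro r hr
    have hr' := Ico_subset_Icc_self hr
    -- The defect of `M` intertwining `A` and `A₀`, the linear term, the error of the nonlinearity
    -- and the part of `F` lost under `Q`.
    have e1 : M (-y r + A.specProj I (F r)) - (-A₀ (u₀ r) + f₀ (u₀ r)) =
        (A₀ (M (v r : X)) - M (y r)) - A₀ (d r) + M (F r - (E (f₀ (u₀ r)) : X)) -
          M (F r - A.specProj I (F r)) := by
      simp only [map_add, map_neg, map_sub, h.leftInv, hd]
      abel
    have b1 := (h.norm_A₀_M_sub_le (hy1 r hr.1)).trans (mul_le_mul_of_nonneg_left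
      (mul_le_mul_of_nonneg_left (hyR r hr') (by positivity : 0 ≤ K * t)) ha0)
    have b2 := norm_apply_le A₀ (d r)
    have b3 := (h.norm_M_le (F r - (E (f₀ (u₀ r)) : X))).trans
      (mul_le_mul_of_nonneg_left (hf₀ _ (u₀ r)) hK0)
    have b4 : ‖v r + (s (S r w) : A.FracSpace α) - E (u₀ r)‖ ≤
        (1 + K ^ 2) * t * (b * R) + cs * t + K * ‖d r‖ := by
      have e2 : v r + (s (S r w) : A.FracSpace α) - E (u₀ r) =
          (v r - E (M (v r : X))) + (s (S r w) : A.FracSpace α) + E (d r) := by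
        simp only [hd, map_sub]
        abel
      rw [e2]
      refine (norm_add₃_le).trans ?_
      exact add_le_add (add_le_add (hvE r hr') (hcs _)) (h.norm_E_le _)
    have b5 := (hcM (F r)).trans (mul_le_mul_of_nonneg_left (hK _)
      (by positivity : 0 ≤ cM * t))
    have b6 := mul_le_mul_of_nonneg_left (mul_le_mul_of_nonneg_left b4 hK0) hK0
    have b7 : ‖(A₀ (M (v r : X)) - M (y r)) - A₀ (d r) + M (F r - (E (f₀ (u₀ r)) : X)) -
        M (F r - A.specProj I (F r))‖ ≤ ‖A₀ (M (v r : X)) - M (y r)‖ + ‖A₀ (d r)‖ +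
        ‖M (F r - (E (f₀ (u₀ r)) : X))‖ + ‖M (F r - A.specProj I (F r))‖ :=
      (_root_.norm_sub_le _ _).trans (add_le_add_left ((norm_add_le _ _).trans
        (add_le_add_left (_root_.norm_sub_le _ _) _)) _)
    rw [e1]
    refine b7.trans ?_
    have := norm_nonneg (d r)
    rw [hD]
    nlinarith
  have hd1 := norm_le_gronwallBound_of_norm_deriv_right_le (a := 0) (b := 1)
    (K := a + K ^ 3 + 1) (ε := D) (δ := 0) (f := d)
    (fun r hr => ((hderiv r hr.1).continuousWithinAt).mono fun q hq => hq.1)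
    (fun r hr => (hderiv r hr.1).mono (Ici_subset_Ici.2 hr.1))
    (by
      simp only [hd, hu₀0, hv]
      rw [(hS w).1, sub_self, norm_zero]) hbound 1 (right_mem_Icc.2 zero_le_one)
  -- `a` comes from `A₀` and `K³` from `M`, `f` and `E` in turn; the `1` only excludes the
  -- degenerate form of the Gronwall bound.
  have hk : 0 < a + K ^ 3 + 1 := by positivity
  simp only [gronwallBound_of_K_ne_0 hk.ne', zero_mul, zero_add, sub_zero, mul_one] at hd1
  set k := a + K ^ 3 + 1 with hkdef
  have hexp : 0 ≤ Real.exp k - 1 := by linarith [Real.one_le_exp hk.le]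
  have e3 : v 1 - E (u₀ 1) = (v 1 - E (M (v 1 : X))) + E (d 1) := by
    simp only [hd, map_sub]
    abel
  have hfin : ‖v 1 - E (u₀ 1)‖ ≤ (1 + K ^ 2) * t * (b * R) + K * (D / k * (Real.exp k - 1)) := by
    rw [e3]
    exact (norm_add_le _ _).trans (add_le_add (hvE 1 (right_mem_Icc.2 zero_le_one))
      ((h.norm_E_le _).trans (mul_le_mul_of_nonneg_left hd1 hK0)))
  set G := growthConst K b c with hG
  set W := 1 + ‖w‖ with hW
  have hW1 : 1 ≤ W := by linarith
  set c₂ := a * K * (b * G) + K ^ 2 * ((1 + K ^ 2) * (b * G)) + K ^ 2 * cs + cM * K + K with hc₂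
  have hDle : D ≤ c₂ * ((t + ρ) * W) := by
    have q1 : t * W ≤ (t + ρ) * W := mul_le_mul_of_nonneg_right (by linarith) (by linarith)
    have q2 : t ≤ (t + ρ) * W := by nlinarith
    have q3 : ρ ≤ (t + ρ) * W := by nlinarith
    have p1 : 0 ≤ a * K * (b * G) + K ^ 2 * ((1 + K ^ 2) * (b * G)) := by positivity
    have p2 : 0 ≤ K ^ 2 * cs + cM * K := by positivity
    have r1 := mul_le_mul_of_nonneg_left q1 p1
    have r2 := mul_le_mul_of_nonneg_left q2 p2
    have r3 := mul_le_mul_of_nonneg_left q3 hK0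
    rw [hD, hR, hc₂]
    linarith
  have hfirst : (1 + K ^ 2) * t * (b * R) ≤ (1 + K ^ 2) * (b * G) * ((t + ρ) * W) := by
    have q1 : t * W ≤ (t + ρ) * W := mul_le_mul_of_nonneg_right (by linarith) (by linarith)
    have r1 := mul_le_mul_of_nonneg_left q1 (by positivity : 0 ≤ (1 + K ^ 2) * (b * G))
    rw [hR]
    linarith
  have hsecond : K * (D / k * (Real.exp k - 1)) ≤
      K * (c₂ * ((t + ρ) * W) / k * (Real.exp k - 1)) := by
    gcongr
  refine hfin.trans ((add_le_add hfirst hsecond).trans (le_of_eq ?_))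
  unfold comparisonConst
  rw [← hG, ← hkdef, ← hc₂]
  ring

end PosSelfAdjoint
end AttractorRate
namespace AttractorRate

universe u v

/-! ### The limit problem -/

section Limit

variable {V : Type v} [NormedAddCommGroup V] [NormedSpace ℝ V]

theorem IsODESemigroup.norm_le {A₀ : V ≃L[ℝ] V} {f₀ : V → V} {T₀ : ℝ → V → V}
    (hT₀ : IsODESemigroup A₀ f₀ T₀) {c R : ℝ} (hc : ∀ u, ‖f₀ u‖ ≤ c) {w : V} (hw : ‖w‖ ≤ R) :
    ∀ r ∈ Icc (0 : ℝ) 1, ‖T₀ r w‖ ≤ R * Real.exp (‖(A₀ : V →L[ℝ] V)‖ + 1) +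
      c / (‖(A₀ : V →L[ℝ] V)‖ + 1) * (Real.exp (‖(A₀ : V →L[ℝ] V)‖ + 1) - 1) := by
  intro r hr
  set a := ‖(A₀ : V →L[ℝ] V)‖ with ha
  have ha0 : 0 ≤ a := norm_nonneg _
  have hk : 0 < a + 1 := by positivity
  have h1 := norm_le_gronwallBound_of_norm_deriv_right_le (a := 0) (b := 1) (K := a + 1) (ε := c)
    (δ := R) (f := fun r : ℝ => T₀ r w)
    (fun r hr => (((hT₀ w).2 r hr.1).continuousWithinAt).mono fun q hq => hq.1)
    (fun r hr => ((hT₀ w).2 r hr.1).mono (Ici_subset_Ici.2 hr.1))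
    (by rwa [(hT₀ w).1]) (fun r hr => by
      refine (norm_add_le _ _).trans ?_
      rw [norm_neg]
      have h2 : ‖A₀ (T₀ r w)‖ ≤ a * ‖T₀ r w‖ := (A₀ : V →L[ℝ] V).le_opNorm _
      have := norm_nonneg (T₀ r w)
      linarith [hc (T₀ r w)]) r hr
  refine h1.trans ?_
  simp only [gronwallBound_of_K_ne_0 hk.ne', sub_zero]
  have hR : 0 ≤ R := (norm_nonneg w).trans hw
  have hc0 : 0 ≤ c := (norm_nonneg _).trans (hc 0)
  have h2 : (a + 1) * r ≤ a + 1 := by nlinarith [hr.2]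
  gcongr

/-- `f₀` is only locally Lipschitz, but being bounded it keeps trajectories from the `R`-ball in the
`R'`-ball up to time `1`. That ball is compact, so one Lipschitz constant serves Gronwall. -/
theorem IsODESemigroup.exists_lipschitz [ProperSpace V] {A₀ : V ≃L[ℝ] V} {f₀ : V → V}
    {T₀ : ℝ → V → V} (hT₀ : IsODESemigroup A₀ f₀ T₀) (hf₀ : ContDiff ℝ 1 f₀) {c : ℝ}
    (hc : ∀ u, ‖f₀ u‖ ≤ c) (R : ℝ) :
    ∃ L, 0 ≤ L ∧ ∀ u v, ‖u‖ ≤ R → ‖v‖ ≤ R → ‖T₀ 1 u - T₀ 1 v‖ ≤ L * ‖u - v‖ := by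
  set a := ‖(A₀ : V →L[ℝ] V)‖ with ha
  have ha0 : 0 ≤ a := norm_nonneg _
  set R' := R * Real.exp (a + 1) + c / (a + 1) * (Real.exp (a + 1) - 1) with hR'
  obtain ⟨L, hL⟩ := hf₀.locallyLipschitz.locallyLipschitzOn.exists_lipschitzOnWith_of_compact
    (isCompact_closedBall (0 : V) R')
  refine ⟨Real.exp (a + L), (Real.exp_pos _).le, fun u v hu hv => ?_⟩
  have h1 := norm_le_gronwallBound_of_norm_deriv_right_le (a := 0) (b := 1) (K := a + L) (ε := 0)
    (δ := ‖u - v‖) (f := fun r : ℝ => T₀ r u - T₀ r v)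
    (fun r hr => ((((hT₀ u).2 r hr.1).sub ((hT₀ v).2 r hr.1)).continuousWithinAt).mono
      fun q hq => hq.1)
    (fun r hr => (((hT₀ u).2 r hr.1).sub ((hT₀ v).2 r hr.1)).mono (Ici_subset_Ici.2 hr.1))
    (by rw [(hT₀ u).1, (hT₀ v).1]) (fun r hr => by
      have hr' := Ico_subset_Icc_self hr
      have e : -A₀ (T₀ r u) + f₀ (T₀ r u) - (-A₀ (T₀ r v) + f₀ (T₀ r v)) =
          -A₀ (T₀ r u - T₀ r v) + (f₀ (T₀ r u) - f₀ (T₀ r v)) := by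
        rw [map_sub]
        abel
      rw [e]
      refine (norm_add_le _ _).trans ?_
      rw [norm_neg, add_zero, add_mul]
      refine add_le_add ((A₀ : V →L[ℝ] V).le_opNorm _) ?_
      exact hL.norm_sub_le (mem_closedBall_zero_iff.2 (hT₀.norm_le hc hu r hr'))
        (mem_closedBall_zero_iff.2 (hT₀.norm_le hc hv r hr'))) 1 (right_mem_Icc.2 zero_le_one)
  rwa [gronwallBound_ε0, sub_zero, mul_one, mul_comm] at h1

/-- A nonempty set has infinite semidistance to the empty set, which therefore attracts nothing. -/
theorem IsGlobalAttractor.nonempty {W : Type v} [NormedAddCommGroup W] {T : ℝ → W → W} {𝒜 : Set W}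
    (h : IsGlobalAttractor T 𝒜) : 𝒜.Nonempty := by
  by_contra hne
  rw [not_nonempty_iff_eq_empty] at hne
  have h1 := h.attracts {0} Bornology.isBounded_singleton
  have h2 : ∀ t, semidist (T t '' {0}) 𝒜 = ⊤ := fun t => by
    simp [semidist, hne]
  simp only [h2] at h1
  exact ENNReal.top_ne_zero (tendsto_nhds_unique tendsto_const_nhds h1)

end Limit

/-- Triangle inequality through `P '' S`. Nonemptiness and boundedness keep the extended distances
finite, as the real-valued distance would otherwise be `0` by default. -/
theorem hausdorffDist_le_add_of_norm_sub_le {W : Type v} [NormedAddCommGroup W] {S S' : Set W}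
    {P : W → W} (hS : S.Nonempty) (hSb : Bornology.IsBounded S) (hS' : S'.Nonempty)
    (hSb' : Bornology.IsBounded S') {r : ℝ} (hr : 0 ≤ r) (h : ∀ w ∈ S, ‖w - P w‖ ≤ r) :
    Metric.hausdorffDist S S' ≤ r + Metric.hausdorffDist (P '' S) S' := by
  have hPb : Bornology.IsBounded (P '' S) := by
    obtain ⟨D, hD⟩ := hSb.exists_norm_le
    refine isBounded_iff_forall_norm_le.2 ⟨D + r, ?_⟩
    rintro _ ⟨w, hw, rfl⟩
    have h1 := norm_le_norm_add_norm_sub' (P w) w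
    rw [norm_sub_rev] at h1
    linarith [h w hw, hD w hw]
  have h1 : Metric.hausdorffDist S (P '' S) ≤ r := by
    refine Metric.hausdorffDist_le_of_mem_dist hr (fun w hw => ⟨P w, ⟨w, hw, rfl⟩, ?_⟩) ?_
    · rw [dist_eq_norm]
      exact h w hw
    · rintro _ ⟨w, hw, rfl⟩
      exact ⟨w, hw, by rw [dist_comm, dist_eq_norm]; exact h w hw⟩
  have h2 := Metric.hausdorffDist_triangle' (s := S)
    (Metric.hausdorffEDist_ne_top_of_nonempty_of_bounded (hS.image P) hS' hPb hSb')
  linarith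

/-! ### Convergence of the bounded part of the spectrum. -/

namespace PosSelfAdjoint

section Eigen

variable {X : Type u} [NormedAddCommGroup X] [InnerProductSpace ℝ X] [CompleteSpace X]
  {A : PosSelfAdjoint X} {α : ℝ} (hα : α ∈ Ioo (0 : ℝ) 1)

theorem invFrac_smul_coe (c : ℝ) (u : A.FracSpace α) :
    A.invFrac hα ((c • u : A.FracSpace α) : X) = c • A.invFrac hα (u : X) := by
  rw [← map_smul]
  rfl

theorem exists_unit_eigenvector {μ : ℝ} (hμ : A.IsEig μ) :
    ∃ u : A.FracSpace α, ‖u‖ = 1 ∧ A.invFrac hα (u : X) = μ⁻¹ • u := by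
  have hpos := hμ.pos
  obtain ⟨x, hx, h0⟩ := hμ
  set w := A.invFrac hα x with hw
  have hwx : (w : X) = μ⁻¹ • x := A.inv_of_mem_eigenspace hx
  have hwne : 0 < ‖w‖ := by
    rw [hw, A.norm_invFrac_of_mem_eigenspace hα hx]
    have := norm_pos_iff.2 h0
    positivity
  refine ⟨‖w‖⁻¹ • w, ?_, ?_⟩
  · rw [norm_smul, norm_inv, norm_norm, inv_mul_cancel₀ hwne.ne']
  · rw [invFrac_smul_coe, hwx, map_smul, smul_comm]

theorem norm_invFrac_coe_le {m : ℝ} (hm : 0 < m) (h : ∀ μ, A.IsEig μ → m ≤ μ)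
    (u : A.FracSpace α) : ‖A.invFrac hα (u : X)‖ ≤ m⁻¹ * ‖u‖ := by
  rw [← (A.fracEquiv hα).norm_map, ← (A.fracEquiv hα).norm_map u]
  refine A.norm_le_of_specProj (by positivity) fun μ hμ => ?_
  have hpos := hμ.pos
  rw [A.specProj_fracEquiv_invFrac, A.specProj_coe hα, smul_smul, ← Real.rpow_add hpos,
    show α - 1 + -α = -1 by ring, Real.rpow_neg_one, norm_smul, norm_inv,
    Real.norm_of_nonneg hpos.le]
  have := h μ hμ
  gcongr

end Eigen

end PosSelfAdjoint

open PosSelfAdjoint in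
/-- Under compact convergence the eigenvalues of `A_ε` that do not converge to eigenvalues of `A₀`
tend to infinity. -/
theorem CompactlyConverges.exists_eigGE {X₀ : Type v} [NormedAddCommGroup X₀]
    [InnerProductSpace ℝ X₀] [Nontrivial X₀]
    {X : ℝ → Type u} [∀ ε, NormedAddCommGroup (X ε)] [∀ ε, InnerProductSpace ℝ (X ε)]
    [∀ ε, CompleteSpace (X ε)] {ε₀ : ℝ} (hε₀ : 0 < ε₀) {A : ∀ ε, PosSelfAdjoint (X ε)}
    {A₀ : X₀ ≃L[ℝ] X₀}
    {α : ℝ} {hα : α ∈ Ioo (0 : ℝ) 1} {E : ∀ ε, X₀ →L[ℝ] (A ε).FracSpace α}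
    (hCC : CompactlyConverges ε₀ A A₀ hα E) {K : ℝ} {τ : ℝ → ℝ} {M : ∀ ε, X ε →L[ℝ] X₀}
    (hcon : ∀ ε ∈ Ioc 0 ε₀, Connection (A ε) A₀ hα (E ε) (M ε) K (τ ε)) {m : ℝ} (hm : 0 < m)
    (hlow : ∀ ε ∈ Ioc 0 ε₀, ∀ μ, (A ε).IsEig μ → m ≤ μ) {I : Set ℝ} (hI : IsOpen I)
    (hspec : ∀ (μ : ℝ) (u : X₀), u ≠ 0 → A₀ u = μ • u → μ ∈ I) (Λ : ℝ) :
    ∃ ε₁ ∈ Ioc 0 ε₀, ∀ ε ∈ Ioc 0 ε₁, (A ε).EigGE Iᶜ Λ := by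
  by_contra hcontra
  push Not at hcontra
  set Bad : ℝ → ℝ → Prop := fun ε μ => (A ε).IsEig μ ∧ μ ∉ I ∧ μ ≤ Λ with hBad
  have hbad : ∀ k : ℕ, ∃ ε, ε ∈ Ioc 0 ε₀ ∧ ε ≤ 1 / ((k : ℝ) + 1) ∧ ∃ μ, Bad ε μ := by
    intro k
    have hk : (0 : ℝ) < 1 / ((k : ℝ) + 1) := by positivity
    obtain ⟨ε, hε, h⟩ := hcontra (min ε₀ (1 / ((k : ℝ) + 1)))
      ⟨lt_min hε₀ hk, min_le_left _ _⟩
    refine ⟨ε, ⟨hε.1, hε.2.trans (min_le_left _ _)⟩, hε.2.trans (min_le_right _ _), ?_⟩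
    unfold EigGE at h
    push Not at h
    obtain ⟨μ, h1, h2, h3⟩ := h
    exact ⟨μ, h2, h1, h3.le⟩
  choose e he0 he1 μ hμ using hbad
  have he : Tendsto e atTop (𝓝 0) :=
    squeeze_zero (fun k => (he0 k).1.le) he1 tendsto_one_div_add_atTop_nhds_zero_nat
  have he' : Tendsto e atTop (𝓝[>] 0) :=
    tendsto_nhdsWithin_iff.2 ⟨he, Eventually.of_forall fun k => (he0 k).1⟩
  -- a family of unit vectors which are eigenvectors of bad eigenvalues whenever possible
  have hu : ∀ ε, ∃ u : (A ε).FracSpace α, (ε ∈ Ioc 0 ε₀ → ‖u‖ = 1) ∧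
      (ε ∈ Ioc 0 ε₀ → (∃ μ, Bad ε μ) → ∃ μ, Bad ε μ ∧ (A ε).invFrac hα (u : X ε) = μ⁻¹ • u) := by
    intro ε
    by_cases hex : ∃ μ, Bad ε μ
    · obtain ⟨μ, hμ⟩ := hex
      obtain ⟨u, hu1, hu2⟩ := exists_unit_eigenvector hα hμ.1
      exact ⟨u, fun _ => hu1, fun _ _ => ⟨μ, hμ, hu2⟩⟩
    · by_cases hε : ε ∈ Ioc 0 ε₀
      · obtain ⟨x, hx⟩ := exists_ne (0 : X₀)
        have hEx : E ε x ≠ 0 := by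
          intro h0
          have h1 := (hcon ε hε).leftInv x
          rw [h0] at h1
          exact hx (h1.symm.trans ((M ε).map_zero))
        refine ⟨‖E ε x‖⁻¹ • E ε x, fun _ => ?_, fun _ h => absurd h hex⟩
        rw [norm_smul, norm_inv, norm_norm, inv_mul_cancel₀ (norm_ne_zero_iff.2 hEx)]
      · exact ⟨0, fun h => absurd h hε, fun h => absurd h hε⟩
  choose u hu1 hu2 using hu
  obtain ⟨φ, hφ, u₀, hu₀⟩ := hCC.2 u hu1 e he0 he
  choose ν hν1 hν2 using fun k => hu2 (e (φ k)) (he0 _) ⟨μ (φ k), hμ (φ k)⟩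
  have hνmem : ∀ k, ν k ∈ Icc m Λ := fun k => ⟨hlow _ (he0 _) _ (hν1 k).1, (hν1 k).2.2⟩
  -- The bad eigenvalues stay in `[m, Λ]`, so they accumulate, and the limit is outside `I` because
  -- `I` is open.
  obtain ⟨μs, hμs, ψ, hψ, hlim⟩ := isCompact_Icc.tendsto_subseq hνmem
  have hμsI : μs ∉ I := by
    have : μs ∈ Iᶜ := hI.isClosed_compl.mem_of_tendsto hlim
      (Eventually.of_forall fun k => (hν1 (ψ k)).2.1)
    exact this
  have hμs0 : 0 < μs := hm.trans_le hμs.1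
  set e' : ℕ → ℝ := fun k => e (φ (ψ k)) with he'def
  have he'0 : ∀ k, e' k ∈ Ioc 0 ε₀ := fun k => he0 _
  have hθ : Tendsto (fun k => φ (ψ k)) atTop atTop := hφ.tendsto_atTop.comp hψ.tendsto_atTop
  have hE' : Tendsto e' atTop (𝓝[>] 0) := he'.comp hθ
  have hK0 := (hcon _ (he'0 0)).K_nonneg
  -- `A⁻¹ u_k → u₀`
  have h1 : Tendsto (fun k => ‖(ν (ψ k))⁻¹ • u (e' k) - E (e' k) u₀‖) atTop (𝓝 0) := by
    refine (hu₀.comp hψ.tendsto_atTop).congr fun k => ?_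
    simp only [Function.comp_apply, hν2]
    rfl
  -- `u_k - ν_k u₀ → 0`
  have h2 : Tendsto (fun k => ‖u (e' k) - ν (ψ k) • E (e' k) u₀‖) atTop (𝓝 0) := by
    refine squeeze_zero (fun _ => norm_nonneg _) (fun k => ?_) (by simpa using h1.const_mul Λ)
    have hpos : 0 < ν (ψ k) := hm.trans_le (hνmem _).1
    have e1 : u (e' k) - ν (ψ k) • E (e' k) u₀ =
        ν (ψ k) • ((ν (ψ k))⁻¹ • u (e' k) - E (e' k) u₀) := by
      rw [smul_sub, smul_smul, mul_inv_cancel₀ hpos.ne', one_smul]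
    rw [e1, norm_smul, Real.norm_of_nonneg hpos.le]
    exact mul_le_mul_of_nonneg_right (hνmem _).2 (norm_nonneg _)
  -- If `u₀` vanished, the unit vectors `u` would tend to `0`.
  have hu₀ne : u₀ ≠ 0 := by
    rintro rfl
    have h3 : Tendsto (fun _ : ℕ => (1 : ℝ)) atTop (𝓝 0) := by
      refine h2.congr fun k => ?_
      rw [map_zero, smul_zero, sub_zero, hu1 _ (he'0 k)]
    exact one_ne_zero (tendsto_nhds_unique tendsto_const_nhds h3)
  -- `A⁻¹ E u₀ - E A₀⁻¹ u₀ → 0`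
  have h3 : Tendsto (fun k => ‖(A (e' k)).invFrac hα (E (e' k) u₀ : X (e' k)) -
      E (e' k) (A₀.symm u₀)‖) atTop (𝓝 0) :=
    (hCC.1 (fun ε => E ε u₀) u₀ (by simp)).comp hE'
  -- Telescoping under `E` and applying `M` gives a bound in `X₀` that tends to `0`. In the limit
  -- `u₀` is an eigenvector of `A₀` for `μs`, which contradicts `μs ∉ I`.
  have hkey : ∀ k, ‖u₀ - ν (ψ k) • A₀.symm u₀‖ ≤
      K * (‖(ν (ψ k))⁻¹ • u (e' k) - E (e' k) u₀‖ +
        m⁻¹ * ‖u (e' k) - ν (ψ k) • E (e' k) u₀‖ +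
        Λ * ‖(A (e' k)).invFrac hα (E (e' k) u₀ : X (e' k)) - E (e' k) (A₀.symm u₀)‖) := by
    intro k
    have hpos : 0 < ν (ψ k) := hm.trans_le (hνmem _).1
    have c1 := (hcon _ (he'0 k)).norm_M_frac_le (E (e' k) (u₀ - ν (ψ k) • A₀.symm u₀))
    rw [(hcon _ (he'0 k)).leftInv] at c1
    refine c1.trans (mul_le_mul_of_nonneg_left ?_ hK0)
    have hinv := hν2 (ψ k)
    have e1 : E (e' k) (u₀ - ν (ψ k) • A₀.symm u₀) =
        -((ν (ψ k))⁻¹ • u (e' k) - E (e' k) u₀) +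
        ((ν (ψ k))⁻¹ • u (e' k) -
          ν (ψ k) • (A (e' k)).invFrac hα (E (e' k) u₀ : X (e' k))) +
        ν (ψ k) • ((A (e' k)).invFrac hα (E (e' k) u₀ : X (e' k)) - E (e' k) (A₀.symm u₀)) := by
      rw [map_sub, map_smul, smul_sub]
      abel
    have e2 : (ν (ψ k))⁻¹ • u (e' k) - ν (ψ k) • (A (e' k)).invFrac hα (E (e' k) u₀ : X (e' k)) =
        (A (e' k)).invFrac hα ((u (e' k) - ν (ψ k) • E (e' k) u₀ : (A (e' k)).FracSpace α) :
          X (e' k)) := by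
      rw [← hinv, ← invFrac_smul_coe, ← map_sub]
      rfl
    rw [e1]
    refine norm_add₃_le.trans (add_le_add (add_le_add ?_ ?_) ?_)
    · rw [norm_neg]
    · rw [e2]
      exact norm_invFrac_coe_le hα hm (hlow _ (he'0 k)) _
    · rw [norm_smul, Real.norm_of_nonneg hpos.le]
      exact mul_le_mul_of_nonneg_right (hνmem _).2 (norm_nonneg _)
  have h4 : Tendsto (fun k => ‖u₀ - ν (ψ k) • A₀.symm u₀‖) atTop (𝓝 0) := by
    refine squeeze_zero (fun _ => norm_nonneg _) hkey ?_
    have := ((h1.add (h2.const_mul m⁻¹)).add (h3.const_mul Λ)).const_mul K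
    simpa using this
  have h5 : Tendsto (fun k => ‖u₀ - ν (ψ k) • A₀.symm u₀‖) atTop
      (𝓝 ‖u₀ - μs • A₀.symm u₀‖) :=
    (tendsto_const_nhds.sub (hlim.smul_const _)).norm
  have h6 : u₀ = μs • A₀.symm u₀ :=
    sub_eq_zero.1 (norm_eq_zero.1 (tendsto_nhds_unique h5 h4))
  refine hμsI (hspec μs u₀ hu₀ne ?_)
  have h7 := congrArg A₀ h6
  rwa [map_smul, ContinuousLinearEquiv.apply_symm_apply] at h7

end AttractorRate
-- Choice of the constants and proof of the theorem.
theorem mainTheorem4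
    -- the finite dimensional limit space, the limit operator and its spectrum
    {X₀ : Type*} [NormedAddCommGroup X₀] [InnerProductSpace ℝ X₀] [FiniteDimensional ℝ X₀]
    (n : ℕ) (hn : 0 < n) (hdim : Module.finrank ℝ X₀ = n)
    (A₀ : X₀ ≃L[ℝ] X₀) (lam : Fin n → ℝ) (hlam : StrictMono lam) (hlam_pos : ∀ i, 0 < lam i)
    (hspec : spectrum ℝ (A₀ : X₀ →L[ℝ] X₀) = Set.range lam)
    -- the perturbed spaces and operators, indexed by `0 < ε ≤ ε₀`
    (ε₀ : ℝ) (hε₀ : 0 < ε₀)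
    {X : ℝ → Type*} [∀ ε, NormedAddCommGroup (X ε)] [∀ ε, InnerProductSpace ℝ (X ε)]
    [∀ ε, CompleteSpace (X ε)]
    (A : ∀ ε, PosSelfAdjoint (X ε)) (α : ℝ) (hα : α ∈ Set.Ioo (0 : ℝ) 1)
    -- a constant that does not depend on `ε`
    (K : ℝ)
    -- the nonlinearities
    (f₀ : X₀ → X₀) (hf₀ : ContDiff ℝ 1 f₀)
    (f : ∀ ε, (A ε).FracSpace α → X ε)
    (hf : ∀ ε ∈ Set.Ioc 0 ε₀, ContDiff ℝ 1 (f ε))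
    (hf_bdd : ∀ ε ∈ Set.Ioc 0 ε₀, ∀ u, ‖f ε u‖ ≤ K)
    (hf_lip : ∀ ε ∈ Set.Ioc 0 ε₀, ∀ u v, ‖f ε u - f ε v‖ ≤ K * ‖u - v‖)
    -- the nonlinear semigroups and their global attractors
    (T₀ : ℝ → X₀ → X₀) (hT₀ : IsODESemigroup A₀ f₀ T₀)
    (T : ∀ ε, ℝ → (A ε).FracSpace α → (A ε).FracSpace α)
    (hT : ∀ ε ∈ Set.Ioc 0 ε₀, (A ε).IsSolutionSemigroup (f ε) (T ε))
    (𝒜₀ : Set X₀) (h𝒜₀ : IsGlobalAttractor T₀ 𝒜₀)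
    (𝒜 : ∀ ε, Set ((A ε).FracSpace α))
    (h𝒜 : ∀ ε ∈ Set.Ioc 0 ε₀, IsGlobalAttractor (T ε) (𝒜 ε))
    (h𝒜_bdd : ∀ ε ∈ Set.Ioc 0 ε₀, ∀ u ∈ 𝒜 ε, ‖u‖ ≤ K)
    -- the operators connecting the spaces
    (E : ∀ ε, X₀ →L[ℝ] (A ε).FracSpace α) (M : ∀ ε, X ε →L[ℝ] X₀)
    (hME : ∀ ε ∈ Set.Ioc 0 ε₀, ∀ u, M ε (E ε u : X ε) = u)
    (hE_norm : ∀ u, Filter.Tendsto (fun ε => ‖(E ε u : X ε)‖) (nhdsWithin 0 (Set.Ioi 0)) (nhds ‖u‖))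
    (hE : ∀ ε ∈ Set.Ioc 0 ε₀, ∀ u, ‖(E ε u : X ε)‖ ≤ K * ‖u‖)
    (hE_frac : ∀ ε ∈ Set.Ioc 0 ε₀, ∀ u, ‖E ε u‖ ≤ K * ‖u‖)
    (hM : ∀ ε ∈ Set.Ioc 0 ε₀, ∀ x, ‖M ε x‖ ≤ K * ‖x‖)
    (hM_frac : ∀ ε ∈ Set.Ioc 0 ε₀, ∀ x : (A ε).FracSpace α, ‖M ε (x : X ε)‖ ≤ K * ‖x‖)
    -- compact convergence, and the rates for the resolvents and the nonlinearities
    (hCC : CompactlyConverges ε₀ A A₀ hα E)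
    (τ ρ : ℝ → ℝ) (hτ : MonotoneOn τ (Set.Icc 0 ε₀)) (hρ : MonotoneOn ρ (Set.Icc 0 ε₀))
    (hτ_zero : τ 0 = 0) (hρ_zero : ρ 0 = 0)
    (hrate_inv : ∀ ε ∈ Set.Ioc 0 ε₀, ∀ x : X ε,
      ‖(A ε).invFrac hα x - E ε (A₀.symm (M ε x))‖ ≤ τ ε * ‖x‖)
    (hrate_f : ∀ ε ∈ Set.Ioc 0 ε₀, ∀ (u : (A ε).FracSpace α) (u₀ : X₀),
      ‖f ε u - (E ε (f₀ u₀) : X ε)‖ ≤ K * ‖u - E ε u₀‖ + ρ ε)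
    -- the interval cut out by the contour that defines the spectral projections
    (δ : ℝ) (hδ : 0 < δ) (I : Set ℝ)
    (hI : I = Set.Ioo (lam ⟨0, hn⟩ - δ) (lam ⟨n - 1, Nat.sub_lt hn one_pos⟩ + δ)) :
    ∃ C > 0, ∃ ε₁ ∈ Set.Ioc 0 ε₀, ∀ ε ∈ Set.Ioc 0 ε₁,
      -- the invariant manifold exists, as the graph of a bounded Lipschitz map `s`
      (∃ s : (A ε).fracY α I → (A ε).fracZ α I, (∃ L, LipschitzWith L s) ∧
        (∃ D, ∀ v, ‖s v‖ ≤ D) ∧ IsInvariantManifold (T ε) ((A ε).graphOf s)) ∧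
      -- estimate for the reduced time-one map on the invariant manifold
      (∀ s : (A ε).fracY α I → (A ε).fracZ α I, (∃ L, LipschitzWith L s) →
        (∃ D, ∀ v, ‖s v‖ ≤ D) → IsInvariantManifold (T ε) ((A ε).graphOf s) →
        (∃ S, (A ε).IsReducedSemigroup (f ε) s S) ∧
        ∀ S, (A ε).IsReducedSemigroup (f ε) s S → ∀ w : (A ε).fracY α I,
          ‖(S 1 w : (A ε).FracSpace α) - E ε (T₀ 1 (M ε ((w : (A ε).FracSpace α) : X ε)))‖
            ≤ C * (τ ε + ρ ε) * (1 + ‖w‖)) ∧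
      -- Lipschitz estimate for the limit time-one map
      (∀ w ∈ 𝒜 ε, ∀ w₀ ∈ 𝒜₀,
        ‖E ε (T₀ 1 (M ε ((A ε).fracProj α I w : X ε))) - E ε (T₀ 1 w₀)‖
          ≤ C * ‖(A ε).fracProj α I w - E ε w₀‖) ∧
      -- estimate for the attractors
      Metric.hausdorffDist (𝒜 ε) (E ε '' 𝒜₀) ≤ C * (τ ε + ρ ε) +
        Metric.hausdorffDist ((A ε).fracProj α I '' 𝒜 ε) (E ε '' 𝒜₀) := by
  

  obtain ⟨hα0, hα1⟩ := id hα
  have hε₀mem : ε₀ ∈ Set.Ioc 0 ε₀ := ⟨hε₀, le_rfl⟩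
  have hK0 : 0 ≤ K := (norm_nonneg _).trans (hf_bdd ε₀ hε₀mem 0)
  have hτ0 : ∀ ε ∈ Set.Ioc 0 ε₀, 0 ≤ τ ε := fun ε hε => by
    rw [← hτ_zero]
    exact hτ ⟨le_rfl, hε₀.le⟩ ⟨hε.1.le, hε.2⟩ hε.1.le
  have hρ0 : ∀ ε ∈ Set.Ioc 0 ε₀, 0 ≤ ρ ε := fun ε hε => by
    rw [← hρ_zero]
    exact hρ ⟨le_rfl, hε₀.le⟩ ⟨hε.1.le, hε.2⟩ hε.1.le
  have hτle : ∀ ε ∈ Set.Ioc 0 ε₀, τ ε ≤ τ ε₀ := fun ε hε =>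
    hτ ⟨hε.1.le, hε.2⟩ ⟨hε₀.le, le_rfl⟩ hε.2
  have hcon : ∀ ε ∈ Set.Ioc 0 ε₀, (A ε).Connection A₀ hα (E ε) (M ε) K (τ ε) := fun ε hε =>
    ⟨hK0, hτ0 ε hε, hME ε hε, hE_frac ε hε, hM ε hε, hM_frac ε hε, hrate_inv ε hε⟩
  have hnt : Nontrivial X₀ := Module.nontrivial_of_finrank_pos (R := ℝ) (by rw [hdim]; exact hn)
  -- uniform lower bound for the eigenvalues
  set c₁ := τ ε₀ + K ^ 2 * ‖(A₀.symm : X₀ →L[ℝ] X₀)‖ + 1 with hc₁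
  have hc₁pos : 0 < c₁ := by
    have := hτ0 ε₀ hε₀mem
    positivity
  set m := c₁ ^ (α - 1)⁻¹ with hmdef
  have hm : 0 < m := Real.rpow_pos_of_pos hc₁pos _
  have hlow : ∀ ε ∈ Set.Ioc 0 ε₀, ∀ μ, (A ε).IsEig μ → m ≤ μ := fun ε hε μ hμ =>
    PosSelfAdjoint.rpow_inv_le_of_rpow_le hα1 hμ.pos (by
      have h1 := (hcon ε hε).rpow_le hμ
      have h2 := hτle ε hε
      linarith)
  -- the interval `I`
  set b := lam ⟨n - 1, Nat.sub_lt hn one_pos⟩ + δ with hbdef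
  have hb : 0 < b := by
    have := hlam_pos ⟨n - 1, Nat.sub_lt hn one_pos⟩
    linarith
  have hIle : ∀ μ ∈ I, μ ≤ b := fun μ hμ => by
    rw [hI] at hμ
    exact hμ.2.le
  have hIopen : IsOpen I := by
    rw [hI]
    exact isOpen_Ioo
  have hIspec : ∀ (μ : ℝ) (u : X₀), u ≠ 0 → A₀ u = μ • u → μ ∈ I := by
    intro μ u hu hμ
    have hmem : μ ∈ spectrum ℝ (A₀ : X₀ →L[ℝ] X₀) := by
      intro hunit
      obtain ⟨V, hV⟩ := hunit
      have h1 : (V : X₀ →L[ℝ] X₀) u = 0 := by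
        rw [hV, sub_apply, Algebra.algebraMap_eq_smul_one,
          smul_apply, one_apply_eq_self,
          ContinuousLinearEquiv.coe_coe, hμ, sub_self]
      have h2 : ((V⁻¹ : (X₀ →L[ℝ] X₀)ˣ) : X₀ →L[ℝ] X₀) ((V : X₀ →L[ℝ] X₀) u) = u := by
        rw [← mul_apply_eq_comp, Units.inv_mul, one_apply_eq_self]
      rw [h1, map_zero] at h2
      exact hu h2.symm
    rw [hspec] at hmem
    obtain ⟨i, rfl⟩ := hmem
    rw [hI]
    have h1 : lam ⟨0, hn⟩ ≤ lam i := hlam.monotone (Fin.mk_le_of_le_val (Nat.zero_le _))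
    have h2 : lam i ≤ lam ⟨n - 1, Nat.sub_lt hn one_pos⟩ :=
      hlam.monotone (Fin.le_def.2 (Nat.le_sub_one_of_lt i.2))
    exact ⟨by linarith, by linarith⟩
  -- the spectral gap
  set σ := b + 4 * K * b ^ α + 1 with hσ
  have hbα : 0 < b ^ α := Real.rpow_pos_of_pos hb α
  have hσb : 0 < σ - b := by
    have : 0 ≤ 4 * K * b ^ α := by positivity
    linarith
  -- `GapData.small` allows `1/2`: the summand `4Kb^α` of `σ` takes one quarter, and `Λ₁` below the
  -- other.
  have hsmall₁ : K * (b ^ α / (σ - b)) ≤ 1 / 4 := by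
    rw [← mul_div_assoc, div_le_iff₀ hσb]
    linarith
  obtain ⟨Λ₁, hΛ₁, hΛ₁pos⟩ : ∃ Λ₁, K * smoothConst α Λ₁ ≤ 1 / 4 ∧ 0 < Λ₁ := by
    have h1 := (tendsto_smoothConst hα1).const_mul K
    rw [mul_zero] at h1
    obtain ⟨Λ₁, h2, h3⟩ := ((h1.eventually (gt_mem_nhds (by norm_num : (0 : ℝ) < 1 / 4))).and
      (Filter.eventually_gt_atTop 0)).exists
    exact ⟨Λ₁, h2.le, h3⟩
  set a := ‖(A₀ : X₀ →L[ℝ] X₀)‖ with ha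
  have ha0 : 0 ≤ a := norm_nonneg _
  -- `2a` admits the estimate for large eigenvalues; `Λ = 2(Λ₁ + σ)` makes `Λ/2 - σ = Λ₁` in the gap
  -- condition.
  obtain ⟨ε₁, hε₁, hgap⟩ := hCC.exists_eigGE hε₀ hcon hm hlow hIopen hIspec
    (max (2 * a) (2 * (Λ₁ + σ)))
  -- the limit problem
  have hf₀bdd : ∀ u, ‖f₀ u‖ ≤ K * (K + ρ ε₀) := by
    intro u
    -- At `E u` the Lipschitz term vanishes, and `f₀ u = M E (f₀ u)`, so the bound of `f` at `ε₀`
    -- passes to `f₀`.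
    have h1 := hrate_f ε₀ hε₀mem (E ε₀ u) u
    rw [sub_self, norm_zero, mul_zero, zero_add] at h1
    have h2 := hM ε₀ hε₀mem (E ε₀ (f₀ u) : X ε₀)
    rw [hME ε₀ hε₀mem] at h2
    have h3 := norm_le_norm_add_norm_sub (f ε₀ (E ε₀ u)) (E ε₀ (f₀ u) : X ε₀)
    have h4 := hf_bdd ε₀ hε₀mem (E ε₀ u)
    exact h2.trans (mul_le_mul_of_nonneg_left (by linarith) hK0)
  obtain ⟨R, hR⟩ := h𝒜₀.isCompact.isBounded.exists_norm_le
  -- `K * K` bounds `M Q w` for `w` in any of the attractors, and `R` bounds `𝒜₀`.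
  obtain ⟨L, hL0, hL⟩ := hT₀.exists_lipschitz hf₀ hf₀bdd (max (K * K) R)
  -- the constants
  set c := m ^ (-α) with hc
  have hc0 : 0 ≤ c := (Real.rpow_pos_of_pos hm _).le
  set cs := K * Real.Gamma (1 - α) * 2⁻¹ ^ (α - 1) * (1 + 2 * K ^ 2) with hcs
  have hcs0 : 0 ≤ cs := by
    have := Real.Gamma_pos_of_pos (by linarith : 0 < 1 - α)
    positivity
  set cM := a * (K * (2 + 2 * K ^ 2)) with hcM
  have hcM0 : 0 ≤ cM := by positivity
  have hcc0 := PosSelfAdjoint.comparisonConst_nonneg hK0 ha0 hb hc0 hcs0 hcM0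
  set C := PosSelfAdjoint.comparisonConst K a b c cs cM + K * (L * K) + cs + 1 with hC
  have hKLK : 0 ≤ K * (L * K) := by positivity
  refine ⟨C, by positivity, ε₁, hε₁, fun ε hε' => ?_⟩
  have hε : ε ∈ Set.Ioc 0 ε₀ := ⟨hε'.1, hε'.2.trans hε₁.2⟩
  have hconε := hcon ε hε
  have hTε := hT ε hε
  have hlarge : (A ε).EigGE Iᶜ (2 * a) := fun μ hμ he =>
    (le_max_left _ _).trans (hgap ε hε' μ hμ he)
  have hdata : (A ε).GapData I (f ε) K b σ (2 * (Λ₁ + σ)) :=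
    { mem := hα
      pos := hb
      le := hIle
      ge := fun μ hμ he => (le_max_right _ _).trans (hgap ε hε' μ hμ he)
      lt := by linarith
      lt' := by linarith
      bdd := hf_bdd ε hε
      lip := hf_lip ε hε
      small := by
        have e1 : 2 * (Λ₁ + σ) / 2 - σ = Λ₁ := by ring
        rw [e1, mul_add]
        linarith }
  have hfc := hdata.continuous_f
  have hτε := hτ0 ε hε
  have hρε := hρ0 ε hε
  refine ⟨hdata.exists_invariantManifold hTε, fun s _ hsD hsinv => ⟨?_, fun S hS w => ?_⟩,
    fun w hw w₀ hw₀ => ?_, ?_⟩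
  · exact hTε.exists_isReducedSemigroup hα hIle hb.le hfc hsinv
  · have hsub : ∀ v : (A ε).fracY α I,
        ((v : (A ε).FracSpace α) + (s v : (A ε).FracSpace α)) -
          (A ε).fracProj α I ((v : (A ε).FracSpace α) + (s v : (A ε).FracSpace α)) = s v :=
      fun v => by
        rw [map_add, (A ε).mem_fracY_iff.1 v.2, (A ε).mem_fracZ_iff.1 (s v).2, add_zero,
          add_sub_cancel_left]
    obtain ⟨D, hD⟩ := hsD
    -- The bound `D` of `s` need not be uniform in `ε`: the global solutions in the graph supply
    -- backward orbits of every length, along which `D` is damped away.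
    have hsbd : ∀ v, ‖s v‖ ≤ cs * τ ε := by
      intro v
      obtain ⟨ξ, -, h1, h2, h3⟩ := hsinv _ ⟨v, rfl⟩
      have h4 := hconε.norm_sub_fracProj_le hlarge hfc (hf_bdd ε hε) hTε (D := D)
        (w := (v : (A ε).FracSpace α) + (s v : (A ε).FracSpace α)) (fun t ht => ⟨ξ (-t), ?_, ?_⟩)
      · rw [hsub] at h4
        exact h4
      · rw [h1 _ _ ht, add_neg_cancel, h2]
      · obtain ⟨v', hv'⟩ := h3 (-t)
        rw [← hv', hsub]
        exact hD v'
    have hMbd : ∀ x, ‖M ε (x - (A ε).specProj I x)‖ ≤ cM * τ ε * ‖x‖ := by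
      intro x
      refine (hconε.norm_M_le_of_specProj_eq_zero hlarge fun μ hμ => ?_).trans
        (mul_le_mul_of_nonneg_left ((A ε).norm_sub_specProj_le I x) (by positivity))
      rw [map_sub, (A ε).specProj_singleton_specProj, Set.indicator_of_mem hμ, one_smul, sub_self]
    have h1 := hS.norm_sub_le hconε hIle hb (hf_bdd ε hε) hc0
      ((A ε).norm_coe_le hα hm (hlow ε hε)) hcs0 hsbd hcM0 hMbd hρε (hrate_f ε hε) hT₀ w
    refine h1.trans ?_
    gcongr
    linarith
  · set q := (A ε).fracProj α I w with hq
    have hqK : ‖q‖ ≤ K := ((A ε).norm_fracProj_le hα I w).trans (h𝒜_bdd ε hε w hw)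
    have h1 : ‖M ε (q : X ε)‖ ≤ K * K :=
      (hM_frac ε hε q).trans (mul_le_mul_of_nonneg_left hqK hK0)
    have h2 := hL (M ε (q : X ε)) w₀ (h1.trans (le_max_left _ _))
      ((hR w₀ hw₀).trans (le_max_right _ _))
    have h3 := hM_frac ε hε (q - E ε w₀)
    rw [PosSelfAdjoint.map_coe_sub, hME ε hε] at h3
    have h4 := hE_frac ε hε (T₀ 1 (M ε (q : X ε)) - T₀ 1 w₀)
    rw [map_sub] at h4
    have h5 : ‖E ε (T₀ 1 (M ε (q : X ε))) - E ε (T₀ 1 w₀)‖ ≤ K * (L * (K * ‖q - E ε w₀‖)) :=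
      h4.trans (mul_le_mul_of_nonneg_left
        (h2.trans (mul_le_mul_of_nonneg_left h3 hL0)) hK0)
    refine h5.trans ?_
    have h6 : K * (L * (K * ‖q - E ε w₀‖)) = K * (L * K) * ‖q - E ε w₀‖ := by ring
    rw [h6]
    gcongr
    linarith
  · have hattr := h𝒜 ε hε
    -- Invariance of the attractor supplies the backward orbits, with `Z` part bounded by `K`.
    have hZ : ∀ w ∈ 𝒜 ε, ‖w - (A ε).fracProj α I w‖ ≤ cs * τ ε := by
      intro w hw
      refine hconε.norm_sub_fracProj_le hlarge hfc (hf_bdd ε hε) hTε (D := K) fun t ht => ?_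
      rw [← hattr.invariant t ht] at hw
      obtain ⟨v, hv, rfl⟩ := hw
      exact ⟨v, rfl, (PosSelfAdjoint.norm_sub_fracProj_le_self hα I v).trans
        (h𝒜_bdd ε hε v hv)⟩
    have h1 := hausdorffDist_le_add_of_norm_sub_le hattr.nonempty hattr.isCompact.isBounded
      (h𝒜₀.nonempty.image (E ε)) (h𝒜₀.isCompact.image (E ε).continuous).isBounded
      (by positivity) hZ
    refine h1.trans (add_le_add_left ?_ _)
    have h2 : cs * τ ε ≤ C * τ ε := by
      gcongr
      linarith
    have h3 : 0 ≤ C * ρ ε := by positivity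
    linarith
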